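/- Let $0<\alpha<1$, let $\zeta_c,\zeta_b\in\mathbb C$, and let $D$ be the open unit disk. Let $\mathscr O$ be the set of all bounded simply connected domains $\Omega\subset\mathbb C$ of class $C^{1,\alpha}$ (locally, up to a rigid motion, the region above the graph of a $C^{1,\alpha}$ function) with $\zeta_c\in\Omega$ and $\zeta_b\in\partial\Omega$. Let $\mathscr F$ be the class of all one-to-one $f\in C^{1,\alpha}(\overline D)$, analytic in $D$, with $f(0)=\zeta_c$ and $f(1)=\zeta_b$. For $\Omega\in\mathscr O$ with boundary length $L=|\partial\Omega|$, let $U$ be its Green's function with pole $\zeta_c$, i.e. $-\Delta U=\delta_{\zeta_c}$ in $\Omega$ and $U=0$ on $\partial\Omega$; equivalently, $U(\zeta)+\frac1{2\pi}\log|\zeta-\zeta_c|$ extends to a harmonic function in $\Omega$, $U$ is continuous on $\overline\Omega\setminus\{\zeta_c\}$, and $U=0$ on $\partial\Omega$. The interior normal derivative $\frac{\partial U}{\partial\nu}$ on $\partial\Omega$ is regarded as a function on $[0,L]$ of the arclength measured counterclockwise from $\zeta_b$. For $f\in\mathscr F$ with $f'\neq0$ on $\partial D$ put $s_f(\theta)=\int_0^\theta|f'(e^{it})|\,dt$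 for $\theta\in[0,2\pi]$. The function $\mathcal T(f)$ on $[0,s_f(2\pi)]$ is defined by $\mathcal T(f)(s_f(\theta))=\frac1{2\pi|f'(e^{i\theta})|}$, $\theta\in[0,2\pi]$. In what follows, $\mathcal T(f)=\varphi$ for a function $\varphi$ on $[0,L]$ includes the requirements that $f'\ne0$ on $\partial D$ and $s_f(2\pi)=L$. **Theorem.** (1) Let $\Omega\in\mathscr O$, $L=|\partial\Omega|$, and let $\varphi:[0,L]\to\mathbb R$ be the interior normal derivative of the Green's function of $\Omega$ with pole $\zeta_c$, as a function of the arclength measured counterclockwise from $\zeta_b$. Then $\varphi$ is continuous and positive, $\Phi(s)=2\pi\int_0^s\varphi(\sigma)\,d\sigma$ is a bijection of $[0,L]$ onto $[0,2\pi]$, and there is a unique $f\in\mathscr F$ with $\mathcal T(f)=\varphi$. Moreover $f(D)=\Omega$ and, with $s=\Phi^{-1}$, $$f'(z)=e^{i\gamma}\exp\left\{\frac1{2\pi}\int_0^{2\pi}\frac{e^{it}+z}{e^{it}-z}\log\frac1{2\pi\varphi(s(t))}\,dt\right\},\qquad z\in D,$$ where $\gamma\in\mathbb R$ is determined, uniquely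 modulo $2\pi$, by $$e^{i\gamma}\int_0^1\exp\left\{\frac1{2\pi}\int_0^{2\pi}\frac{e^{i\tau}+t}{e^{i\tau}-t}\log\frac1{2\pi\varphi(s(\tau))}\,d\tau\right\}dt=\zeta_b-\zeta_c.$$ (2) The forward operator is injective. If $\Omega_1,\Omega_2\in\mathscr O$ have the same boundary length $L$ and the same function $\varphi$ on $[0,L]$ as interior normal derivative of the Green's function with pole $\zeta_c$ (as a function of the arclength measured counterclockwise from $\zeta_b$), then $\Omega_1=\Omega_2$; and if $f,g\in\mathscr F$ satisfy $\mathcal T(f)=\mathcal T(g)=\varphi$ for some function $\varphi$ on $[0,L]$, then $f=g$ on $\overline D$. -/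

import Mathlib

noncomputable section

namespace GreenInverse

/-- `Ω` is of class `C^{1,α}`: near every boundary point, after a rigid motion (translation of the
point to the origin followed by a rotation), `Ω` is the region above the graph of a function
`g : ℝ → ℝ` of class `C^{1,α}`. -/
def IsC1HolderDomain (α : ℝ) (Ω : Set ℂ) : Prop :=
  ∀ p ∈ frontier Ω, ∃ (u : ℂ) (r : ℝ) (g : ℝ → ℝ), ‖u‖ = 1 ∧ 0 < r ∧ Differentiable ℝ g ∧
    (∃ C : ℝ, ∀ x y : ℝ, |deriv g x - deriv g y| ≤ C * |x - y| ^ α) ∧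
    ∀ x y : ℝ, p + u * (x + y * Complex.I) ∈ Metric.ball p r →
      (p + u * (x + y * Complex.I) ∈ Ω ↔ g x < y)

/-- The class `𝒪` of bounded simply connected domains of class `C^{1,α}` that contain `ζc` and have
`ζb` on their boundary. -/
structure MemO (α : ℝ) (ζc ζb : ℂ) (Ω : Set ℂ) : Prop where
  isOpen : IsOpen Ω
  isBounded : Bornology.IsBounded Ω
  simplyConnected : IsSimplyConnected Ω
  c1Holder : IsC1HolderDomain α Ω
  center_mem : ζc ∈ Ω
  base_mem : ζb ∈ frontier Ω

/-- `U` is the Green's function of `Ω` with pole `ζc`, that is `-ΔU = δ_{ζc}` in `Ω` and `U = 0` on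
the boundary: `U` differs from the fundamental solution `-(1/2π) log |ζ - ζc|` by a function that is
harmonic in `Ω`, it is continuous up to the boundary and vanishes there. The value `U ζc` is
irrelevant. -/
structure IsGreenFunction (Ω : Set ℂ) (ζc : ℂ) (U : ℂ → ℝ) : Prop where
  harmonic : ∃ h : ℂ → ℝ, InnerProductSpace.HarmonicOnNhd h Ω ∧
    ∀ ζ ∈ Ω, ζ ≠ ζc → U ζ = -(1 / (2 * Real.pi)) * Real.log ‖ζ - ζc‖ + h ζ
  continuousOn : ContinuousOn U (closure Ω \ {ζc})
  boundary : ∀ ζ ∈ frontier Ω, U ζ = 0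

/-- `c` is the (periodically continued) parametrization of the boundary of `Ω` by arclength,
starting at `ζb` and running counterclockwise, that is with `Ω` on its left; `L` is the length of
the boundary. In particular `i c'(s)` is the interior unit normal at `c(s)`. -/
structure IsArclengthParam (Ω : Set ℂ) (ζb : ℂ) (L : ℝ) (c : ℝ → ℂ) : Prop where
  length_pos : 0 < L
  contDiff : ContDiff ℝ 1 c
  unit_speed : ∀ s, ‖deriv c s‖ = 1
  periodic : Function.Periodic c L
  injOn : Set.InjOn c (Set.Ico 0 L)
  range_eq : Set.range c = frontier Ω
  base : c 0 = ζb
  counterclockwise : ∀ s, ∀ᶠ t : ℝ in nhdsWithin 0 (Set.Ioi 0),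
    c s + t * (Complex.I * deriv c s) ∈ Ω

/-- `φ`, as a function on `[0, L]` with `L` the length of the boundary, is the interior normal
derivative of the Green's function of `Ω` with pole `ζc`, as a function of the arclength measured
counterclockwise from `ζb`. -/
def IsGreenNormalDeriv (ζc ζb : ℂ) (Ω : Set ℂ) (L : ℝ) (φ : ℝ → ℝ) : Prop :=
  ∃ (U : ℂ → ℝ) (c : ℝ → ℂ), IsGreenFunction Ω ζc U ∧ IsArclengthParam Ω ζb L c ∧
    ∀ s ∈ Set.Icc 0 L,
      HasDerivWithinAt (fun t : ℝ => U (c s + t * (Complex.I * deriv c s))) (φ s) (Set.Ici 0) 0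

/-- The derivative of `f` as a function on the closed unit disk. -/
def diskDeriv (f : ℂ → ℂ) (z : ℂ) : ℂ :=
  derivWithin f (Metric.closedBall 0 1) z

/-- The class `ℱ` of one-to-one analytic maps of class `C^{1,α}` on the closed unit disk with
`f 0 = ζc` and `f 1 = ζb`. Only the values of `f` on the closed disk matter. -/
structure MemF (α : ℝ) (ζc ζb : ℂ) (f : ℂ → ℂ) : Prop where
  differentiableOn : DifferentiableOn ℂ f (Metric.closedBall 0 1)
  holder : ∃ C : ℝ, ∀ z ∈ Metric.closedBall (0 : ℂ) 1, ∀ w ∈ Metric.closedBall (0 : ℂ) 1,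
    ‖diskDeriv f z - diskDeriv f w‖ ≤ C * ‖z - w‖ ^ α
  injOn : Set.InjOn f (Metric.closedBall 0 1)
  map_zero : f 0 = ζc
  map_one : f 1 = ζb

/-- Arclength along the image of the unit circle: `∫₀^θ |f'(e^{it})| dt`. -/
def arclength (f : ℂ → ℂ) (θ : ℝ) : ℝ :=
  ∫ t in (0 : ℝ)..θ, ‖diskDeriv f (Complex.exp (t * Complex.I))‖

/-- `𝒯(f) = φ` as functions on `[0, L]`. The function `𝒯(f)` is given parametrically by
`s = ∫₀^θ |f'(e^{it})| dt`, `𝒯(f)(s) = 1 / (2π |f'(e^{iθ})|)`, `θ ∈ [0, 2π]`; it is defined when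
`f'` has no zero on the unit circle. -/
def IsForwardImage (f : ℂ → ℂ) (L : ℝ) (φ : ℝ → ℝ) : Prop :=
  arclength f (2 * Real.pi) = L ∧
    ∀ θ ∈ Set.Icc 0 (2 * Real.pi), diskDeriv f (Complex.exp (θ * Complex.I)) ≠ 0 ∧
      φ (arclength f θ) = 1 / (2 * Real.pi * ‖diskDeriv f (Complex.exp (θ * Complex.I))‖)

/-- `Φ(s) = 2π ∫₀^s φ`. -/
def Phi (φ : ℝ → ℝ) (s : ℝ) : ℝ :=
  2 * Real.pi * ∫ σ in (0 : ℝ)..s, φ σ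

/-- The inverse of `Φ : [0, L] → [0, 2π]`. -/
def PhiInv (φ : ℝ → ℝ) (L : ℝ) (θ : ℝ) : ℝ :=
  Function.invFunOn (Phi φ) (Set.Icc 0 L) θ

/-- `exp ((1/2π) ∫₀^{2π} (e^{it} + z) / (e^{it} - z) log (1 / (2π φ(s(t)))) dt)`, `s = Φ⁻¹`. -/
def outerExp (φ : ℝ → ℝ) (L : ℝ) (z : ℂ) : ℂ :=
  Complex.exp ((1 / (2 * Real.pi) : ℝ) * ∫ t in (0 : ℝ)..(2 * Real.pi),
    (Complex.exp (t * Complex.I) + z) / (Complex.exp (t * Complex.I) - z) *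
      (Real.log (1 / (2 * Real.pi * φ (PhiInv φ L t))) : ℝ))

/-- The condition on `γ`: `e^{iγ} ∫₀¹ exp (…)(t) dt = ζb - ζc`. -/
def GammaCondition (ζc ζb : ℂ) (φ : ℝ → ℝ) (L γ : ℝ) : Prop :=
  Complex.exp (γ * Complex.I) * ∫ t in (0 : ℝ)..1, outerExp φ L (t : ℂ) = ζb - ζc

end GreenInverse

end

open GreenInverse

/-! A conformal map `f` of the disk onto `Ω` with `f 0 = ζc` pulls the Green's function back to that
of the disk: `U ∘ f = -(1/2π) log|z|`. Since `f` stretches lengths at `e^{iθ}` by `|f'|`, the normal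
derivative of `U` at `f(e^{iθ})` is `1/(2π|f'(e^{iθ})|)`, and the arclength there is `s_f(θ)`. So
the Riemann map normalized by `f 1 = ζb` satisfies `𝒯(f) = φ`, provided that `f'` extends
continuously and without zeros to the circle.

Conversely, `φ` determines `f`. The substitution `s = s_f(t)` makes the integrand of `Φ` constant,
so `Φ` inverts `s_f`, and `log(1/(2πφ(s(t))))` is `log|f'(e^{it})|`. As `f'` has no zeros, `log|f'|`
is harmonic and is the Poisson integral of these boundary values. Schwarz's formula then gives `f'`
up to a factor `e^{iγ}`, and the values of `f` at `0` and `1` fix this factor and the constant of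
integration (`IsForwardImage.exists_deriv_eq`, `MemF.gammaCondition_iff`). Injectivity for domains
follows because `Ω = f(D)`.

The bulk of the work is boundary regularity: the Riemann mapping theorem followed by Kellogg's
theorem. Near a boundary point `p` with inner normal `ν`, points are written `p + ν v`; the boundary
stays within `K|v|^{1+α}` of its tangent (`IsFlat`). The real part of `v ± A v^{1+α}` then serves as
a barrier, and the maximum principle makes `1 - |F|`, `F = f⁻¹`, comparable to the distance to the
boundary. Schwarz–Pick bounds `F'` and `f'`, so `f` extends to a Lipschitz injection of the closed
disk. Hence the real part of `(f - f(z₀))/ν` is `O(|ζ - z₀|^{1+α})` on the circle. Schwarz's formula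
turns this into `|f''| ≤ C(1 - |z|)^{α-1}` (`norm_deriv_deriv_le`), and integration gives a Hölder
extension of `f'`, nonzero because `F'` is bounded. -/

namespace GreenInverse

/-! ### Maximum principle, disk automorphisms and univalent functions -/

open Set Metric Filter Topology Bornology
open scoped ComplexConjugate

/-- Maximum modulus principle with a `limsup` condition at the boundary. -/
lemma norm_le_of_frontier_limsup {V : Set ℂ} (hVo : IsOpen V) (hVb : IsBounded V) {f : ℂ → ℂ}
    (hf : DifferentiableOn ℂ f V) {C : ℝ}
    (h : ∀ z ∈ frontier V, ∀ ε > 0, ∀ᶠ w in 𝓝[V] z, ‖f w‖ ≤ C + ε) {z : ℂ} (hz : z ∈ V) :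
    ‖f z‖ ≤ C := by
  refine le_of_forall_pos_le_add fun ε hε => ?_
  by_contra! hlt
  -- The boundary condition keeps the superlevel set `W` away from `frontier V`, so `f` is
  -- holomorphic up to the closure of `W` and the ordinary maximum principle applies there, with
  -- `‖f‖ ≤ C + ε` on `frontier W`.
  set W : Set ℂ := V ∩ {w | C + ε < ‖f w‖}
  have hWV : closure W ⊆ V := by
    intro w hw
    by_contra hwV
    have hwcl : w ∈ closure V := closure_mono inter_subset_left hw
    have hfr : w ∈ frontier V := ⟨hwcl, by rwa [hVo.interior_eq]⟩
    have h1 := h w hfr ε hε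
    rw [mem_closure_iff_frequently] at hw
    rw [eventually_nhdsWithin_iff] at h1
    obtain ⟨x, hx, hx'⟩ := (hw.and_eventually h1).exists
    exact absurd (hx' hx.1) (not_le.2 hx.2)
  have hd : DiffContOnCl ℂ f W := (hf.mono hWV).diffContOnCl
  have hzW : z ∈ W := ⟨hz, hlt⟩
  have hWo : IsOpen W := hf.continuousOn.norm.isOpen_inter_preimage hVo isOpen_Ioi
  refine absurd (Complex.norm_le_of_forall_mem_frontier_norm_le (hVb.subset inter_subset_left) hd
    (C := C + ε) (fun w hw => ?_) (subset_closure hzW)) (not_le.2 hlt)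
  by_contra! hw2
  have : w ∈ W := ⟨hWV hw.1, hw2⟩
  exact hw.2 (by rwa [hWo.interior_eq])

/-- The automorphism of the unit disk that sends `a` to `0`. -/
noncomputable def mobius (a z : ℂ) : ℂ := (z - a) / (1 - conj a * z)

lemma mobius_denom_ne_zero {a z : ℂ} (ha : ‖a‖ < 1) (hz : ‖z‖ ≤ 1) : 1 - conj a * z ≠ 0 := by
  intro h
  have h1 : ‖conj a * z‖ = 1 := by rw [← sub_eq_zero.1 h]; simp
  rw [norm_mul, RCLike.norm_conj] at h1
  nlinarith [norm_nonneg a, norm_nonneg z]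

lemma norm_mobius_lt_one {a z : ℂ} (ha : ‖a‖ < 1) (hz : ‖z‖ < 1) : ‖mobius a z‖ < 1 := by
  have hne := mobius_denom_ne_zero ha hz.le
  rw [mobius, norm_div, div_lt_one (norm_pos_iff.2 hne)]
  refine lt_of_pow_lt_pow_left₀ 2 (norm_nonneg _) ?_
  rw [Complex.sq_norm, Complex.sq_norm, Complex.normSq_apply, Complex.normSq_apply]
  have h1 : a.re * a.re + a.im * a.im < 1 := by
    rw [← Complex.normSq_apply, ← Complex.sq_norm]; nlinarith [norm_nonneg a]
  have h2 : z.re * z.re + z.im * z.im < 1 := by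
    rw [← Complex.normSq_apply, ← Complex.sq_norm]; nlinarith [norm_nonneg z]
  simp only [Complex.sub_re, Complex.sub_im, Complex.mul_re, Complex.mul_im, Complex.conj_re,
    Complex.conj_im, Complex.one_re, Complex.one_im]
  nlinarith [mul_pos (sub_pos.2 h1) (sub_pos.2 h2)]

lemma mobius_self (a : ℂ) : mobius a a = 0 := by simp [mobius]

lemma mobius_neg_mobius {a z : ℂ} (ha : ‖a‖ < 1) (hz : ‖z‖ < 1) :
    mobius (-a) (mobius a z) = z := by
  have hne := mobius_denom_ne_zero ha hz.le
  have hne2 := mobius_denom_ne_zero (a := -a) (by simpa) (norm_mobius_lt_one ha hz).le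
  rw [mobius, div_eq_iff hne2]
  simp only [mobius, map_neg]
  generalize conj a = b at hne
  have h : (z - a) / (1 - b * z) * (1 - b * z) = z - a := div_mul_cancel₀ _ hne
  generalize (z - a) / (1 - b * z) = w at h
  linear_combination h

lemma hasDerivAt_mobius {a z : ℂ} (ha : ‖a‖ < 1) (hz : ‖z‖ < 1) :
    HasDerivAt (mobius a) ((1 - conj a * a) / (1 - conj a * z) ^ 2) z := by
  have hne := mobius_denom_ne_zero ha hz.le
  have h := ((hasDerivAt_id z).sub_const a).fun_div
    (((hasDerivAt_id z).const_mul (conj a)).const_sub 1) hne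
  refine h.congr_deriv ?_
  simp only [id]
  congr 1
  ring

lemma differentiableOn_mobius {a : ℂ} (ha : ‖a‖ < 1) :
    DifferentiableOn ℂ (mobius a) (ball 0 1) := fun _ hz =>
  (hasDerivAt_mobius ha (by simpa using hz)).differentiableAt.differentiableWithinAt

lemma mapsTo_mobius {a : ℂ} (ha : ‖a‖ < 1) : MapsTo (mobius a) (ball 0 1) (ball 0 1) :=
  fun z hz => by simpa using norm_mobius_lt_one ha (by simpa using hz)

lemma injOn_mobius {a : ℂ} (ha : ‖a‖ < 1) : InjOn (mobius a) (ball 0 1) := by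
  intro z hz w hw h
  rw [← mobius_neg_mobius (z := z) ha (by simpa using hz), h,
    mobius_neg_mobius ha (by simpa using hw)]

/-- Infinitesimal Schwarz–Pick lemma on a disk. -/
lemma norm_deriv_le_schwarz_pick {F : ℂ → ℂ} {c : ℂ} {R : ℝ} (hR : 0 < R)
    (hd : DifferentiableOn ℂ F (ball c R)) (hm : MapsTo F (ball c R) (ball 0 1)) :
    ‖deriv F c‖ ≤ (1 - ‖F c‖ ^ 2) / R := by
  have hc : c ∈ ball c R := mem_ball_self hR
  have ha : ‖F c‖ < 1 := by simpa using hm hc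
  have hdc : DifferentiableAt ℂ F c := hd.differentiableAt (isOpen_ball.mem_nhds hc)
  -- Moving `F c` to the origin reduces to the Schwarz lemma; the automorphism has derivative `1 /
  -- (1 - ‖F c‖ ^ 2)` at `F c`.
  have h1 : HasDerivAt (mobius (F c) ∘ F) _ c := (hasDerivAt_mobius ha ha).comp c hdc.hasDerivAt
  have h2 := Complex.norm_deriv_le_div_of_mapsTo_ball (f := mobius (F c) ∘ F) (R₂ := 1)
    ((differentiableOn_mobius ha).comp hd hm)
    (fun z hz => by
      rw [Function.comp, Function.comp, mobius_self]
      exact ball_subset_closedBall (mapsTo_mobius ha (hm hz))) hR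
  have h3 : (conj (F c) * F c : ℂ) = ((‖F c‖ ^ 2 : ℝ) : ℂ) := by
    rw [mul_comm, Complex.mul_conj, Complex.normSq_eq_norm_sq]
  have h4 : 0 < 1 - ‖F c‖ ^ 2 := by nlinarith [norm_nonneg (F c)]
  rw [h1.deriv, h3, norm_mul, norm_div, norm_pow, ← Complex.ofReal_one, ← Complex.ofReal_sub,
    Complex.norm_real, Real.norm_of_nonneg h4.le] at h2
  have h5 : (1 - ‖F c‖ ^ 2) / (1 - ‖F c‖ ^ 2) ^ 2 = (1 - ‖F c‖ ^ 2)⁻¹ := by field_simp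
  rw [h5, inv_mul_le_iff₀ h4] at h2
  calc _ ≤ _ := h2
    _ = _ := by ring

/-- An injective holomorphic function has an open image and maps neighborhoods to
neighborhoods. -/
lemma nhds_le_map_of_injOn {f : ℂ → ℂ} {U : Set ℂ} (hU : IsOpen U) (hf : DifferentiableOn ℂ f U)
    (hi : InjOn f U) {z : ℂ} (hz : z ∈ U) : 𝓝 (f z) ≤ map f (𝓝 z) := by
  refine ((hf.analyticAt (hU.mem_nhds hz)).eventually_constant_or_nhds_le_map_nhds).resolve_left
    fun h => ?_
  have h1 : ∀ᶠ w in 𝓝[≠] z, f w = f z ∧ w ∈ U :=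
    (h.and (hU.mem_nhds hz)).filter_mono nhdsWithin_le_nhds
  obtain ⟨w, hw, hw'⟩ := (h1.and self_mem_nhdsWithin).exists
  exact hw' (hi hw.2 hz hw.1)

lemma isOpen_image_of_injOn {f : ℂ → ℂ} {U : Set ℂ} (hU : IsOpen U) (hf : DifferentiableOn ℂ f U)
    (hi : InjOn f U) : IsOpen (f '' U) := by
  rw [isOpen_iff_mem_nhds]
  rintro _ ⟨z, hz, rfl⟩
  exact nhds_le_map_of_injOn hU hf hi hz (image_mem_map (hU.mem_nhds hz))

lemma continuousAt_of_leftInvOn {f g : ℂ → ℂ} {U : Set ℂ} (hU : IsOpen U)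
    (hf : DifferentiableOn ℂ f U) (hg : LeftInvOn g f U) {z : ℂ} (hz : z ∈ U) :
    ContinuousAt g (f z) := by
  have h1 := nhds_le_map_of_injOn hU hf hg.injOn hz
  rw [ContinuousAt, hg hz]
  refine (Tendsto.mono_left ?_ h1)
  rw [tendsto_map'_iff]
  refine tendsto_id.congr' ?_
  filter_upwards [hU.mem_nhds hz] with w hw using (hg hw).symm

/-- The inverse of an injective holomorphic function is holomorphic. -/
lemma hasDerivAt_of_leftInvOn {f g : ℂ → ℂ} {U : Set ℂ} (hU : IsOpen U)
    (hf : DifferentiableOn ℂ f U) (hg : LeftInvOn g f U) {z : ℂ} (hz : z ∈ U) :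
    deriv f z ≠ 0 ∧ HasDerivAt g (deriv f z)⁻¹ (f z) := by
  have hnhds : ∀ w ∈ U, f '' U ∈ 𝓝 (f w) := fun w hw =>
    nhds_le_map_of_injOn hU hf hg.injOn hw (image_mem_map (hU.mem_nhds hw))
  have key : ∀ w ∈ U, deriv f w ≠ 0 → HasDerivAt g (deriv f w)⁻¹ (f w) := by
    intro w hw hne
    have h1 : HasDerivAt f (deriv f w) (g (f w)) := by
      rw [hg hw]; exact (hf.differentiableAt (hU.mem_nhds hw)).hasDerivAt
    refine h1.of_local_left_inverse (continuousAt_of_leftInvOn hU hf hg hw) hne ?_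
    filter_upwards [hnhds w hw]
    rintro _ ⟨x, hx, rfl⟩
    rw [hg hx]
  suffices h : deriv f z ≠ 0 from ⟨h, key z hz h⟩
  -- Zeros of `f'` are isolated, since otherwise `f` would be locally constant. So `g` is
  -- holomorphic on a punctured neighborhood of `f z` and continuous there; the singularity is
  -- removable, and the chain rule for `g ∘ f = id` excludes `f' z = 0`.
  have hda : AnalyticAt ℂ (deriv f) z := (hf.analyticAt (hU.mem_nhds hz)).deriv
  have hev : ∀ᶠ w in 𝓝[≠] z, deriv f w ≠ 0 := by
    refine hda.eventually_eq_zero_or_eventually_ne_zero.resolve_left fun h => ?_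
    obtain ⟨r, hr, hrs⟩ := Metric.mem_nhds_iff.1 (h.and (hU.mem_nhds hz))
    have h2 : (z + (r / 2 : ℝ)) ∈ ball z r := by
      rw [mem_ball, dist_self_add_left, Complex.norm_real, Real.norm_of_nonneg (by positivity)]
      linarith
    have h3 := hg.injOn (hrs h2).2 hz (isOpen_ball.is_const_of_deriv_eq_zero
      (convex_ball z r).isPreconnected (hf.mono fun x hx => (hrs hx).2)
      (fun x hx => (hrs hx).1) h2 (mem_ball_self hr))
    have h4 : ((r / 2 : ℝ) : ℂ) = 0 := by simpa using h3
    have : r / 2 = 0 := by exact_mod_cast h4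
    linarith
  have hdg : DifferentiableAt ℂ g (f z) := by
    refine (Complex.analyticAt_of_differentiable_on_punctured_nhds_of_continuousAt ?_
      (continuousAt_of_leftInvOn hU hf hg hz)).differentiableAt
    have h5 : ∀ᶠ w in 𝓝 z, w ∈ U ∧ (w ≠ z → deriv f w ≠ 0) :=
      Eventually.and (hU.mem_nhds hz) (eventually_nhdsWithin_iff.1 hev)
    have h6 := nhds_le_map_of_injOn hU hf hg.injOn hz (image_mem_map h5)
    rw [eventually_nhdsWithin_iff]
    filter_upwards [h6]
    rintro _ ⟨w, ⟨hw, hw'⟩, rfl⟩ hne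
    exact (key w hw (hw' fun h => hne (by rw [h]; rfl))).differentiableAt
  intro h0
  have h1 : HasDerivAt (g ∘ f) (deriv g (f z) * deriv f z) z :=
    hdg.hasDerivAt.comp z (hf.differentiableAt (hU.mem_nhds hz)).hasDerivAt
  have h2 : HasDerivAt (g ∘ f) 1 z := by
    refine (hasDerivAt_id z).congr_of_eventuallyEq ?_
    filter_upwards [hU.mem_nhds hz] with w hw using hg hw
  have := h1.unique h2
  simp [h0] at this

lemma deriv_ne_zero_of_injOn {f : ℂ → ℂ} {U : Set ℂ} (hU : IsOpen U)
    (hf : DifferentiableOn ℂ f U) (hi : InjOn f U) {z : ℂ} (hz : z ∈ U) : deriv f z ≠ 0 :=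
  (hasDerivAt_of_leftInvOn hU hf hi.leftInvOn_invFunOn hz).1

end GreenInverse

/-! ### The Riemann mapping theorem -/

namespace GreenInverse

open Set Metric Filter Topology Bornology
open scoped ComplexConjugate

/-- A continuous logarithm of a differentiable function is differentiable. -/
lemma hasDerivAt_of_exp_eq {l T : ℂ → ℂ} {z T' : ℂ} (hl : ContinuousAt l z)
    (hT : HasDerivAt T T' z) (h : ∀ᶠ w in 𝓝 z, Complex.exp (l w) = T w) :
    HasDerivAt l (T' / T z) z := by
  rw [hasDerivAt_iff_tendsto_slope] at hT ⊢
  have hz : Complex.exp (l z) = T z := h.self_of_nhds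
  -- The slope of `l` is the slope of `T` divided by the difference quotient of `exp` between `l z`
  -- and `l w`, and the latter tends to `exp (l z) = T z ≠ 0`.
  have h1 : Tendsto (fun w => dslope Complex.exp (l z) (l w)) (𝓝[≠] z) (𝓝 (T z)) := by
    have h2 : ContinuousAt (dslope Complex.exp (l z)) (l z) :=
      continuousAt_dslope_same.2 Complex.differentiableAt_exp
    have h3 : ContinuousAt (fun w => dslope Complex.exp (l z) (l w)) z :=
      ContinuousAt.comp (f := l) h2 hl
    have h4 := h3.tendsto
    rw [dslope_same, Complex.deriv_exp, hz] at h4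
    exact h4.mono_left nhdsWithin_le_nhds
  have hTz : T z ≠ 0 := hz ▸ Complex.exp_ne_zero _
  refine (hT.div h1 hTz).congr' ?_
  filter_upwards [self_mem_nhdsWithin, h.filter_mono nhdsWithin_le_nhds,
    h1.eventually_ne hTz] with w hw hexp hne
  have h5 : (l w - l z) * dslope Complex.exp (l z) (l w) = T w - T z := by
    rw [← smul_eq_mul, sub_smul_dslope, hexp, hz]
  rw [Pi.div_apply, slope_def_field, slope_def_field, ← h5]
  field_simp

/-- A holomorphic function without zeros on a simply connected open set has a holomorphic
logarithm. -/
lemma exists_holomorphic_log {U : Set ℂ} (hU : IsOpen U) (hs : IsSimplyConnected U) {T : ℂ → ℂ}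
    (hT : DifferentiableOn ℂ T U) (h0 : ∀ z ∈ U, T z ≠ 0) :
    ∃ l : ℂ → ℂ, DifferentiableOn ℂ l U ∧ ∀ z ∈ U, Complex.exp (l z) = T z := by
  obtain ⟨l, hlc, hl⟩ := Complex.exists_continuousOn_eqOn_exp_comp hs hU hT.continuousOn
    (by rintro ⟨z, hz, hz'⟩; exact h0 z hz hz')
  refine ⟨l, fun z hz => ?_, fun z hz => hl hz⟩
  refine (hasDerivAt_of_exp_eq (hlc.continuousAt (hU.mem_nhds hz))
    (hT.differentiableAt (hU.mem_nhds hz)).hasDerivAt ?_).differentiableAt.differentiableWithinAt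
  filter_upwards [hU.mem_nhds hz] with w hw using hl hw

/-- **Hurwitz**: a non-constant locally uniform limit of injective holomorphic functions is
injective. -/
lemma injOn_of_tendstoLocallyUniformlyOn {ι : Type*} {l : Filter ι} [l.NeBot] {F : ι → ℂ → ℂ}
    {f : ℂ → ℂ} {U : Set ℂ} (hU : IsOpen U) (hUc : IsPreconnected U)
    (hF : ∀ n, DifferentiableOn ℂ (F n) U) (hi : ∀ n, InjOn (F n) U)
    (hlim : TendstoLocallyUniformlyOn F f l U) {c : ℂ} (hc : c ∈ U) (hfc : deriv f c ≠ 0) :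
    InjOn f U := by
  have hf : DifferentiableOn ℂ f U := hlim.differentiableOn (.of_forall hF) hU
  intro a ha b hb hab
  by_contra hne
  have hfa : AnalyticOnNhd ℂ f U := hf.analyticOnNhd hU
  have hev : ∀ᶠ z in 𝓝[≠] a, f z ≠ f b := by
    have := ((hfa a ha).sub (analyticAt_const (v := f b))).eventually_eq_zero_or_eventually_ne_zero
    refine (this.resolve_left fun h => hfc ?_).mono fun z hz => by simpa [sub_eq_zero] using hz
    have h1 : EqOn f (fun _ => f b) U := hfa.eqOn_of_preconnected_of_eventuallyEq
      analyticOnNhd_const hUc ha (h.mono fun z hz => by simpa [sub_eq_zero] using hz)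
    have h2 : f =ᶠ[𝓝 c] fun _ => f b := by
      filter_upwards [hU.mem_nhds hc] with z hz using h1 hz
    rw [h2.deriv_eq, deriv_const]
  rw [eventually_nhdsWithin_iff] at hev
  obtain ⟨r, hr, hrs⟩ := Metric.nhds_basis_closedBall.mem_iff.1
    (inter_mem hev (inter_mem (hU.mem_nhds ha) (isOpen_ne.mem_nhds hne : {x | x ≠ b} ∈ 𝓝 a)))
  have hrU : closedBall a r ⊆ U := fun z hz => (hrs hz).2.1
  obtain ⟨z₀, hz₀, hmin⟩ := (isCompact_sphere a r).exists_isMinOn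
    (NormedSpace.sphere_nonempty.2 hr.le)
    ((hf.continuousOn.mono (sphere_subset_closedBall.trans hrU)).sub continuousOn_const
      (g := fun _ => f b)).norm
  set m := ‖f z₀ - f b‖
  have hm : 0 < m := norm_pos_iff.2 (sub_ne_zero.2 ((hrs (sphere_subset_closedBall hz₀)).1
    (ne_of_mem_sphere hz₀ hr.ne')))
  have hunif : TendstoUniformlyOn F f l (closedBall a r) :=
    (tendstoLocallyUniformlyOn_iff_forall_isCompact hU).1 hlim _ hrU (isCompact_closedBall a r)
  obtain ⟨n, hn1, hn2⟩ := ((Metric.tendstoUniformlyOn_iff.1 hunif (m / 4) (by positivity)).and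
    (Metric.tendsto_nhds.1 (hlim.tendsto_at hb) (m / 4) (by positivity))).exists
  -- The function `F n - F n b` has no zero in the small disk about `a`, because `b` lies outside
  -- it. On the bounding circle its modulus is at least `m / 2`, so the maximum principle for the
  -- reciprocal gives the same bound at `a`, whereas its value there tends to `f a - f b = 0`.
  have hg0 : ∀ z ∈ closedBall a r, F n z - F n b ≠ 0 := fun z hz h =>
    (hrs hz).2.2 (hi n (hrU hz) hb (sub_eq_zero.1 h))
  have hd : DiffContOnCl ℂ (fun z => (F n z - F n b)⁻¹) (ball a r) := by
    refine DifferentiableOn.diffContOnCl ?_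
    rw [closure_ball a hr.ne']
    exact (((hF n).mono hrU).sub_const _).inv hg0
  rw [dist_eq_norm] at hn2
  have h3 := Complex.norm_le_of_forall_mem_frontier_norm_le isBounded_ball hd (C := (m / 2)⁻¹)
    (fun z hz => by
      rw [frontier_ball a hr.ne'] at hz
      have h4 : m ≤ ‖f z - f b‖ := hmin hz
      have h5 := hn1 z (sphere_subset_closedBall hz)
      rw [dist_eq_norm] at h5
      rw [norm_inv]
      refine inv_anti₀ (by positivity) ?_
      have : f z - f b = (F n z - F n b) + (f z - F n z) + (F n b - f b) := by ring
      have h6 : ‖f z - f b‖ ≤ ‖F n z - F n b‖ + ‖f z - F n z‖ + ‖F n b - f b‖ := by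
        rw [this]; exact norm_add₃_le
      linarith) (subset_closure (mem_ball_self hr))
  have ha' : a ∈ closedBall a r := mem_closedBall_self hr.le
  rw [norm_inv, inv_le_inv₀ (norm_pos_iff.2 (hg0 a ha')) (by positivity)] at h3
  have h5 := hn1 a ha'
  rw [dist_eq_norm] at h5
  have h6 : ‖F n a - F n b‖ ≤ ‖f a - F n a‖ + ‖F n b - f b‖ := by
    have : F n a - F n b = -((f a - F n a) + (F n b - f b)) := by rw [hab]; ring
    rw [this, norm_neg]; exact norm_add_le _ _
  linarith

/-- Equicontinuity for Montel's theorem: Schwarz–Pick on the ball of radius `R` about each point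
bounds the derivative by `1 / R`. -/
lemma lipschitz_of_mapsTo_unit_ball {F : ℂ → ℂ} {c : ℂ} {R : ℝ} (hR : 0 < R)
    (hd : DifferentiableOn ℂ F (ball c (2 * R))) (hm : MapsTo F (ball c (2 * R)) (ball 0 1))
    {z w : ℂ} (hz : z ∈ ball c R) (hw : w ∈ ball c R) : ‖F z - F w‖ ≤ 1 / R * ‖z - w‖ := by
  refine (convex_ball c R).norm_image_sub_le_of_norm_deriv_le (fun x hx => ?_) (fun x hx => ?_)
    hw hz
  · exact hd.differentiableAt (isOpen_ball.mem_nhds (ball_subset_ball (by linarith) hx))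
  · have hsub : ball x R ⊆ ball c (2 * R) := ball_subset_ball' (by
      rw [mem_ball] at hx; linarith)
    refine (norm_deriv_le_schwarz_pick hR (hd.mono hsub) (hm.mono_left hsub)).trans ?_
    gcongr
    nlinarith [norm_nonneg (F x)]

/-- **Montel**: along an ultrafilter, every sequence of holomorphic maps into the unit disk
converges locally uniformly. -/
lemma exists_tendstoLocallyUniformlyOn_ultrafilter {ι : Type*} (l : Ultrafilter ι)
    {F : ι → ℂ → ℂ} {U : Set ℂ} (hU : IsOpen U) (hF : ∀ n, DifferentiableOn ℂ (F n) U)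
    (hm : ∀ n, MapsTo (F n) U (ball 0 1)) :
    ∃ f : ℂ → ℂ, TendstoLocallyUniformlyOn F f l U := by
  -- Compactness of the closed disk gives the limit along an ultrafilter at all points
  -- simultaneously, so no diagonal subsequence is needed.
  have h1 : ∀ z, ∃ y, z ∈ U → Tendsto (fun n => F n z) l (𝓝 y) := by
    intro z
    by_cases hz : z ∈ U
    · obtain ⟨y, -, hy⟩ := (isCompact_closedBall (0 : ℂ) 1).ultrafilter_le_nhds
        (l.map fun n => F n z) (by
          rw [le_principal_iff]
          exact mem_map.2 (univ_mem' fun n => ball_subset_closedBall (hm n hz)))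
      exact ⟨y, fun _ => hy⟩
    · exact ⟨0, fun h => absurd h hz⟩
  choose f hf using h1
  refine ⟨f, Metric.tendstoLocallyUniformlyOn_iff.2 fun ε hε x hx => ?_⟩
  obtain ⟨R₀, hR₀, hRU⟩ := Metric.isOpen_iff.1 hU x hx
  set R := R₀ / 2
  have hR : 0 < R := by positivity
  have h2R : 2 * R = R₀ := by simp only [R]; ring
  rw [← h2R] at hRU
  set δ := min R (ε * R / 4)
  have hδ : 0 < δ := by positivity
  refine ⟨ball x δ, mem_nhdsWithin_of_mem_nhds (ball_mem_nhds x hδ), ?_⟩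
  have hL : ∀ n, ∀ y ∈ ball x δ, ‖F n y - F n x‖ ≤ ε / 4 := by
    intro n y hy
    have h3 := lipschitz_of_mapsTo_unit_ball hR ((hF n).mono hRU) ((hm n).mono_left hRU)
      (ball_subset_ball (min_le_left _ _) hy) (mem_ball_self hR)
    have h4 : ‖y - x‖ ≤ ε * R / 4 := by
      rw [mem_ball, dist_eq_norm] at hy
      exact hy.le.trans (min_le_right _ _)
    calc _ ≤ _ := h3
      _ ≤ 1 / R * (ε * R / 4) := by gcongr
      _ = ε / 4 := by field_simp
  have hδU : ball x δ ⊆ U := (ball_subset_ball (by linarith [min_le_left R (ε * R / 4)])).trans hRU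
  filter_upwards [Metric.tendsto_nhds.1 (hf x hx) (ε / 4) (by positivity)] with n hn y hy
  have h5 : ‖f y - f x‖ ≤ ε / 4 :=
    le_of_tendsto ((hf y (hδU hy)).sub (hf x hx)).norm (.of_forall fun k => hL k y hy)
  rw [dist_eq_norm] at hn ⊢
  have h6 : f y - F n y = (f y - f x) - (F n x - f x) - (F n y - F n x) := by ring
  rw [h6]
  have h7 := norm_sub_le ((f y - f x) - (F n x - f x)) (F n y - F n x)
  have h8 := norm_sub_le (f y - f x) (F n x - f x)
  linarith [hL n y hy]

/-- The square root trick: `z ↦ T_w⁻¹ (T_b⁻¹(z)²)` contracts strictly at the origin. -/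
lemma norm_deriv_lt_one_of_not_injective {w b : ℂ} (hw : ‖w‖ < 1) (hb : ‖b‖ < 1)
    (h0 : mobius (-w) ((mobius (-b) 0) ^ 2) = 0) :
    DifferentiableAt ℂ (fun z => mobius (-w) ((mobius (-b) z) ^ 2)) 0 ∧
      ‖deriv (fun z => mobius (-w) ((mobius (-b) z) ^ 2)) 0‖ < 1 := by
  set ψ : ℂ → ℂ := fun z => mobius (-w) ((mobius (-b) z) ^ 2)
  have hw' : ‖-w‖ < 1 := by simpa
  have hb' : ‖-b‖ < 1 := by simpa
  have hsq : MapsTo (fun z => (mobius (-b) z) ^ 2) (ball 0 1) (ball 0 1) := by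
    intro z hz
    have := norm_mobius_lt_one hb' (z := z) (by simpa using hz)
    simpa using pow_lt_one₀ (norm_nonneg _) this two_ne_zero
  have hmaps : MapsTo ψ (ball 0 1) (ball 0 1) := (mapsTo_mobius hw').comp hsq
  have hd : DifferentiableOn ℂ ψ (ball 0 1) :=
    (differentiableOn_mobius hw').comp ((differentiableOn_mobius hb').pow 2) hsq
  have hψ0 : ψ 0 = 0 := h0
  have h01 : (0 : ℂ) ∈ ball (0 : ℂ) 1 := mem_ball_self one_pos
  refine ⟨hd.differentiableAt (isOpen_ball.mem_nhds h01), ?_⟩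
  have hm2 : MapsTo ψ (ball 0 1) (closedBall (ψ 0) 1) := by
    rw [hψ0]; exact hmaps.mono_right ball_subset_closedBall
  -- Equality in the Schwarz lemma would make `ψ` linear with nonzero slope; but the square makes
  -- `ψ` agree at the two distinct points `mobius b (±1/2)`.
  refine lt_of_le_of_ne (Complex.norm_deriv_le_one_of_mapsTo_ball hd hm2 one_pos) fun heq => ?_
  have haff := Complex.affine_of_mapsTo_ball_of_norm_dslope_eq_div hd hm2 h01
    (by rw [dslope_same, heq]; norm_num)
  have hhalf : ‖(1 / 2 : ℂ)‖ < 1 := by norm_num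
  have hhalf' : ‖-(1 / 2 : ℂ)‖ < 1 := by norm_num
  have e1 : mobius b (1 / 2) ∈ ball (0 : ℂ) 1 := mapsTo_mobius hb (by simpa using hhalf)
  have e2 : mobius b (-(1 / 2)) ∈ ball (0 : ℂ) 1 := mapsTo_mobius hb (by simpa using hhalf')
  have e3 : ψ (mobius b (1 / 2)) = ψ (mobius b (-(1 / 2))) := by
    simp only [ψ]
    rw [mobius_neg_mobius hb hhalf, mobius_neg_mobius hb hhalf']
    norm_num
  rw [haff e1, haff e2, hψ0, dslope_same] at e3
  have hne : deriv ψ 0 ≠ 0 := by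
    intro h; rw [h] at heq; simp at heq
  have e4 : mobius b (1 / 2) = mobius b (-(1 / 2)) := by simpa [hne] using e3
  have e5 := injOn_mobius hb (by simpa using hhalf) (by simpa using hhalf') e4
  norm_num at e5

/-- A simply connected proper open subset of the plane embeds holomorphically into the unit disk. -/
lemma exists_injOn_mapsTo_unit_ball {U : Set ℂ} (hU : IsOpen U) (hs : IsSimplyConnected U)
    (hne : U ≠ univ) :
    ∃ f : ℂ → ℂ, DifferentiableOn ℂ f U ∧ MapsTo f U (ball 0 1) ∧ InjOn f U := by
  obtain ⟨b, hb⟩ := (ne_univ_iff_exists_notMem U).1 hne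
  obtain ⟨lg, hlg, hexp⟩ := exists_holomorphic_log hU hs (T := fun z => z - b)
    (differentiableOn_id.sub_const b) (fun z hz h => hb (by rwa [← sub_eq_zero.1 h]))
  set g : ℂ → ℂ := fun z => Complex.exp (lg z / 2)
  have hg2 : ∀ z ∈ U, g z ^ 2 = z - b := by
    intro z hz
    simp only [g]
    rw [← Complex.exp_nat_mul, Nat.cast_ofNat, mul_div_cancel₀ _ two_ne_zero]
    exact hexp z hz
  have hgd : DifferentiableOn ℂ g U := (hlg.div_const 2).cexp
  have hgi : InjOn g U := fun z hz w hw h => by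
    have := hg2 z hz
    rw [h, hg2 w hw] at this
    simpa using this.symm
  obtain ⟨a, ha⟩ := hs.nonempty
  obtain ⟨ε, hε, hball⟩ := Metric.isOpen_iff.1 (isOpen_image_of_injOn hU hgd hgi) (g a) ⟨a, ha, rfl⟩
  -- A branch `g` of `√(z - b)` cannot take both a value and its negative, so its image omits the
  -- ball about `-g a`. An inversion about `-g a` then makes it bounded.
  have hfar : ∀ z ∈ U, ε ≤ ‖g z + g a‖ := by
    intro z hz
    by_contra! hlt
    obtain ⟨w, hw, hwz⟩ := hball (show -g z ∈ ball (g a) ε by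
      rwa [mem_ball, dist_eq_norm, ← norm_neg, show -(-g z - g a) = g z + g a by ring])
    have h1 : w = z := by
      have := hg2 w hw
      rw [hwz, neg_sq, hg2 z hz] at this
      simpa using this.symm
    rw [h1] at hwz
    exact Complex.exp_ne_zero (lg z / 2) (self_eq_neg.1 hwz)
  have hne0 : ∀ z ∈ U, g z + g a ≠ 0 := fun z hz => norm_pos_iff.1 (hε.trans_le (hfar z hz))
  refine ⟨fun z => (ε / 2 : ℝ) / (g z + g a), (differentiableOn_const _).div (hgd.add_const _) hne0,
    fun z hz => ?_, fun z hz w hw h => hgi hz hw ?_⟩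
  · rw [mem_ball_zero_iff, norm_div, Complex.norm_real, Real.norm_of_nonneg (by positivity),
      div_lt_one (hε.trans_le (hfar z hz))]
    linarith [hfar z hz]
  · have hε' : ((ε / 2 : ℝ) : ℂ) ≠ 0 := by exact_mod_cast (by positivity : ε / 2 ≠ 0)
    have h1 := hne0 z hz
    have h2 := hne0 w hw
    simp only at h
    rw [div_eq_div_iff h1 h2] at h
    simpa using (mul_left_cancel₀ hε' h).symm

/-- **Riemann mapping theorem.** -/
theorem exists_riemann_map {Ω : Set ℂ} (hΩ : IsOpen Ω) (hs : IsSimplyConnected Ω)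
    (hne : Ω ≠ univ) {a : ℂ} (ha : a ∈ Ω) :
    ∃ F : ℂ → ℂ, DifferentiableOn ℂ F Ω ∧ BijOn F Ω (ball 0 1) ∧ F a = 0 := by
  have hconn : IsPreconnected Ω := hs.isPathConnected.isConnected.isPreconnected
  -- Extremal problem: among the univalent maps into the disk vanishing at `a`, one with maximal
  -- `‖F' a‖` is surjective.
  set S : Set (ℂ → ℂ) :=
    {F | DifferentiableOn ℂ F Ω ∧ MapsTo F Ω (ball 0 1) ∧ InjOn F Ω ∧ F a = 0}
  have hSne : S.Nonempty := by
    obtain ⟨f, hfd, hm, hi⟩ := exists_injOn_mapsTo_unit_ball hΩ hs hne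
    have hfa : ‖f a‖ < 1 := by simpa using hm ha
    exact ⟨mobius (f a) ∘ f, (differentiableOn_mobius hfa).comp hfd hm,
      (mapsTo_mobius hfa).comp hm, (injOn_mobius hfa).comp hi hm, mobius_self _⟩
  obtain ⟨R, hR, hRΩ⟩ := Metric.isOpen_iff.1 hΩ a ha
  set D : Set ℝ := (fun F : ℂ → ℂ => ‖deriv F a‖) '' S
  have hDb : BddAbove D := by
    refine ⟨1 / R, ?_⟩
    rintro _ ⟨F, ⟨hd, hm, -, -⟩, rfl⟩
    refine (norm_deriv_le_schwarz_pick hR (hd.mono hRΩ) (hm.mono_left hRΩ)).trans ?_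
    gcongr
    nlinarith [norm_nonneg (F a)]
  obtain ⟨u, -, hulim, hu⟩ := exists_seq_tendsto_sSup (hSne.image _) hDb
  choose F hFS hFu using hu
  set l : Ultrafilter ℕ := hyperfilter ℕ
  obtain ⟨f, hf⟩ := exists_tendstoLocallyUniformlyOn_ultrafilter l hΩ (fun n => (hFS n).1)
    (fun n => (hFS n).2.1)
  have hfd : DifferentiableOn ℂ f Ω := hf.differentiableOn (.of_forall fun n => (hFS n).1) hΩ
  have hM : ‖deriv f a‖ = sSup D := by
    have h1 := ((hf.deriv (.of_forall fun n => (hFS n).1) hΩ).tendsto_at ha).norm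
    refine tendsto_nhds_unique h1 ?_
    have h2 : (fun n => ‖(deriv ∘ F) n a‖) = u := funext hFu
    rw [h2]
    exact hulim.mono_left (Nat.hyperfilter_le_atTop)
  have hMpos : 0 < sSup D := by
    obtain ⟨G, hG⟩ := hSne
    exact (norm_pos_iff.2 (deriv_ne_zero_of_injOn hΩ hG.1 hG.2.2.1 ha)).trans_le
      (le_csSup hDb ⟨G, hG, rfl⟩)
  have hfa' : deriv f a ≠ 0 := norm_pos_iff.1 (hM ▸ hMpos)
  have hfi : InjOn f Ω := injOn_of_tendstoLocallyUniformlyOn hΩ hconn (fun n => (hFS n).1)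
    (fun n => (hFS n).2.2.1) hf ha hfa'
  have hfa : f a = 0 := by
    refine tendsto_nhds_unique (hf.tendsto_at ha) ?_
    simp only [fun n => (hFS n).2.2.2]
    exact tendsto_const_nhds
  have hfm : MapsTo f Ω (ball 0 1) := by
    have h1 : f '' Ω ⊆ closedBall 0 1 := by
      rintro _ ⟨z, hz, rfl⟩
      exact isClosed_closedBall.mem_of_tendsto (hf.tendsto_at hz)
        (.of_forall fun n => ball_subset_closedBall ((hFS n).2.1 hz))
    have h2 := interior_maximal h1 (isOpen_image_of_injOn hΩ hfd hfi)
    rw [interior_closedBall _ one_ne_zero] at h2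
    exact fun z hz => h2 ⟨z, hz, rfl⟩
  refine ⟨f, hfd, ⟨hfm, hfi, fun w hw => ?_⟩, hfa⟩
  -- If `w` is omitted, `mobius w ∘ f` has a square root `g` on `Ω`. With `G = mobius (g a) ∘ g` in
  -- `S` one has `f = ψ ∘ G` and `‖ψ' 0‖ < 1`, so `G` beats the maximal derivative.
  by_contra hwf
  have hw1 : ‖w‖ < 1 := by simpa using hw
  obtain ⟨lg, hlg, hexp⟩ := exists_holomorphic_log hΩ hs ((differentiableOn_mobius hw1).comp hfd hfm)
    (fun z hz h => hwf ⟨z, hz, by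
      refine injOn_mobius hw1 (hfm hz) hw ?_
      rw [mobius_self]; exact h⟩)
  set g : ℂ → ℂ := fun z => Complex.exp (lg z / 2)
  have hg2 : ∀ z ∈ Ω, g z ^ 2 = mobius w (f z) := by
    intro z hz
    simp only [g]
    rw [← Complex.exp_nat_mul, Nat.cast_ofNat, mul_div_cancel₀ _ two_ne_zero]
    exact hexp z hz
  have hgm : MapsTo g Ω (ball 0 1) := by
    intro z hz
    have h1 := norm_mobius_lt_one hw1 (z := f z) (by simpa using hfm hz)
    rw [← hg2 z hz, norm_pow, sq_lt_one_iff₀ (norm_nonneg _)] at h1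
    simpa using h1
  have hgd : DifferentiableOn ℂ g Ω := (hlg.div_const 2).cexp
  have hb1 : ‖g a‖ < 1 := by simpa using hgm ha
  have hgi : InjOn g Ω := fun z hz z' hz' h => hfi hz hz' (injOn_mobius hw1 (hfm hz) (hfm hz')
    (by rw [← hg2 z hz, ← hg2 z' hz', h]))
  have hGS : mobius (g a) ∘ g ∈ S := ⟨(differentiableOn_mobius hb1).comp hgd hgm,
      (mapsTo_mobius hb1).comp hgm, (injOn_mobius hb1).comp hgi hgm, mobius_self _⟩
  set ψ : ℂ → ℂ := fun z => mobius (-w) ((mobius (-(g a)) z) ^ 2)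
  have hψ : ∀ z ∈ Ω, ψ ((mobius (g a) ∘ g) z) = f z := by
    intro z hz
    simp only [ψ, Function.comp]
    rw [mobius_neg_mobius hb1 (by simpa using hgm hz), hg2 z hz,
      mobius_neg_mobius hw1 (by simpa using hfm hz)]
  have hG0 : (mobius (g a) ∘ g) a = 0 := mobius_self _
  obtain ⟨hψd, hψ1⟩ := norm_deriv_lt_one_of_not_injective hw1 hb1 (by
    have := hψ a ha
    rwa [hG0, hfa] at this)
  have hcomp : deriv f a = deriv ψ 0 * deriv (mobius (g a) ∘ g) a := by
    have h1 : f =ᶠ[𝓝 a] ψ ∘ (mobius (g a) ∘ g) := by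
      filter_upwards [hΩ.mem_nhds ha] with z hz using (hψ z hz).symm
    rw [h1.deriv_eq, deriv_comp, hG0]
    · rw [hG0]; exact hψd
    · exact hGS.1.differentiableAt (hΩ.mem_nhds ha)
  have h1 : ‖deriv (mobius (g a) ∘ g) a‖ ≤ sSup D := le_csSup hDb ⟨_, hGS, rfl⟩
  have h2 := congrArg norm hcomp
  rw [norm_mul, hM] at h2
  nlinarith [norm_nonneg (deriv ψ 0), norm_nonneg (deriv (mobius (g a) ∘ g) a)]

end GreenInverse

/-! ### Flatness of a `C^{1,α}` boundary -/

namespace GreenInverse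

open Set Metric Filter Topology Bornology

/-- Quantitative flatness of the boundary: at every boundary point `p`, `Ω` lies between two
`C^{1,α}` perturbations of the half plane with interior normal `ν p`. -/
structure IsFlat (α ρ K : ℝ) (ν : ℂ → ℂ) (Ω : Set ℂ) : Prop where
  alpha_pos : 0 < α
  alpha_lt : α < 1
  radius_pos : 0 < ρ
  one_le : 1 ≤ K
  small : K * ρ ^ α ≤ 1 / 100
  norm_normal : ∀ p ∈ frontier Ω, ‖ν p‖ = 1
  mem : ∀ p ∈ frontier Ω, ∀ v : ℂ, ‖v‖ < ρ → K * ‖v‖ ^ (1 + α) < v.re → p + ν p * v ∈ Ω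
  le_re : ∀ p ∈ frontier Ω, ∀ v : ℂ, ‖v‖ < ρ → p + ν p * v ∈ Ω → -(K * ‖v‖ ^ (1 + α)) ≤ v.re

lemma abs_taylor_le {g : ℝ → ℝ} (hg : Differentiable ℝ g) {α C : ℝ} (hα : 0 < α) (hC : 0 ≤ C)
    (h : ∀ x y : ℝ, |deriv g x - deriv g y| ≤ C * |x - y| ^ α) (x₀ X : ℝ) :
    |g (x₀ + X) - g x₀ - deriv g x₀ * X| ≤ C * |X| ^ (1 + α) := by
  have hd : ∀ x, HasDerivAt (fun x => g x - deriv g x₀ * x) (deriv g x - deriv g x₀) x := fun x => by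
    have h2 := (hg x).hasDerivAt.fun_sub ((hasDerivAt_id x).const_mul (deriv g x₀))
    rw [mul_one] at h2
    exact h2
  have h1 := (convex_uIcc x₀ (x₀ + X)).norm_image_sub_le_of_norm_hasDerivWithin_le
    (C := C * |X| ^ α) (fun x _ => (hd x).hasDerivWithinAt) (fun x hx => by
      refine (h x x₀).trans ?_
      have := Set.abs_sub_left_of_mem_uIcc hx
      rw [add_sub_cancel_left] at this
      exact mul_le_mul_of_nonneg_left (Real.rpow_le_rpow (abs_nonneg _) this hα.le) hC) left_mem_uIcc right_mem_uIcc
  rw [Real.norm_eq_abs, Real.norm_eq_abs] at h1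
  have h2 : |X| ^ (1 + α) = |X| * |X| ^ α := by
    rcases eq_or_ne X 0 with rfl | hX
    · rw [abs_zero, Real.zero_rpow (by linarith), zero_mul]
    · rw [Real.rpow_add (abs_pos.2 hX), Real.rpow_one]
  calc _ = |g (x₀ + X) - deriv g x₀ * (x₀ + X) - (g x₀ - deriv g x₀ * x₀)| := by congr 1; ring
    _ ≤ _ := h1
    _ = _ := by rw [h2, add_sub_cancel_left]; ring

/-- If `m` is the slope of the graph at `p`, then `u(-m + i)/√(1 + m²)` is its upward normal, and a
displacement `v` in these coordinates changes the height above the tangent line by `√(1 + m²) ·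
v.re`. As the factor is at least `1`, comparing with the Taylor remainder of `g` gives both
implications, with constants common to all boundary points near `p₀`. -/
lemma exists_local_normal {α : ℝ} (hα : 0 < α) {Ω : Set ℂ} (hΩ : IsOpen Ω)
    (h : IsC1HolderDomain α Ω) {p₀ : ℂ} (hp₀ : p₀ ∈ frontier Ω) :
    ∃ ρ > 0, ∃ K : ℝ, ∀ p ∈ ball p₀ ρ ∩ frontier Ω, ∃ n : ℂ, ‖n‖ = 1 ∧ ∀ v : ℂ, ‖v‖ < ρ →
      (K * ‖v‖ ^ (1 + α) < v.re → p + n * v ∈ Ω) ∧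
      (p + n * v ∈ Ω → -(K * ‖v‖ ^ (1 + α)) ≤ v.re) := by
  obtain ⟨u, r, g, hu, hr, hg, ⟨C, hC⟩, hΩg⟩ := h p₀ hp₀
  have hu0 : u ≠ 0 := norm_ne_zero_iff.1 (by rw [hu]; exact one_ne_zero)
  refine ⟨r / 2, by positivity, max C 0, fun p hp => ?_⟩
  have hC' : ∀ x y : ℝ, |deriv g x - deriv g y| ≤ max C 0 * |x - y| ^ α := fun x y =>
    (hC x y).trans (by gcongr; exact le_max_left _ _)
  set x₀ := ((p - p₀) / u).re
  set y₀ := ((p - p₀) / u).im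
  have hcoord : ∀ z : ℂ, p₀ + u * (((z - p₀) / u).re + ((z - p₀) / u).im * Complex.I) = z := by
    intro z; rw [Complex.re_add_im]; field_simp; ring
  have hpc : p₀ + u * (x₀ + y₀ * Complex.I) = p := hcoord p
  have hpr : p ∈ ball p₀ r := ball_subset_ball (by linarith) hp.1
  have hpΩ : p ∉ Ω := fun hh => hp.2.2 (by rwa [hΩ.interior_eq])
  -- The chart describes only `Ω`, so it has to be shown that `p` lies on the graph: above it `p`
  -- would be in `Ω`, strictly below it a whole neighborhood would miss `Ω`.
  have hy₀ : y₀ = g x₀ := by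
    refine le_antisymm (not_lt.1 fun hlt => hpΩ ?_) (not_lt.1 fun hlt => ?_)
    · rw [← hpc]; exact (hΩg x₀ y₀ (by rwa [hpc])).2 hlt
    · have hcont : Continuous fun z : ℂ => g ((z - p₀) / u).re - ((z - p₀) / u).im := by
        have := hg.continuous
        fun_prop
      have hev : ∀ᶠ z in 𝓝 p, z ∉ Ω := by
        filter_upwards [isOpen_ball.mem_nhds hpr,
          hcont.continuousAt.eventually_const_lt (show 0 < g x₀ - y₀ by linarith)] with z hz hz' hzΩ
        have := (hΩg ((z - p₀) / u).re ((z - p₀) / u).im (by rwa [hcoord])).1 (by rwa [hcoord])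
        linarith
      obtain ⟨z, hz, hz'⟩ := ((mem_closure_iff_frequently.1 hp.2.1).and_eventually hev).exists
      exact hz' hz
  set m := deriv g x₀
  set n := √(1 + m ^ 2)
  have hn2 : n ^ 2 = 1 + m ^ 2 := Real.sq_sqrt (by positivity)
  have hn1 : 1 ≤ n := Real.one_le_sqrt.2 (by nlinarith [sq_nonneg m])
  have hn0 : (n : ℂ) ≠ 0 := by exact_mod_cast (by positivity : n ≠ 0)
  have hnorm : ‖u * ((-m + Complex.I) / n)‖ = 1 := by
    rw [norm_mul, hu, one_mul, norm_div, Complex.norm_real, Real.norm_of_nonneg (by positivity),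
      div_eq_one_iff_eq (by positivity), Complex.norm_eq_sqrt_sq_add_sq]
    congr 1
    simp
    ring
  refine ⟨u * ((-m + Complex.I) / n), hnorm, fun v hv => ?_⟩
  set X := (-m * v.re - v.im) / n
  set Y := (v.re - m * v.im) / n
  have hzc : p + u * ((-m + Complex.I) / n) * v =
      p₀ + u * (((x₀ + X : ℝ) : ℂ) + ((y₀ + Y : ℝ) : ℂ) * Complex.I) := by
    rw [← hpc]
    have : ((-m + Complex.I) / n) * v = X + Y * Complex.I := by
      rw [div_mul_eq_mul_div, div_eq_iff hn0]
      apply Complex.ext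
      · simp [X, Y]; field_simp
      · simp [X, Y]; field_simp; ring
    rw [mul_assoc, this]
    push_cast
    ring
  have hzball : p + u * ((-m + Complex.I) / n) * v ∈ ball p₀ r := by
    have h1 := hp.1
    rw [mem_ball, dist_eq_norm] at h1 ⊢
    calc _ = ‖(p - p₀) + u * ((-m + Complex.I) / n) * v‖ := by congr 1; ring
      _ ≤ ‖p - p₀‖ + ‖u * ((-m + Complex.I) / n) * v‖ := norm_add_le _ _
      _ < r := by rw [norm_mul, hnorm]; linarith
  have hiff := hΩg (x₀ + X) (y₀ + Y) (by rwa [← hzc])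
  rw [← hzc] at hiff
  have hXY : Y - m * X = n * v.re := by
    simp only [X, Y]; field_simp; linear_combination -v.re * hn2
  have hXv : |X| ≤ ‖v‖ := by
    refine abs_le_of_sq_le_sq ?_ (norm_nonneg v)
    rw [Complex.sq_norm, Complex.normSq_apply, div_pow, hn2, div_le_iff₀ (by positivity)]
    nlinarith [sq_nonneg (v.re - m * v.im)]
  have hT := abs_le.1 ((abs_taylor_le hg hα (le_max_right _ _) hC' x₀ X).trans
    (show _ ≤ max C 0 * ‖v‖ ^ (1 + α) by gcongr))
  rw [hiff, hy₀]
  have hK : 0 ≤ max C 0 * ‖v‖ ^ (1 + α) := by positivity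
  constructor
  · intro hre
    nlinarith [hT.2]
  · intro hre
    by_contra! hlt
    nlinarith [hT.1]

/-- A bounded `C^{1,α}` domain has uniformly flat boundary. -/
lemma exists_isFlat {α : ℝ} (hα : 0 < α) (hα1 : α < 1) {Ω : Set ℂ} (hΩ : IsOpen Ω) (hb : IsBounded Ω)
    (h : IsC1HolderDomain α Ω) : ∃ (ρ K : ℝ) (ν : ℂ → ℂ), IsFlat α ρ K ν Ω := by
  have hc : IsCompact (frontier Ω) := hb.isCompact_closure.of_isClosed_subset isClosed_frontier
    frontier_subset_closure
  have key : ∃ ρ > 0, ∃ K : ℝ, ∀ p ∈ frontier Ω ∩ frontier Ω, ∃ n : ℂ, ‖n‖ = 1 ∧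
      ∀ v : ℂ, ‖v‖ < ρ → (K * ‖v‖ ^ (1 + α) < v.re → p + n * v ∈ Ω) ∧
      (p + n * v ∈ Ω → -(K * ‖v‖ ^ (1 + α)) ≤ v.re) := by
    refine hc.induction_on (p := fun S => ∃ ρ > 0, ∃ K : ℝ, ∀ p ∈ S ∩ frontier Ω, ∃ n : ℂ,
      ‖n‖ = 1 ∧ ∀ v : ℂ, ‖v‖ < ρ → (K * ‖v‖ ^ (1 + α) < v.re → p + n * v ∈ Ω) ∧
      (p + n * v ∈ Ω → -(K * ‖v‖ ^ (1 + α)) ≤ v.re)) ⟨1, one_pos, 0, by simp⟩ ?_ ?_ ?_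
    · rintro s t hst ⟨ρ, hρ, K, hK⟩
      exact ⟨ρ, hρ, K, fun p hp => hK p ⟨hst hp.1, hp.2⟩⟩
    · rintro s t ⟨ρ, hρ, K, hK⟩ ⟨ρ', hρ', K', hK'⟩
      refine ⟨min ρ ρ', lt_min hρ hρ', max K K', ?_⟩
      rintro p ⟨hp | hp, hpf⟩
      · obtain ⟨n, hn, hv⟩ := hK p ⟨hp, hpf⟩
        refine ⟨n, hn, fun v hvρ => ⟨fun h1 => (hv v (hvρ.trans_le (min_le_left _ _))).1
          (h1.trans_le' ?_), fun h1 => ((hv v (hvρ.trans_le (min_le_left _ _))).2 h1).trans' ?_⟩⟩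
        · gcongr; exact le_max_left _ _
        · gcongr; exact le_max_left _ _
      · obtain ⟨n, hn, hv⟩ := hK' p ⟨hp, hpf⟩
        refine ⟨n, hn, fun v hvρ => ⟨fun h1 => (hv v (hvρ.trans_le (min_le_right _ _))).1
          (h1.trans_le' ?_), fun h1 => ((hv v (hvρ.trans_le (min_le_right _ _))).2 h1).trans' ?_⟩⟩
        · gcongr; exact le_max_right _ _
        · gcongr; exact le_max_right _ _
    · intro p₀ hp₀
      obtain ⟨ρ, hρ, K, hK⟩ := exists_local_normal hα hΩ h hp₀
      exact ⟨ball p₀ ρ, mem_nhdsWithin_of_mem_nhds (ball_mem_nhds p₀ hρ), ρ, hρ, K, hK⟩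
  obtain ⟨ρ, hρ, K, hK⟩ := key
  have h1 : ∀ p, ∃ n : ℂ, p ∈ frontier Ω → ‖n‖ = 1 ∧ ∀ v : ℂ, ‖v‖ < ρ →
      (K * ‖v‖ ^ (1 + α) < v.re → p + n * v ∈ Ω) ∧
      (p + n * v ∈ Ω → -(K * ‖v‖ ^ (1 + α)) ≤ v.re) := by
    intro p
    by_cases hp : p ∈ frontier Ω
    · obtain ⟨n, hn⟩ := hK p ⟨hp, hp⟩
      exact ⟨n, fun _ => hn⟩
    · exact ⟨0, fun h => absurd h hp⟩
  choose ν hν using h1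
  -- The radius is shrunk until `K ρ ^ α ≤ 1/100`: the boundary error `K ‖v‖ ^ (1 + α)` is then at
  -- most `‖v‖ / 100`, which is what the cone arguments use.
  have hlim : Tendsto (fun t : ℝ => max K 1 * t ^ α) (𝓝[>] 0) (𝓝 0) := by
    have h2 : ContinuousAt (fun t : ℝ => max K 1 * t ^ α) 0 :=
      (Real.continuousAt_rpow_const 0 α (.inr hα.le)).const_mul _
    have h3 := h2.tendsto
    rw [Real.zero_rpow hα.ne', mul_zero] at h3
    exact h3.mono_left nhdsWithin_le_nhds
  obtain ⟨t, ht, ht0, htρ⟩ := ((hlim.eventually_le_const (show (0 : ℝ) < 1 / 100 by norm_num)).and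
    (Eventually.and (self_mem_nhdsWithin (s := Ioi (0 : ℝ)))
      (mem_nhdsWithin_of_mem_nhds (Iio_mem_nhds hρ)))).exists
  refine ⟨t, max K 1, ν, hα, hα1, ht0, le_max_right _ _, ht, fun p hp => (hν p hp).1,
    fun p hp v hv h1 => ((hν p hp).2 v (hv.trans htρ)).1 (h1.trans_le' ?_),
    fun p hp v hv h1 => (((hν p hp).2 v (hv.trans htρ)).2 h1).trans' ?_⟩
  · gcongr; exact le_max_left _ _
  · gcongr; exact le_max_left _ _

section

variable {α ρ K : ℝ} {ν : ℂ → ℂ} {Ω : Set ℂ}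

lemma IsFlat.rpow_eq (h : IsFlat α ρ K ν Ω) {x : ℝ} (hx : 0 ≤ x) : x ^ (1 + α) = x * x ^ α := by
  rcases hx.eq_or_lt with rfl | hx
  · rw [Real.zero_rpow (by linarith [h.alpha_pos]), zero_mul]
  · rw [Real.rpow_add hx, Real.rpow_one]

lemma IsFlat.rpow_le (h : IsFlat α ρ K ν Ω) {x : ℝ} (hx : 0 ≤ x) (hxρ : x ≤ ρ) :
    K * x ^ (1 + α) ≤ x / 100 := by
  have h1 : x ^ α ≤ ρ ^ α := Real.rpow_le_rpow hx hxρ h.alpha_pos.le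
  have h2 := h.one_le
  rw [h.rpow_eq hx]
  calc K * (x * x ^ α) = x * (K * x ^ α) := by ring
    _ ≤ x * (K * ρ ^ α) := by gcongr
    _ ≤ x * (1 / 100) := by gcongr; exact h.small
    _ = _ := by ring

lemma IsFlat.normal_ne_zero (h : IsFlat α ρ K ν Ω) {p : ℂ} (hp : p ∈ frontier Ω) : ν p ≠ 0 :=
  norm_ne_zero_iff.1 (by rw [h.norm_normal p hp]; exact one_ne_zero)

lemma IsFlat.norm_div_normal (h : IsFlat α ρ K ν Ω) {p : ℂ} (hp : p ∈ frontier Ω) (z : ℂ) :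
    ‖z / ν p‖ = ‖z‖ := by rw [norm_div, h.norm_normal p hp, div_one]

lemma IsFlat.mem_of_cone (h : IsFlat α ρ K ν Ω) {p : ℂ} (hp : p ∈ frontier Ω) {v : ℂ}
    (hv0 : v ≠ 0) (hv : ‖v‖ < ρ) (hre : ‖v‖ / 50 ≤ v.re) : p + ν p * v ∈ Ω := by
  have h1 := norm_pos_iff.2 hv0
  exact h.mem p hp v hv (by linarith [h.rpow_le h1.le hv.le])

lemma IsFlat.le_re_of_mem_closure (h : IsFlat α ρ K ν Ω) {p : ℂ} (hp : p ∈ frontier Ω) {v : ℂ}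
    (hv : ‖v‖ < ρ) (hm : p + ν p * v ∈ closure Ω) : -(K * ‖v‖ ^ (1 + α)) ≤ v.re := by
  have hν := h.normal_ne_zero hp
  have hc : Continuous fun z : ℂ => (z - p) / ν p := by fun_prop
  have hval : (p + ν p * v - p) / ν p = v := by field_simp; ring
  have hα := h.alpha_pos
  have h1 : ContinuousAt (fun z : ℂ => ((z - p) / ν p).re + K * ‖(z - p) / ν p‖ ^ (1 + α))
      (p + ν p * v) := by
    refine (Complex.continuous_re.comp hc).continuousAt.add (ContinuousAt.const_mul ?_ _)
    exact hc.norm.continuousAt.rpow_const (.inr (by linarith))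
  by_contra! hlt
  have h2 := h1.eventually_lt_const (u := 0) (by simp only [hval]; linarith)
  have h3 := (hc.norm.continuousAt (x := p + ν p * v)).eventually_lt_const (u := ρ)
    (by beta_reduce; rwa [hval])
  obtain ⟨z, hz, hz2, hz3⟩ := ((mem_closure_iff_frequently.1 hm).and_eventually (h2.and h3)).exists
  have h4 := h.le_re p hp ((z - p) / ν p) hz3 (by
    rwa [mul_div_cancel₀ _ hν, add_sub_cancel])
  linarith

/-- Boundary chords are nearly tangent. -/
lemma IsFlat.abs_re_chord_le (h : IsFlat α ρ K ν Ω) (hΩ : IsOpen Ω) {p q : ℂ}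
    (hp : p ∈ frontier Ω) (hq : q ∈ frontier Ω) (hpq : ‖q - p‖ < ρ) :
    |((q - p) / ν p).re| ≤ K * ‖q - p‖ ^ (1 + α) := by
  have hν := h.normal_ne_zero hp
  have he : p + ν p * ((q - p) / ν p) = q := by field_simp; ring
  have h1 := h.norm_div_normal hp (q - p)
  rw [← h1] at hpq ⊢
  refine abs_le.2 ⟨h.le_re_of_mem_closure hp hpq (by rw [he]; exact hq.1), not_lt.1 fun hlt => ?_⟩
  have := h.mem p hp _ hpq hlt
  rw [he] at this
  exact hq.2 (by rwa [hΩ.interior_eq])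

/-- The interior normal is Hölder continuous. -/
lemma IsFlat.norm_normal_sub_le (h : IsFlat α ρ K ν Ω) (hΩ : IsOpen Ω) {p q : ℂ}
    (hp : p ∈ frontier Ω) (hq : q ∈ frontier Ω) (hpq : 2 * ‖q - p‖ < ρ) :
    ‖ν q - ν p‖ ≤ 28 * (K * ‖q - p‖ ^ α) := by
  rcases eq_or_ne q p with rfl | hne
  · have := h.one_le
    rw [sub_self, norm_zero]; positivity
  set d := ‖q - p‖
  have hd : 0 < d := norm_pos_iff.2 (sub_ne_zero.2 hne)
  have hνp := h.normal_ne_zero hp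
  have hνq := h.normal_ne_zero hq
  set σ := ν q / ν p
  have hσ : ‖σ‖ = 1 := by rw [h.norm_div_normal hp, h.norm_normal q hq]
  set ε := K * d ^ α
  have hε0 : 0 < ε := mul_pos (by linarith [h.one_le]) (Real.rpow_pos_of_pos hd α)
  have hKd : K * d ^ (1 + α) = ε * d := by rw [h.rpow_eq hd.le]; ring
  have hε : ε ≤ 1 / 100 := by
    have := h.rpow_le hd.le (by linarith)
    rw [hKd] at this
    nlinarith
  have hw := abs_le.1 (h.abs_re_chord_le hΩ hp hq (by linarith))
  rw [show ‖q - p‖ = d from rfl, hKd] at hw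
  have hα := h.alpha_pos
  have hK : 0 < K := by linarith [h.one_le]
  -- The point `q + ν q * (d e)` is in `Ω` by flatness at `q`, and flatness at `p` then bounds it
  -- from below. The chord `q - p` costs `ε d` and the error at distance `2d` costs at most `4 ε d`.
  have key : ∀ e : ℂ, ‖e‖ ≤ 1 → ε < e.re → -(5 * ε) ≤ (σ * e).re := by
    intro e he hre
    have hv : ‖(d : ℂ) * e‖ ≤ d := by
      rw [norm_mul, Complex.norm_real, Real.norm_of_nonneg hd.le]
      nlinarith
    have h1 : q + ν q * (d * e) ∈ Ω := by
      refine h.mem q hq _ (by linarith) ?_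
      rw [Complex.re_ofReal_mul]
      calc _ ≤ K * d ^ (1 + α) := by gcongr
        _ = d * ε := by rw [hKd, mul_comm]
        _ < _ := by gcongr
    have h2 : p + ν p * ((q - p) / ν p + σ * (d * e)) = q + ν q * (d * e) := by
      simp only [σ]; field_simp; ring
    have h3 : ‖(q - p) / ν p + σ * (d * e)‖ ≤ 2 * d := by
      refine (norm_add_le _ _).trans ?_
      rw [h.norm_div_normal hp, norm_mul, hσ]
      simp only [d] at hv ⊢
      linarith
    have h4 := h.le_re p hp _ (by linarith) (by rwa [h2])
    have h5 : K * ‖(q - p) / ν p + σ * (d * e)‖ ^ (1 + α) ≤ 4 * (ε * d) := by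
      calc _ ≤ K * (2 * d) ^ (1 + α) := by gcongr
        _ = 2 ^ (1 + α) * (K * d ^ (1 + α)) := by
          rw [Real.mul_rpow two_pos.le hd.le]; ring
        _ ≤ 2 ^ (2 : ℝ) * (K * d ^ (1 + α)) := by
          gcongr
          · norm_num
          · linarith [h.alpha_lt]
        _ = _ := by rw [hKd]; norm_num
    have h6 : (σ * (d * e)).re = d * (σ * e).re := by
      rw [mul_left_comm, Complex.re_ofReal_mul]
    rw [Complex.add_re, h6] at h4
    have h7 : d * (-(5 * ε)) ≤ d * (σ * e).re := by linarith [hw.2]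
    exact le_of_mul_le_mul_left h7 hd
  have hsq : σ.re ^ 2 + σ.im ^ 2 = 1 := by
    have := Complex.sq_norm σ
    rw [hσ, Complex.normSq_apply] at this
    nlinarith
  have hre := abs_le.1 (Complex.abs_re_le_norm σ)
  rw [hσ] at hre
  have hnorm : ∀ t : ℝ, |t| ≤ 1 / 2 → ‖((2 * ε : ℝ) : ℂ) + (t : ℂ) * Complex.I‖ ≤ 1 := by
    intro t ht
    refine (norm_add_le _ _).trans ?_
    rw [norm_mul, Complex.norm_I, Complex.norm_real, Complex.norm_real, Real.norm_eq_abs,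
      Real.norm_eq_abs, abs_of_pos (by positivity)]
    linarith
  -- The directions `2ε ± i/2` give `|σ.im| ≤ 14 ε`, and the direction `1/2` excludes `σ` near `-1`.
  -- Then `1 - σ.re ≤ 1 - σ.re ^ 2 = σ.im ^ 2 ≤ 14 ε`, whence the total `28 ε`.
  have k1 := key _ (hnorm (1 / 2) (by norm_num)) (by simp; linarith)
  have k2 := key _ (hnorm (-(1 / 2)) (by norm_num)) (by simp; linarith)
  have k3 := key (1 / 2 : ℝ) (by rw [Complex.norm_real]; norm_num) (by rw [Complex.ofReal_re]; linarith)
  simp only [Complex.mul_re, Complex.add_re, Complex.add_im, Complex.mul_im, Complex.ofReal_re,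
    Complex.ofReal_im, Complex.I_re, Complex.I_im] at k1 k2 k3
  have hi : |σ.im| ≤ 14 * ε := abs_le.2 ⟨by nlinarith, by nlinarith⟩
  have hi2 : σ.im ^ 2 ≤ 14 * ε * 1 := by
    rw [← sq_abs, sq]
    exact mul_le_mul hi (hi.trans (by linarith)) (abs_nonneg _) (by positivity)
  have hre0 : 0 < σ.re := by
    by_contra! hle
    have : σ.re ^ 2 ≤ 1 / 4 := by nlinarith
    linarith
  have h8 : ‖σ - 1‖ ≤ 28 * ε := by
    refine (Complex.norm_le_abs_re_add_abs_im _).trans ?_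
    rw [Complex.sub_re, Complex.sub_im, Complex.one_re, Complex.one_im, sub_zero,
      abs_of_nonpos (by linarith)]
    nlinarith
  have h9 : ν q - ν p = ν p * (σ - 1) := by simp only [σ]; field_simp
  rw [h9, norm_mul, h.norm_normal p hp, one_mul]
  exact h8

/-- Every point close to the boundary lies in a cone around the normal at its nearest boundary
point. -/
lemma exists_nearest (hΩ : IsOpen Ω) (hne : Ω ≠ univ) {ζ : ℂ} (hζ : ζ ∈ Ω) :
    0 < infDist ζ Ωᶜ ∧ ball ζ (infDist ζ Ωᶜ) ⊆ Ω ∧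
      ∃ p ∈ frontier Ω, ‖ζ - p‖ = infDist ζ Ωᶜ := by
  have hcl : IsClosed Ωᶜ := hΩ.isClosed_compl
  have hnon : (Ωᶜ).Nonempty := nonempty_compl.2 hne
  have hpos : 0 < infDist ζ Ωᶜ := (hcl.notMem_iff_infDist_pos hnon).1 (by simpa)
  have hsub : ball ζ (infDist ζ Ωᶜ) ⊆ Ω := ball_infDist_compl_subset
  refine ⟨hpos, hsub, ?_⟩
  obtain ⟨p, hp, hd⟩ := hcl.exists_infDist_eq_dist hnon ζ
  refine ⟨p, ⟨?_, by rwa [hΩ.interior_eq]⟩, by rw [hd, dist_eq_norm]⟩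
  have h1 : p ∈ closure (ball ζ (infDist ζ Ωᶜ)) := by
    rw [closure_ball _ hpos.ne', mem_closedBall, dist_comm, hd]
  exact closure_mono hsub h1

/-- For `t < d` the point `ζ - ν p * t` is still in the inscribed ball, so flatness at `p` gives
`((ζ - p) / ν p).re - t ≥ -d/50`. Letting `t → d` shows that `ζ` lies almost straight above its
nearest boundary point. -/
lemma IsFlat.half_le_re_of_nearest (h : IsFlat α ρ K ν Ω) {p : ℂ} (hp : p ∈ frontier Ω) {ζ : ℂ}
    {d : ℝ} (hball : ball ζ d ⊆ Ω) (hd : ‖ζ - p‖ = d) (hd0 : 0 < d) (hdρ : 2 * d < ρ) :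
    d / 2 ≤ ((ζ - p) / ν p).re := by
  have hν := h.normal_ne_zero hp
  have hlim : Tendsto (fun t : ℝ => t - d / 50) (𝓝[<] d) (𝓝 (d - d / 50)) :=
    (Continuous.tendsto (by fun_prop) d).mono_left nhdsWithin_le_nhds
  have h1 : d - d / 50 ≤ ((ζ - p) / ν p).re := by
    refine le_of_tendsto hlim ?_
    filter_upwards [Ioo_mem_nhdsLT hd0] with t ht
    have h2 : p + ν p * ((ζ - p) / ν p - t) ∈ Ω := by
      refine hball ?_
      rw [mem_ball, dist_eq_norm, show p + ν p * ((ζ - p) / ν p - t) - ζ = -(ν p * t) by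
        field_simp; ring, norm_neg, norm_mul, h.norm_normal p hp, Complex.norm_real,
        Real.norm_of_nonneg ht.1.le, one_mul]
      exact ht.2
    have h3 : ‖(ζ - p) / ν p - t‖ ≤ 2 * d := by
      refine (norm_sub_le _ _).trans ?_
      rw [h.norm_div_normal hp, hd, Complex.norm_real, Real.norm_of_nonneg ht.1.le]
      linarith [ht.2]
    have h4 := h.le_re p hp _ (by linarith) h2
    have h5 := h.rpow_le (norm_nonneg ((ζ - p) / ν p - t)) (by linarith)
    rw [Complex.sub_re, Complex.ofReal_re] at h4
    linarith
  linarith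

/-- In the ball of radius `d/2` about `p - ν p * d` one has `v.re < -d/2`, far below what flatness
allows. This exterior ball makes `(f - p')⁻¹`, with `p'` its centre, a bounded function when `f'` is
estimated. -/
lemma IsFlat.exterior_ball (h : IsFlat α ρ K ν Ω) {p : ℂ} (hp : p ∈ frontier Ω) {d : ℝ}
    (hd : 0 < d) (hdρ : 2 * d < ρ) {ζ : ℂ} (hζ : ζ ∈ Ω) : d / 2 ≤ ‖ζ - (p - ν p * d)‖ := by
  have hν := h.normal_ne_zero hp
  by_contra! hlt
  set e := (ζ - (p - ν p * d)) / ν p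
  have he : ‖e‖ < d / 2 := by rwa [h.norm_div_normal hp]
  have h1 : p + ν p * (e - d) = ζ := by simp only [e]; field_simp; ring
  have h2 : ‖e - d‖ ≤ 3 / 2 * d := by
    refine (norm_sub_le _ _).trans ?_
    rw [Complex.norm_real, Real.norm_of_nonneg hd.le]; linarith
  have h3 := h.le_re p hp (e - d) (by linarith) (by rwa [h1])
  have h4 := h.rpow_le (norm_nonneg (e - d)) (by linarith)
  rw [Complex.sub_re, Complex.ofReal_re] at h3
  linarith [(abs_le.1 (Complex.abs_re_le_norm e)).2]

end

end GreenInverse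

/-! ### Barriers and the boundary decay of the Riemann map -/

namespace GreenInverse

open Set Metric Filter Topology Bornology

/-- Near the imaginary axis `Re v^{1+α}` is negative. -/
lemma re_cpow_le_neg {α : ℝ} (hα : 0 < α) (hα1 : α < 1) {v : ℂ} (hv : |v.re| ≤ α / 4 * ‖v‖) :
    (v ^ ((1 + α : ℝ) : ℂ)).re ≤ -(Real.sin (α * Real.pi / 4) * ‖v‖ ^ (1 + α)) := by
  rcases eq_or_ne v 0 with rfl | hv0
  · rw [norm_zero, Real.zero_rpow (by linarith), Complex.ofReal_add, Complex.ofReal_one,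
      Complex.zero_cpow (by exact_mod_cast (by linarith : (1 : ℝ) + α ≠ 0))]
    simp
  have hn : 0 < ‖v‖ := norm_pos_iff.2 hv0
  have hπ := Real.pi_pos
  set t := |v.arg|
  have ht0 : 0 ≤ t := abs_nonneg _
  have htπ : t ≤ Real.pi := Complex.abs_arg_le_pi v
  have h1 : |Real.sin (Real.pi / 2 - t)| ≤ α / 4 := by
    rw [Real.sin_pi_div_two_sub, Real.cos_abs, Complex.cos_arg hv0, abs_div, abs_norm,
      div_le_iff₀ hn]
    exact hv
  have h2 := (Real.mul_abs_le_abs_sin (x := Real.pi / 2 - t)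
    (abs_le.2 ⟨by linarith, by linarith⟩)).trans h1
  have h3 : |Real.pi / 2 - t| ≤ α / 4 * (Real.pi / 2) := by
    rw [div_mul_eq_mul_div, div_le_iff₀ hπ] at h2
    linarith
  obtain ⟨h4, h5⟩ := abs_le.1 h3
  -- Now `|arg v|` is within `απ/8` of `π/2`, so `(1 + α)|arg v|` is within `π/2 - απ/4` of `π`.
  have h6 : Real.cos (v.arg * (1 + α)) ≤ -Real.sin (α * Real.pi / 4) := by
    have h7 : Real.cos (v.arg * (1 + α)) = -Real.cos |t * (1 + α) - Real.pi| := by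
      rw [Real.cos_abs, Real.cos_sub_pi, neg_neg, ← Real.cos_abs (v.arg * (1 + α)), abs_mul,
        abs_of_pos (by linarith : 0 < 1 + α)]
    rw [h7, neg_le_neg_iff, ← Real.cos_pi_div_two_sub]
    have hlow : Real.pi / 2 * (1 - α / 4) * (1 + α) ≤ t * (1 + α) := by
      have : Real.pi / 2 * (1 - α / 4) ≤ t := by linarith
      gcongr
    have hupp : t * (1 + α) ≤ Real.pi / 2 * (1 + α / 4) * (1 + α) := by
      have : t ≤ Real.pi / 2 * (1 + α / 4) := by linarith
      gcongr
    have hα2 : α * α ≤ α := by nlinarith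
    have e1 := mul_le_mul_of_nonneg_left hα2 hπ.le
    have e2 := mul_le_mul_of_nonneg_left hα1.le hπ.le
    refine Real.cos_le_cos_of_nonneg_of_le_pi (abs_nonneg _) (by nlinarith) (abs_le.2 ⟨?_, ?_⟩)
    · nlinarith
    · nlinarith
  rw [Complex.cpow_ofReal_re]
  have h8 : 0 ≤ ‖v‖ ^ (1 + α) := by positivity
  nlinarith [mul_le_mul_of_nonneg_left h6 h8]

section

variable {α ρ K : ℝ} {ν : ℂ → ℂ} {Ω : Set ℂ}

/-- Near the imaginary axis `A Re v^{1+α} ≤ -3K‖v‖^{1+α}`, which outweighs the boundary error;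
elsewhere `v.re ≥ (α/4)‖v‖` dominates once `r` is small. The plus sign gives a barrier that is
nonpositive in the layer containing the boundary, the minus sign one that is nonnegative up to the
boundary, and the last bound keeps both comparable to `v`. -/
lemma IsFlat.exists_barrier (h : IsFlat α ρ K ν Ω) {δ : ℝ} (hδ : 0 < δ) :
    ∃ A r : ℝ, 0 ≤ A ∧ 0 < r ∧ r < δ ∧ 2 * r < ρ ∧ ∀ v : ℂ, ‖v‖ ≤ r →
      -(K * ‖v‖ ^ (1 + α)) ≤ v.re →
      (v.re ≤ 2 * K * ‖v‖ ^ (1 + α) → v.re + A * (v ^ ((1 + α : ℝ) : ℂ)).re ≤ 0) ∧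
      K * ‖v‖ ^ (1 + α) ≤ v.re - A * (v ^ ((1 + α : ℝ) : ℂ)).re ∧
      A * ‖v‖ ^ (1 + α) ≤ ‖v‖ / 4 := by
  have hα := h.alpha_pos
  have hα1 := h.alpha_lt
  have hK : 0 < K := by linarith [h.one_le]
  set c := Real.sin (α * Real.pi / 4)
  have hc : 0 < c := Real.sin_pos_of_pos_of_lt_pi (by positivity) (by nlinarith [Real.pi_pos])
  set A := 3 * K / c
  have hA : 0 < A := by positivity
  have hAc : A * c = 3 * K := by simp only [A]; field_simp
  have hlim : Tendsto (fun t : ℝ => (A + 2 * K) * t ^ α) (𝓝[>] 0) (𝓝 0) := by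
    have h2 : ContinuousAt (fun t : ℝ => (A + 2 * K) * t ^ α) 0 :=
      (Real.continuousAt_rpow_const 0 α (.inr hα.le)).const_mul _
    have h3 := h2.tendsto
    rw [Real.zero_rpow hα.ne', mul_zero] at h3
    exact h3.mono_left nhdsWithin_le_nhds
  obtain ⟨r, hr, hr0, hrδ, hrρ⟩ := ((hlim.eventually_le_const (show (0 : ℝ) < α / 4 by linarith)).and
    (Eventually.and (self_mem_nhdsWithin (s := Ioi (0 : ℝ)))
      (Eventually.and (mem_nhdsWithin_of_mem_nhds (Iio_mem_nhds hδ))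
      (mem_nhdsWithin_of_mem_nhds (Iio_mem_nhds (half_pos h.radius_pos)))))).exists
  refine ⟨A, r, hA.le, hr0, hrδ, by linarith [show r < ρ / 2 from hrρ], fun v hv hre => ?_⟩
  have hs : ‖v‖ ^ (1 + α) = ‖v‖ * ‖v‖ ^ α := h.rpow_eq (norm_nonneg v)
  have hsmall : (A + 2 * K) * ‖v‖ ^ (1 + α) ≤ α / 4 * ‖v‖ := by
    rw [hs]
    calc _ = ‖v‖ * ((A + 2 * K) * ‖v‖ ^ α) := by ring
      _ ≤ ‖v‖ * ((A + 2 * K) * r ^ α) := by gcongr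
      _ ≤ ‖v‖ * (α / 4) := by gcongr
      _ = _ := by ring
  have hn : 0 ≤ ‖v‖ ^ (1 + α) := by positivity
  have hn' := norm_nonneg v
  have hKn : 0 ≤ K * ‖v‖ ^ (1 + α) := by positivity
  have hAn : 0 ≤ A * ‖v‖ ^ (1 + α) := by positivity
  have hcp : |v.re| ≤ α / 4 * ‖v‖ →
      A * (v ^ ((1 + α : ℝ) : ℂ)).re ≤ -(3 * K * ‖v‖ ^ (1 + α)) := fun h1 => by
    have := mul_le_mul_of_nonneg_left (re_cpow_le_neg hα hα1 h1) hA.le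
    calc _ ≤ _ := this
      _ = -(A * c * ‖v‖ ^ (1 + α)) := by ring
      _ = _ := by rw [hAc]
  refine ⟨fun h1 => ?_, ?_, by nlinarith⟩
  · have := hcp (abs_le.2 ⟨by linarith, by linarith⟩)
    linarith
  · by_cases h2 : |v.re| ≤ α / 4 * ‖v‖
    · linarith [hcp h2]
    · have h3 : α / 4 * ‖v‖ ≤ v.re := by
        rcases abs_cases v.re with h4 | h4 <;> linarith
      have h4 := (abs_le.1 (Complex.abs_re_le_norm (v ^ ((1 + α : ℝ) : ℂ)))).2
      rw [Complex.norm_cpow_real] at h4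
      have h5 := mul_le_mul_of_nonneg_left h4 hA.le
      linarith

end

/-- `F : Ω → D` is a Riemann map with inverse `f`. -/
structure IsRiemannMap (Ω : Set ℂ) (F f : ℂ → ℂ) : Prop where
  isOpen : IsOpen Ω
  isBounded : IsBounded Ω
  diffF : DifferentiableOn ℂ F Ω
  diff : DifferentiableOn ℂ f (ball 0 1)
  mapsToF : MapsTo F Ω (ball 0 1)
  mapsTo : MapsTo f (ball 0 1) Ω
  left_inv : ∀ ζ ∈ Ω, f (F ζ) = ζ
  right_inv : ∀ z ∈ ball (0 : ℂ) 1, F (f z) = z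

namespace IsRiemannMap

variable {Ω : Set ℂ} {F f : ℂ → ℂ}

lemma ne_univ (h : IsRiemannMap Ω F f) : Ω ≠ univ := by
  rintro rfl
  exact NormedSpace.unbounded_univ ℝ ℂ h.isBounded

lemma compl_nonempty (h : IsRiemannMap Ω F f) : (Ωᶜ).Nonempty := nonempty_compl.2 h.ne_univ

lemma norm_lt_one (h : IsRiemannMap Ω F f) {ζ : ℂ} (hζ : ζ ∈ Ω) : ‖F ζ‖ < 1 := by
  simpa using h.mapsToF hζ

/-- `|F|` is close to `1` near the boundary. -/
lemma exists_lt_norm (h : IsRiemannMap Ω F f) {t : ℝ} (ht : t < 1) :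
    ∃ δ > 0, ∀ ζ ∈ Ω, infDist ζ Ωᶜ < δ → t < ‖F ζ‖ := by
  have hsub : closedBall (0 : ℂ) t ⊆ ball 0 1 := closedBall_subset_ball ht
  have hK : IsCompact (f '' closedBall 0 t) :=
    (isCompact_closedBall 0 t).image_of_continuousOn (h.diff.continuousOn.mono hsub)
  obtain ⟨δ, hδ, hδK⟩ := hK.exists_thickening_subset_open h.isOpen
    ((h.mapsTo.mono_left hsub).image_subset)
  refine ⟨δ, hδ, fun ζ hζ hd => ?_⟩
  by_contra! hle
  obtain ⟨y, hy, hyd⟩ := (infDist_lt_iff h.compl_nonempty).1 hd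
  refine hy (hδK (mem_thickening_iff.2 ⟨ζ, ⟨F ζ, by simpa using hle, h.left_inv ζ hζ⟩, ?_⟩))
  rwa [dist_comm]

/-- `|F|` is bounded away from `1` away from the boundary. -/
lemma exists_norm_le (h : IsRiemannMap Ω F f) {δ : ℝ} (hδ : 0 < δ) :
    ∃ η > 0, ∀ ζ ∈ Ω, δ ≤ infDist ζ Ωᶜ → ‖F ζ‖ ≤ 1 - η := by
  set S := {ζ : ℂ | δ ≤ infDist ζ Ωᶜ} ∩ closure Ω
  have hS : IsCompact S := h.isBounded.isCompact_closure.inter_left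
    (isClosed_le continuous_const (continuous_infDist_pt _))
  have hSΩ : S ⊆ Ω := fun ζ hζ => by
    by_contra hn
    have := hζ.1
    rw [mem_ofPred_eq, infDist_zero_of_mem hn] at this
    linarith
  rcases S.eq_empty_or_nonempty with he | hne
  · refine ⟨1, one_pos, fun ζ hζ hd => absurd (show ζ ∈ S from ⟨hd, subset_closure hζ⟩) ?_⟩
    simp [he]
  · obtain ⟨ζ₀, hζ₀, hmax⟩ := hS.exists_isMaxOn hne (h.diffF.continuousOn.mono hSΩ).norm
    refine ⟨1 - ‖F ζ₀‖, by linarith [h.norm_lt_one (hSΩ hζ₀)], fun ζ hζ hd => ?_⟩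
    have : ‖F ζ‖ ≤ ‖F ζ₀‖ := hmax (show ζ ∈ S from ⟨hd, subset_closure hζ⟩)
    linarith

end IsRiemannMap

section

variable {α ρ K : ℝ} {ν : ℂ → ℂ} {Ω : Set ℂ} {F f : ℂ → ℂ}

/-- The part of `Ω` near the boundary point `p`, in the coordinates given by the normal. -/
def localDomain (ν : ℂ → ℂ) (Ω : Set ℂ) (p : ℂ) (r : ℝ) : Set ℂ :=
  ball 0 r ∩ (fun v => p + ν p * v) ⁻¹' Ω

lemma isOpen_localDomain (hΩ : IsOpen Ω) (p : ℂ) (r : ℝ) : IsOpen (localDomain ν Ω p r) :=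
  isOpen_ball.inter (hΩ.preimage (by fun_prop))

lemma IsFlat.localDomain_frontier (h : IsFlat α ρ K ν Ω) (hΩ : IsOpen Ω) {p : ℂ}
    (hp : p ∈ frontier Ω) {r : ℝ} (hr : 0 < r) (hrρ : r < ρ) {z : ℂ}
    (hz : z ∈ frontier (localDomain ν Ω p r)) :
    ‖z‖ ≤ r ∧ -(K * ‖z‖ ^ (1 + α)) ≤ z.re ∧
      (p + ν p * z ∈ frontier Ω ∧ z.re ≤ K * ‖z‖ ^ (1 + α) ∨ p + ν p * z ∈ Ω ∧ ‖z‖ = r) := by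
  have hzr : ‖z‖ ≤ r := by
    have := closure_mono (inter_subset_left : localDomain ν Ω p r ⊆ ball 0 r) hz.1
    rw [closure_ball _ hr.ne'] at this
    simpa using this
  have hzcl : p + ν p * z ∈ closure Ω := by
    have hc : Continuous fun v => p + ν p * v := by fun_prop
    exact map_mem_closure (f := fun v => p + ν p * v) hc hz.1 fun v hv => hv.2
  have hznot : z ∉ localDomain ν Ω p r := by
    have := hz.2
    rwa [(isOpen_localDomain hΩ p r).interior_eq] at this
  refine ⟨hzr, h.le_re_of_mem_closure hp (by linarith) hzcl, ?_⟩
  by_cases hm : p + ν p * z ∈ Ω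
  · refine .inr ⟨hm, le_antisymm hzr (not_lt.1 fun hlt => hznot ⟨by simpa using hlt, hm⟩)⟩
  · exact .inl ⟨⟨hzcl, by rwa [hΩ.interior_eq]⟩,
      not_lt.1 fun hlt => hm (h.mem p hp z (by linarith) hlt)⟩

/-- Keeps the domain off the branch cut of `v ^ (1 + α)`: on the negative real axis `‖v‖ = -v.re`,
contrary to `-v.re ≤ ‖v‖ / 100`. -/
lemma IsFlat.im_ne_zero_of_re_neg (h : IsFlat α ρ K ν Ω) {z : ℂ} (hz : ‖z‖ ≤ ρ)
    (hre : -(K * ‖z‖ ^ (1 + α)) ≤ z.re) : 0 ≤ z.re ∨ z.im ≠ 0 := by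
  by_contra! hcon
  have h1 := h.rpow_le (norm_nonneg z) hz
  have h2 : ‖z‖ = -z.re := by
    rw [← Complex.re_add_im z, hcon.2]
    simp [abs_of_neg hcon.1]
  linarith

lemma continuousAt_barrier {s A : ℝ} (hs : 0 < s) {z : ℂ} (hz : 0 ≤ z.re ∨ z.im ≠ 0) :
    ContinuousAt (fun v : ℂ => v + A * v ^ (s : ℂ)) z :=
  continuousAt_id.add ((Complex.continuousAt_cpow_const_of_re_pos hz (by simpa)).const_mul _)

lemma IsFlat.differentiableOn_barrier (h : IsFlat α ρ K ν Ω) (hΩ : IsOpen Ω) {p : ℂ}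
    (hp : p ∈ frontier Ω) {r : ℝ} (hrρ : r < ρ) (A : ℝ) :
    DifferentiableOn ℂ (fun v : ℂ => v + A * v ^ ((1 + α : ℝ) : ℂ)) (localDomain ν Ω p r) := by
  intro v hv
  have hvr : ‖v‖ < r := by simpa using hv.1
  have h1 := h.im_ne_zero_of_re_neg (by linarith) (h.le_re p hp v (by linarith) hv.2)
  have h0 : v ≠ 0 := by
    rintro rfl
    have := hv.2
    rw [mem_preimage, mul_zero, add_zero] at this
    exact hp.2 (by rwa [hΩ.interior_eq])
  have h2 : v ∈ Complex.slitPlane := by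
    rw [Complex.mem_slitPlane_iff]
    by_cases him : v.im = 0
    · left
      refine lt_of_le_of_ne (h1.resolve_right (not_not.2 him)) fun he => h0 ?_
      exact Complex.ext he.symm him
    · exact .inr him
  exact (differentiableAt_id.add
    ((differentiableAt_id.cpow_const h2).const_mul _)).differentiableWithinAt

/-- A quantitative Hopf lemma: the maximum principle shows `‖F · exp (c B)‖ ≤ 1` in the local
domain. Where `Re B ≤ 0` this only needs `‖F‖ < 1`. The other frontier points lie at a definite
depth in `Ω`, where `‖F‖ ≤ 1 - η` absorbs the exponential for small `c`. -/
lemma IsFlat.exists_lower_barrier (h : IsFlat α ρ K ν Ω) (hR : IsRiemannMap Ω F f) :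
    ∃ c r : ℝ, 0 < c ∧ 0 < r ∧ 2 * r < ρ ∧ ∀ p ∈ frontier Ω, ∀ v : ℂ, ‖v‖ < r →
      p + ν p * v ∈ Ω → ‖v‖ / 2 ≤ v.re → ‖F (p + ν p * v)‖ ≤ Real.exp (-(c * ‖v‖)) := by
  have hα := h.alpha_pos
  have hK : 0 < K := by linarith [h.one_le]
  obtain ⟨A, r, hA, hr, -, hrρ, hbar⟩ := h.exists_barrier one_pos
  -- With this `δ`, a point with `‖z‖ = r` and `z.re > 2K r^{1+α}` keeps its whole `δ`-neighborhood
  -- in the region that flatness places inside `Ω`.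
  obtain ⟨δ, hδ, hδr, hδK⟩ : ∃ δ > 0, r + δ < ρ ∧ K * (r + δ) ^ (1 + α) + δ < 2 * K * r ^ (1 + α) := by
    have h1 : ContinuousAt (fun t : ℝ => K * (r + t) ^ (1 + α) + t) 0 := by
      refine ContinuousAt.add (ContinuousAt.const_mul ?_ _) continuousAt_id
      exact ContinuousAt.rpow_const (by fun_prop) (.inr (by linarith))
    have h2 := h1.eventually_lt_const (u := 2 * K * r ^ (1 + α)) (by
      simp only [add_zero]
      have : 0 < K * r ^ (1 + α) := by positivity
      linarith)
    obtain ⟨t, ht, ht0, htρ⟩ := ((h2.filter_mono nhdsWithin_le_nhds).and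
      (Eventually.and (self_mem_nhdsWithin (s := Ioi (0 : ℝ)))
      (mem_nhdsWithin_of_mem_nhds (Iio_mem_nhds (show (0 : ℝ) < ρ - r by linarith))))).exists
    exact ⟨t, ht0, by linarith [show t < ρ - r from htρ], ht⟩
  obtain ⟨η, hη, hF⟩ := hR.exists_norm_le hδ
  obtain ⟨c, hc, hcη⟩ : ∃ c > 0, (1 - η) * Real.exp (c * (r + A * r ^ (1 + α))) ≤ 1 := by
    have h1 : ContinuousAt (fun c : ℝ => (1 - η) * Real.exp (c * (r + A * r ^ (1 + α)))) 0 := by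
      fun_prop
    have h2 := h1.eventually_lt_const (u := 1) (by simp; linarith)
    obtain ⟨t, ht, ht0⟩ := ((h2.filter_mono nhdsWithin_le_nhds).and
      (self_mem_nhdsWithin (s := Ioi (0 : ℝ)))).exists
    exact ⟨t, ht0, ht.le⟩
  refine ⟨c / 4, r, by positivity, hr, hrρ, fun p hp v hv hvΩ hvre => ?_⟩
  have hν := h.norm_normal p hp
  set B : ℂ → ℂ := fun v => v + A * v ^ ((1 + α : ℝ) : ℂ)
  have hBre : ∀ v, (B v).re = v.re + A * (v ^ ((1 + α : ℝ) : ℂ)).re := fun v => by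
    simp only [B]; rw [Complex.add_re, Complex.re_ofReal_mul]
  set V := localDomain ν Ω p r
  have hFd : DifferentiableOn ℂ (fun v => F (p + ν p * v)) V :=
    hR.diffF.comp (by fun_prop) fun v hv => hv.2
  have hE : DifferentiableOn ℂ (fun v => F (p + ν p * v) * Complex.exp (c * B v)) V :=
    hFd.mul ((h.differentiableOn_barrier hR.isOpen hp (by linarith) A).const_mul _).cexp
  have hnorm : ∀ v, ‖F (p + ν p * v) * Complex.exp (c * B v)‖ =
      ‖F (p + ν p * v)‖ * Real.exp (c * (B v).re) := fun v => by
    rw [norm_mul, Complex.norm_exp, Complex.re_ofReal_mul]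
  have key := norm_le_of_frontier_limsup (isOpen_localDomain hR.isOpen p r)
    (isBounded_ball.subset inter_subset_left) hE (C := 1) (fun z hz ε hε => ?_)
    (show v ∈ V from ⟨by simpa using hv, hvΩ⟩)
  · rw [hnorm] at key
    have h1 : ‖v‖ / 4 ≤ (B v).re := by
      rw [hBre]
      have h3 := (hbar v hv.le (by
        have : 0 ≤ K * ‖v‖ ^ (1 + α) := by positivity
        linarith [norm_nonneg v])).2.2
      have h4 := (abs_le.1 (Complex.abs_re_le_norm (v ^ ((1 + α : ℝ) : ℂ)))).1
      rw [Complex.norm_cpow_real] at h4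
      have h5 := mul_le_mul_of_nonneg_left h4 hA
      linarith
    have h2 : Real.exp (c / 4 * ‖v‖) ≤ Real.exp (c * (B v).re) := by
      apply Real.exp_le_exp.2
      nlinarith
    rw [Real.exp_neg, ← one_div, le_div_iff₀ (Real.exp_pos _)]
    exact (mul_le_mul_of_nonneg_left h2 (norm_nonneg _)).trans key
  · obtain ⟨hzr, hzre, hcase⟩ := h.localDomain_frontier hR.isOpen hp hr (by linarith) hz
    have hBc : ContinuousAt (fun v => c * (B v).re) z :=
      (Complex.continuous_re.continuousAt.comp (continuousAt_barrier (by linarith)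
        (h.im_ne_zero_of_re_neg (by linarith) hzre))).const_mul c
    by_cases hBz : (B z).re ≤ 0
    · have h1 : ∀ᶠ w in 𝓝 z, Real.exp (c * (B w).re) < 1 + ε := by
        refine (Real.continuous_exp.continuousAt.comp hBc).eventually_lt_const ?_
        have : Real.exp (c * (B z).re) ≤ 1 := Real.exp_le_one_iff.2 (by nlinarith)
        simp only [Function.comp]
        linarith
      filter_upwards [h1.filter_mono nhdsWithin_le_nhds, self_mem_nhdsWithin] with w hw hwV
      rw [hnorm]
      have := (hR.norm_lt_one hwV.2).le
      nlinarith [Real.exp_pos (c * (B w).re)]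
    · have h2K : 2 * K * ‖z‖ ^ (1 + α) < z.re := by
        by_contra! hle
        exact hBz (by rw [hBre]; exact (hbar z hzr hzre).1 hle)
      have hKn : 0 ≤ K * ‖z‖ ^ (1 + α) := by positivity
      rcases hcase with ⟨-, hle⟩ | ⟨hm, hzr'⟩
      · linarith
      have hdepth : δ ≤ infDist (p + ν p * z) Ωᶜ := by
        refine (le_infDist hR.compl_nonempty).2 fun y hy => ?_
        by_contra! hlt
        refine hy ?_
        have hν0 := h.normal_ne_zero hp
        have he : p + ν p * (z + (y - (p + ν p * z)) / ν p) = y := by field_simp; ring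
        rw [dist_comm, dist_eq_norm, ← h.norm_div_normal hp] at hlt
        set e := (y - (p + ν p * z)) / ν p
        rw [← he]
        have h3 : ‖z + e‖ ≤ r + δ := (norm_add_le _ _).trans (by linarith)
        refine h.mem p hp _ (by linarith) ?_
        calc K * ‖z + e‖ ^ (1 + α) ≤ K * (r + δ) ^ (1 + α) := by gcongr
          _ < z.re - δ := by rw [hzr'] at h2K; linarith
          _ ≤ _ := by
            rw [Complex.add_re]; linarith [(abs_le.1 (Complex.abs_re_le_norm e)).1]
      have hval : ‖F (p + ν p * z)‖ * Real.exp (c * (B z).re) ≤ 1 := by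
        have h3 : (B z).re ≤ r + A * r ^ (1 + α) := by
          have h4 := (abs_le.1 (Complex.abs_re_le_norm (z ^ ((1 + α : ℝ) : ℂ)))).2
          rw [Complex.norm_cpow_real] at h4
          have h5 := mul_le_mul_of_nonneg_left h4 hA
          rw [hBre, ← hzr']
          linarith [(abs_le.1 (Complex.abs_re_le_norm z)).2]
        have h6 := hF _ hm hdepth
        refine le_trans ?_ hcη
        have h7 := (norm_nonneg _).trans h6
        gcongr
      have hcont : ContinuousAt (fun v => ‖F (p + ν p * v)‖ * Real.exp (c * (B v).re)) z := by
        refine ContinuousAt.mul (ContinuousAt.norm ?_) (Real.continuous_exp.continuousAt.comp hBc)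
        exact ContinuousAt.comp (f := fun v => p + ν p * v) (g := F)
          (hR.diffF.continuousOn.continuousAt (hR.isOpen.mem_nhds hm)) (by fun_prop)
      filter_upwards [(hcont.eventually_lt_const (u := 1 + ε) (by linarith)).filter_mono
        nhdsWithin_le_nhds] with w hw
      rw [hnorm]
      exact hw.le

/-- The maximum principle is applied to `F⁻¹ exp (-C B)`, in a radius so small that `‖F‖ > 1/2` and
`F⁻¹` makes sense. At `frontier Ω`, `‖F‖ → 1` and `Re B ≥ 0`; on the circular part the exponential
beats the factor `2`. -/
lemma IsFlat.exists_upper_barrier (h : IsFlat α ρ K ν Ω) (hR : IsRiemannMap Ω F f) :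
    ∃ C r : ℝ, 0 < C ∧ 0 < r ∧ 2 * r < ρ ∧ ∀ p ∈ frontier Ω, ∀ v : ℂ, ‖v‖ < r →
      p + ν p * v ∈ Ω → Real.exp (-(C * ‖v‖)) ≤ ‖F (p + ν p * v)‖ := by
  have hα := h.alpha_pos
  have hK : 0 < K := by linarith [h.one_le]
  obtain ⟨δ₀, hδ₀, hhalf⟩ := hR.exists_lt_norm (show (1 / 2 : ℝ) < 1 by norm_num)
  obtain ⟨A, r, hA, hr, hrδ, hrρ, hbar⟩ := h.exists_barrier hδ₀
  have hKr : 0 < K * r ^ (1 + α) := by positivity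
  -- On the circular part `Re B ≥ K r^{1+α}`, so this `C` gives `exp (-C Re B) ≤ 1/2 < ‖F‖`. The
  -- final constant is `2 * C` because `Re B ≤ 2‖v‖`.
  set C := Real.log 2 / (K * r ^ (1 + α))
  have hC : 0 < C := by positivity
  refine ⟨2 * C, r, by positivity, hr, hrρ, fun p hp v hv hvΩ => ?_⟩
  have hν := h.norm_normal p hp
  set B : ℂ → ℂ := fun v => v + ((-A : ℝ) : ℂ) * v ^ ((1 + α : ℝ) : ℂ)
  have hBre : ∀ v, (B v).re = v.re - A * (v ^ ((1 + α : ℝ) : ℂ)).re := fun v => by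
    simp only [B]; rw [Complex.add_re, Complex.re_ofReal_mul]; ring
  set V := localDomain ν Ω p r
  have hdist : ∀ w ∈ V, infDist (p + ν p * w) Ωᶜ ≤ ‖w‖ := by
    intro w hw
    refine (infDist_le_dist_of_mem (show p ∈ Ωᶜ from fun hh =>
      hp.2 (by rwa [hR.isOpen.interior_eq]))).trans ?_
    rw [dist_eq_norm, add_sub_cancel_left, norm_mul, hν, one_mul]
  have hF2 : ∀ w ∈ V, 1 / 2 < ‖F (p + ν p * w)‖ := fun w hw => hhalf _ hw.2
    ((hdist w hw).trans_lt (lt_trans (by simpa using hw.1) hrδ))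
  have hFd : DifferentiableOn ℂ (fun v => F (p + ν p * v)) V :=
    hR.diffF.comp (by fun_prop) fun v hv => hv.2
  have hE : DifferentiableOn ℂ (fun v => (F (p + ν p * v))⁻¹ * Complex.exp (((-C : ℝ) : ℂ) * B v)) V :=
    (hFd.inv fun w hw => norm_pos_iff.1 (by linarith [hF2 w hw])).mul
      ((h.differentiableOn_barrier hR.isOpen hp (by linarith) (-A)).const_mul _).cexp
  have hnorm : ∀ v, ‖(F (p + ν p * v))⁻¹ * Complex.exp (((-C : ℝ) : ℂ) * B v)‖ =
      ‖F (p + ν p * v)‖⁻¹ * Real.exp (-C * (B v).re) := fun v => by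
    rw [norm_mul, norm_inv, Complex.norm_exp, Complex.re_ofReal_mul]
  have key := norm_le_of_frontier_limsup (isOpen_localDomain hR.isOpen p r)
    (isBounded_ball.subset inter_subset_left) hE (C := 1) (fun z hz ε hε => ?_)
    (show v ∈ V from ⟨by simpa using hv, hvΩ⟩)
  · rw [hnorm, inv_mul_le_iff₀ (by linarith [hF2 v ⟨by simpa using hv, hvΩ⟩]), mul_one] at key
    refine le_trans (Real.exp_le_exp.2 ?_) key
    have h1 : (B v).re ≤ 2 * ‖v‖ := by
      rw [hBre]
      have h3 := (hbar v hv.le (h.le_re p hp v (by linarith) hvΩ)).2.2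
      have h4 := (abs_le.1 (Complex.abs_re_le_norm (v ^ ((1 + α : ℝ) : ℂ)))).1
      rw [Complex.norm_cpow_real] at h4
      have h5 := mul_le_mul_of_nonneg_left h4 hA
      linarith [(abs_le.1 (Complex.abs_re_le_norm v)).2, norm_nonneg v]
    nlinarith
  · obtain ⟨hzr, hzre, hcase⟩ := h.localDomain_frontier hR.isOpen hp hr (by linarith) hz
    have hBc : ContinuousAt (fun v => -C * (B v).re) z :=
      (Complex.continuous_re.continuousAt.comp (continuousAt_barrier (by linarith)
        (h.im_ne_zero_of_re_neg (by linarith) hzre))).const_mul (-C)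
    have hBz : K * ‖z‖ ^ (1 + α) ≤ (B z).re := by rw [hBre]; exact (hbar z hzr hzre).2.1
    rcases hcase with ⟨hfr, -⟩ | ⟨hm, hzr'⟩
    · have h1 : ∀ᶠ w in 𝓝 z, Real.exp (-C * (B w).re) < 1 + ε / 2 := by
        refine (Real.continuous_exp.continuousAt.comp hBc).eventually_lt_const ?_
        have h2 : 0 ≤ K * ‖z‖ ^ (1 + α) := by positivity
        have : Real.exp (-C * (B z).re) ≤ 1 := Real.exp_le_one_iff.2 (by nlinarith)
        simp only [Function.comp]
        linarith
      obtain ⟨δ, hδ, hFδ⟩ := hR.exists_lt_norm (t := (1 + ε / 2) / (1 + ε)) (by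
        rw [div_lt_one (by linarith)]; linarith)
      have h2 : ∀ᶠ w in 𝓝 z, infDist (p + ν p * w) Ωᶜ < δ := by
        have hc : Continuous fun w => infDist (p + ν p * w) Ωᶜ :=
          (continuous_infDist_pt _).comp (by fun_prop)
        refine hc.continuousAt.eventually_lt_const ?_
        beta_reduce
        rw [infDist_zero_of_mem (show p + ν p * z ∈ Ωᶜ from fun hh =>
          hfr.2 (by rwa [hR.isOpen.interior_eq]))]
        exact hδ
      filter_upwards [h1.filter_mono nhdsWithin_le_nhds, h2.filter_mono nhdsWithin_le_nhds,
        self_mem_nhdsWithin] with w hw1 hw2 hwV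
      have h3 := hFδ _ hwV.2 hw2
      rw [hnorm, inv_mul_le_iff₀ (by linarith [hF2 w hwV])]
      rw [div_lt_iff₀ (by linarith)] at h3
      linarith
    · have hFz : 1 / 2 < ‖F (p + ν p * z)‖ := by
        refine hhalf _ hm ((infDist_le_dist_of_mem (show p ∈ Ωᶜ from fun hh =>
          hp.2 (by rwa [hR.isOpen.interior_eq]))).trans_lt ?_)
        rw [dist_eq_norm, add_sub_cancel_left, norm_mul, hν, one_mul]
        linarith
      have hval : ‖F (p + ν p * z)‖⁻¹ * Real.exp (-C * (B z).re) ≤ 1 := by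
        rw [inv_mul_le_iff₀ (by linarith), mul_one]
        have h3 : Real.exp (-C * (B z).re) ≤ 1 / 2 := by
          rw [one_div, ← Real.exp_log (two_pos : (0 : ℝ) < 2), ← Real.exp_neg]
          refine Real.exp_le_exp.2 ?_
          rw [hzr'] at hBz
          have := mul_le_mul_of_nonneg_left hBz hC.le
          have h4 : C * (K * r ^ (1 + α)) = Real.log 2 := div_mul_cancel₀ _ hKr.ne'
          linarith
        linarith
      have hcont : ContinuousAt (fun v => ‖F (p + ν p * v)‖⁻¹ * Real.exp (-C * (B v).re)) z := by
        refine ContinuousAt.mul (ContinuousAt.inv₀ (ContinuousAt.norm ?_) (by linarith))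
          (Real.continuous_exp.continuousAt.comp hBc)
        exact ContinuousAt.comp (f := fun v => p + ν p * v) (g := F)
          (hR.diffF.continuousOn.continuousAt (hR.isOpen.mem_nhds hm)) (by fun_prop)
      filter_upwards [(hcont.eventually_lt_const (u := 1 + ε) (by linarith)).filter_mono
        nhdsWithin_le_nhds] with w hw
      rw [hnorm]
      exact hw.le

end

end GreenInverse

/-! ### Bounded derivatives and the injective Lipschitz extension -/

namespace GreenInverse

open Set Metric Filter Topology Bornology

section

variable {α ρ K : ℝ} {ν : ℂ → ℂ} {Ω : Set ℂ} {F f : ℂ → ℂ}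

lemma IsRiemannMap.notMem_of_frontier (h : IsRiemannMap Ω F f) {p : ℂ} (hp : p ∈ frontier Ω) :
    p ∉ Ω := fun hh => hp.2 (by rwa [h.isOpen.interior_eq])

/-- The barrier at the nearest boundary point gives `1 - ‖F ζ‖ ≥ 1 - exp (-c d) ≥ c d / (1 + c d)`
when `d < r`; the remaining points form a set on which `‖F‖ ≤ 1 - η` and `d ≤ M`. -/
lemma IsFlat.exists_le_one_sub_norm (h : IsFlat α ρ K ν Ω) (hR : IsRiemannMap Ω F f) :
    ∃ c > 0, ∀ ζ ∈ Ω, c * infDist ζ Ωᶜ ≤ 1 - ‖F ζ‖ := by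
  obtain ⟨c, r, hc, hr, hrρ, hbar⟩ := h.exists_lower_barrier hR
  obtain ⟨η, hη, hF⟩ := hR.exists_norm_le hr
  obtain ⟨M, hM0, hM⟩ : ∃ M > 0, ∀ ζ ∈ Ω, infDist ζ Ωᶜ ≤ M := by
    obtain ⟨y, hy⟩ := hR.compl_nonempty
    obtain ⟨M, hM⟩ := hR.isBounded.subset_closedBall y
    refine ⟨max M 1, by positivity, fun ζ hζ => (infDist_le_dist_of_mem hy).trans ?_⟩
    exact (mem_closedBall.1 (hM hζ)).trans (le_max_left _ _)
  refine ⟨min (c / (1 + c * r)) (η / M), by positivity, fun ζ hζ => ?_⟩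
  obtain ⟨hd0, hball, p, hp, hpd⟩ := exists_nearest hR.isOpen hR.ne_univ hζ
  set d := infDist ζ Ωᶜ
  rcases lt_or_ge d r with hdr | hdr
  · have hν := h.normal_ne_zero hp
    have he : p + ν p * ((ζ - p) / ν p) = ζ := by field_simp; ring
    have hv : ‖(ζ - p) / ν p‖ = d := by rw [h.norm_div_normal hp, hpd]
    have h1 := hbar p hp ((ζ - p) / ν p) (by rwa [hv]) (by rwa [he])
      (by rw [hv]; exact h.half_le_re_of_nearest hp hball hpd hd0 (by linarith))
    rw [he, hv, Real.exp_neg] at h1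
    have h2 : (Real.exp (c * d))⁻¹ ≤ (1 + c * d)⁻¹ :=
      inv_anti₀ (by positivity) (by linarith [Real.add_one_le_exp (c * d)])
    have h3 : 1 - (1 + c * d)⁻¹ = c * d / (1 + c * d) := by field_simp; ring
    have h4 : min (c / (1 + c * r)) (η / M) * d ≤ c / (1 + c * d) * d := by
      gcongr
      refine (min_le_left _ _).trans ?_
      gcongr
    calc _ ≤ _ := h4
      _ = 1 - (1 + c * d)⁻¹ := by rw [h3]; ring
      _ ≤ _ := by linarith
  · calc _ ≤ η / M * M := by
          gcongr
          · exact min_le_right _ _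
          · exact hM ζ hζ
      _ = η := by field_simp
      _ ≤ _ := by linarith [hF ζ hζ hdr]

lemma IsFlat.exists_one_sub_norm_le (h : IsFlat α ρ K ν Ω) (hR : IsRiemannMap Ω F f) :
    ∃ C > 0, ∀ ζ ∈ Ω, 1 - ‖F ζ‖ ≤ C * infDist ζ Ωᶜ := by
  obtain ⟨C, r, hC, hr, hrρ, hbar⟩ := h.exists_upper_barrier hR
  refine ⟨max C (1 / r), by positivity, fun ζ hζ => ?_⟩
  obtain ⟨hd0, hball, p, hp, hpd⟩ := exists_nearest hR.isOpen hR.ne_univ hζ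
  set d := infDist ζ Ωᶜ
  rcases lt_or_ge d r with hdr | hdr
  · have hν := h.normal_ne_zero hp
    have he : p + ν p * ((ζ - p) / ν p) = ζ := by field_simp; ring
    have hv : ‖(ζ - p) / ν p‖ = d := by rw [h.norm_div_normal hp, hpd]
    have h1 := hbar p hp ((ζ - p) / ν p) (by rwa [hv]) (by rwa [he])
    rw [he, hv] at h1
    have h2 := Real.add_one_le_exp (-(C * d))
    have h3 : C * d ≤ max C (1 / r) * d := by gcongr; exact le_max_left _ _
    linarith
  · calc 1 - ‖F ζ‖ ≤ 1 / r * r := by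
          rw [one_div_mul_cancel hr.ne']; linarith [norm_nonneg (F ζ)]
      _ ≤ _ := by gcongr; exact le_max_right _ _

/-- Schwarz–Pick on the inscribed ball of radius `d` gives `(1 - ‖F ζ‖ ^ 2) / d`, and the numerator
is at most `2 C d`. -/
lemma IsFlat.exists_norm_deriv_le (h : IsFlat α ρ K ν Ω) (hR : IsRiemannMap Ω F f) :
    ∃ C > 0, ∀ ζ ∈ Ω, ‖deriv F ζ‖ ≤ C := by
  obtain ⟨C, hC, hF⟩ := h.exists_one_sub_norm_le hR
  refine ⟨2 * C, by positivity, fun ζ hζ => ?_⟩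
  obtain ⟨hd0, hball, -⟩ := exists_nearest hR.isOpen hR.ne_univ hζ
  refine (norm_deriv_le_schwarz_pick hd0 (hR.diffF.mono hball)
    (hR.mapsToF.mono_left hball)).trans ?_
  rw [div_le_iff₀ hd0]
  nlinarith [hF ζ hζ, hR.norm_lt_one hζ, norm_nonneg (F ζ)]

/-- The derivative of the conformal map of the disk is bounded. -/
lemma IsFlat.exists_norm_deriv_inv_le (h : IsFlat α ρ K ν Ω) (hR : IsRiemannMap Ω F f) :
    ∃ C > 0, ∀ z ∈ ball (0 : ℂ) 1, ‖deriv f z‖ ≤ C := by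
  obtain ⟨c, hc, hF⟩ := h.exists_le_one_sub_norm hR
  set r := ρ / 2
  have hr : 0 < r := half_pos h.radius_pos
  obtain ⟨η, hη, hFr⟩ := hR.exists_norm_le hr
  have hΩK : IsCompact (closedBall (0 : ℂ) (1 - η)) := isCompact_closedBall _ _
  have hsub : closedBall (0 : ℂ) (1 - η) ⊆ ball 0 1 := closedBall_subset_ball (by linarith)
  have hdc : ContinuousOn (deriv f) (ball 0 1) :=
    ((hR.diff.analyticOnNhd isOpen_ball).deriv).continuousOn
  obtain ⟨M, hM⟩ := hΩK.exists_bound_of_continuousOn (hdc.mono hsub)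
  refine ⟨max M (16 / c), by positivity, fun z hz => ?_⟩
  have hζ := hR.mapsTo hz
  have hz1 : ‖z‖ < 1 := by simpa using hz
  obtain ⟨hd0, hball, p, hp, hpd⟩ := exists_nearest hR.isOpen hR.ne_univ hζ
  set d := infDist (f z) Ωᶜ
  rcases lt_or_ge d r with hdr | hdr
  · refine le_trans ?_ (le_max_right _ _)
    -- The function `k = (d/4) / (f - p')` maps the disk into itself because of the exterior ball.
    -- Schwarz–Pick on radius `1 - ‖z‖ ≥ c d`, together with `‖f z - p'‖ ≤ 2 d`, yields `‖f' z‖ ≤ 16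
    -- / c`.
    set p' := p - ν p * d
    have hext : ∀ w ∈ ball (0 : ℂ) 1, d / 2 ≤ ‖f w - p'‖ := fun w hw =>
      h.exterior_ball hp hd0 (by simp only [r] at hdr; linarith) (hR.mapsTo hw)
    have hne : ∀ w ∈ ball (0 : ℂ) 1, f w - p' ≠ 0 := fun w hw =>
      norm_pos_iff.1 (by linarith [hext w hw])
    have hsubz : ball z (1 - ‖z‖) ⊆ ball 0 1 := ball_subset_ball' (by simp)
    set k : ℂ → ℂ := fun w => ((d / 4 : ℝ) : ℂ) / (f w - p')
    have hk : DifferentiableOn ℂ k (ball 0 1) :=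
      (differentiableOn_const _).div (hR.diff.sub_const _) hne
    have hkm : MapsTo k (ball 0 1) (ball 0 1) := fun w hw => by
      rw [mem_ball_zero_iff, norm_div, Complex.norm_real, Real.norm_of_nonneg (by positivity),
        div_lt_one (by linarith [hext w hw])]
      linarith [hext w hw]
    have h1 := norm_deriv_le_schwarz_pick (c := z) (R := 1 - ‖z‖) (by linarith) (hk.mono hsubz)
      (hkm.mono_left hsubz)
    have hfz := (hR.diff.differentiableAt (isOpen_ball.mem_nhds hz)).hasDerivAt
    have h2 : HasDerivAt k (-(((d / 4 : ℝ) : ℂ) * deriv f z) / (f z - p') ^ 2) z := by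
      have := (hasDerivAt_const z ((d / 4 : ℝ) : ℂ)).fun_div (hfz.sub_const p') (hne z hz)
      simpa [k] using this
    rw [h2.deriv, norm_div, norm_neg, norm_mul, Complex.norm_real,
      Real.norm_of_nonneg (by positivity), norm_pow,
      div_le_div_iff₀ (pow_pos (norm_pos_iff.2 (hne z hz)) 2) (by linarith)] at h1
    have h3 : ‖f z - p'‖ ≤ 2 * d := by
      have : f z - p' = (f z - p) + ν p * d := by simp only [p']; ring
      rw [this]
      refine (norm_add_le _ _).trans ?_
      rw [hpd, norm_mul, h.norm_normal p hp, Complex.norm_real, Real.norm_of_nonneg hd0.le]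
      linarith
    have h4 := hF _ hζ
    rw [hR.right_inv z hz] at h4
    have h5 : (1 - ‖k z‖ ^ 2) * ‖f z - p'‖ ^ 2 ≤ 1 * (2 * d) ^ 2 := by
      gcongr
      nlinarith [norm_nonneg (k z)]
    have h6 : d / 4 * ‖deriv f z‖ * (c * d) ≤ 4 * d ^ 2 := by
      calc _ ≤ d / 4 * ‖deriv f z‖ * (1 - ‖z‖) := by gcongr
        _ ≤ _ := h1.trans h5
        _ = _ := by ring
    rw [le_div_iff₀ hc]
    have h7 : d ^ 2 * (‖deriv f z‖ * c) ≤ d ^ 2 * 16 := by nlinarith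
    exact le_of_mul_le_mul_left h7 (by positivity)
  · refine le_trans (hM z ?_) (le_max_left _ _)
    have := hFr _ hζ hdr
    rw [hR.right_inv z hz] at this
    simpa using this

/-- The conformal map has a Lipschitz extension. -/
lemma IsFlat.exists_lipschitz (h : IsFlat α ρ K ν Ω) (hR : IsRiemannMap Ω F f) :
    ∃ g : ℂ → ℂ, IsRiemannMap Ω F g ∧ ∃ L, LipschitzWith L g := by
  obtain ⟨C, hC, hd⟩ := h.exists_norm_deriv_inv_le hR
  have h1 : LipschitzOnWith ⟨C, hC.le⟩ f (ball 0 1) :=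
    (convex_ball 0 1).lipschitzOnWith_of_nnnorm_deriv_le
      (fun z hz => hR.diff.differentiableAt (isOpen_ball.mem_nhds hz)) hd
  obtain ⟨g, hg, hgf⟩ := h1.extend_finite_dimension
  exact ⟨g, ⟨hR.isOpen, hR.isBounded, hR.diffF, hR.diff.congr fun z hz => (hgf hz).symm,
    hR.mapsToF, fun z hz => by rw [← hgf hz]; exact hR.mapsTo hz,
    fun ζ hζ => by rw [← hgf (hR.mapsToF hζ)]; exact hR.left_inv ζ hζ,
    fun z hz => by rw [← hgf hz]; exact hR.right_inv z hz⟩, _, hg⟩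

lemma IsRiemannMap.mem_closure (hR : IsRiemannMap Ω F f) (hf : Continuous f) {z : ℂ}
    (hz : ‖z‖ ≤ 1) : f z ∈ closure Ω := by
  have h1 : z ∈ closure (ball (0 : ℂ) 1) := by
    rw [closure_ball _ one_ne_zero]; simpa using hz
  exact map_mem_closure hf h1 hR.mapsTo

lemma tendsto_ofReal_mul_left (z : ℂ) :
    Tendsto (fun t : ℝ => (t : ℂ) * z) (𝓝[<] 1) (𝓝 z) := by
  have h : Continuous fun t : ℝ => (t : ℂ) * z := by fun_prop
  have := h.tendsto 1
  rw [Complex.ofReal_one, one_mul] at this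
  exact this.mono_left nhdsWithin_le_nhds

lemma ofReal_mul_mem_ball {z : ℂ} (hz : ‖z‖ ≤ 1) {t : ℝ} (ht : t ∈ Ioo (0 : ℝ) 1) :
    (t : ℂ) * z ∈ ball (0 : ℂ) 1 := by
  rw [mem_ball_zero_iff, norm_mul, Complex.norm_real, Real.norm_of_nonneg ht.1.le]
  nlinarith [ht.1, ht.2, norm_nonneg z]

/-- Were `f z` in `Ω`, continuity of `F` there and `F (f (t z)) = t z` would force `F (f z) = z`, of
modulus `1`. -/
lemma IsRiemannMap.mem_frontier (hR : IsRiemannMap Ω F f) (hf : Continuous f) {z : ℂ}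
    (hz : ‖z‖ = 1) : f z ∈ frontier Ω := by
  refine ⟨hR.mem_closure hf hz.le, ?_⟩
  rw [hR.isOpen.interior_eq]
  intro hΩ
  have h1 : Tendsto (fun t : ℝ => F (f (t * z))) (𝓝[<] 1) (𝓝 (F (f z))) :=
    (hR.diffF.continuousOn.continuousAt (hR.isOpen.mem_nhds hΩ)).tendsto.comp
      ((hf.tendsto z).comp (tendsto_ofReal_mul_left z))
  have h2 : F (f z) = z := by
    refine tendsto_nhds_unique h1 ((tendsto_ofReal_mul_left z).congr' ?_)
    filter_upwards [Ioo_mem_nhdsLT one_pos] with t ht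
    rw [hR.right_inv _ (ofReal_mul_mem_ball hz.le ht)]
  have := hR.norm_lt_one hΩ
  rw [h2, hz] at this
  exact lt_irrefl _ this

lemma IsRiemannMap.image_closedBall (hR : IsRiemannMap Ω F f) (hf : Continuous f) :
    closure Ω ⊆ f '' closedBall 0 1 := by
  refine closure_minimal (fun ζ hζ => ⟨F ζ, ball_subset_closedBall (hR.mapsToF hζ),
    hR.left_inv ζ hζ⟩) ((isCompact_closedBall 0 1).image hf).isClosed

lemma IsRiemannMap.frontier_subset (hR : IsRiemannMap Ω F f) (hf : Continuous f) :
    frontier Ω ⊆ f '' sphere 0 1 := by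
  intro p hp
  obtain ⟨z, hz, rfl⟩ := hR.image_closedBall hf hp.1
  refine ⟨z, ?_, rfl⟩
  by_contra hne
  refine hR.notMem_of_frontier hp (hR.mapsTo ?_)
  rw [mem_ball]
  exact lt_of_le_of_ne hz hne

lemma norm_sub_le_of_segment {C : ℝ} (hΩ : IsOpen Ω) (hF : DifferentiableOn ℂ F Ω)
    (hC : ∀ ζ ∈ Ω, ‖deriv F ζ‖ ≤ C) {x y : ℂ} (hxy : segment ℝ x y ⊆ Ω) :
    ‖F x - F y‖ ≤ C * ‖x - y‖ :=
  (convex_segment x y).norm_image_sub_le_of_norm_deriv_le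
    (fun _ hz => hF.differentiableAt (hΩ.mem_nhds (hxy hz))) (fun z hz => hC z (hxy hz))
    (right_mem_segment ℝ x y) (left_mem_segment ℝ x y)

/-- Near a boundary point, the values of the Riemann map are close to those along the normal. -/
lemma IsFlat.norm_sub_normal_le (h : IsFlat α ρ K ν Ω) (hR : IsRiemannMap Ω F f) {C : ℝ}
    (hC0 : 0 ≤ C) (hC : ∀ ζ ∈ Ω, ‖deriv F ζ‖ ≤ C) {p : ℂ} (hp : p ∈ frontier Ω) {t : ℝ}
    (ht : 0 < t) (htρ : 8 * t < ρ) {ζ : ℂ} (hζ : ζ ∈ Ω) (hζp : ‖ζ - p‖ ≤ t / 8) :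
    ‖F ζ - F (p + ν p * t)‖ ≤ 2 * C * t := by
  obtain ⟨hd0, hball, q, hq, hqd⟩ := exists_nearest hR.isOpen hR.ne_univ hζ
  have hdp : infDist ζ Ωᶜ ≤ ‖ζ - p‖ := by
    rw [← dist_eq_norm]; exact infDist_le_dist_of_mem (hR.notMem_of_frontier hp)
  set d := infDist ζ Ωᶜ
  have hqp : ‖q - p‖ ≤ t / 4 := by
    have : q - p = (ζ - p) - (ζ - q) := by ring
    rw [this]
    refine (norm_sub_le _ _).trans ?_
    linarith
  have hνq := h.normal_ne_zero hq
  have hνp := h.normal_ne_zero hp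
  set v := (ζ - q) / ν q
  have hvn : ‖v‖ = d := by rw [h.norm_div_normal hq, hqd]
  have hvre : d / 2 ≤ v.re := h.half_le_re_of_nearest hq hball hqd hd0 (by linarith)
  have hζe : ζ = q + ν q * v := by simp only [v]; field_simp; ring
  -- The bound on `F'` only applies along paths in `Ω`. The path goes from `ζ` to `q + ν q * t`
  -- inside the cone at the nearest boundary point `q`, then to `p + ν p * t` inside the cone at
  -- `p`. The lengths are at most `9/8 t` and `53/100 t`, the latter being `t/4` from `q - p` and
  -- `28/100 t` from the rotation of the normal.
  have h1 : ‖F ζ - F (q + ν q * t)‖ ≤ C * ‖ζ - (q + ν q * t)‖ := by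
    refine norm_sub_le_of_segment hR.isOpen hR.diffF hC ?_
    rintro _ ⟨a, b, ha, hb, hab, rfl⟩
    have he : a • ζ + b • (q + ν q * t) = q + ν q * (a * v + (b * t : ℝ)) := by
      rw [hζe, Complex.real_smul, Complex.real_smul]
      have : (a : ℂ) + b = 1 := by exact_mod_cast hab
      push_cast
      linear_combination q * this
    rw [he]
    have hn : ‖(a * v + (b * t : ℝ) : ℂ)‖ ≤ a * d + b * t := by
      refine (norm_add_le _ _).trans ?_
      rw [norm_mul, Complex.norm_real, Complex.norm_real, Real.norm_of_nonneg ha,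
        Real.norm_of_nonneg (by positivity), hvn]
    have hre : (a * d + b * t) / 2 ≤ (a * v + (b * t : ℝ) : ℂ).re := by
      rw [Complex.add_re, Complex.re_ofReal_mul, Complex.ofReal_re]
      nlinarith [mul_nonneg hb ht.le]
    have hpos : 0 < a * d + b * t := by
      rcases ha.eq_or_lt with rfl | ha
      · have : b = 1 := by linarith
        rw [this]; linarith
      · have := mul_pos ha hd0
        have := mul_nonneg hb ht.le
        linarith
    have hle : a * d + b * t ≤ t := by nlinarith
    refine h.mem_of_cone hq (fun h0 => ?_) (by linarith) (by linarith)
    rw [h0, Complex.zero_re] at hre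
    linarith
  have h2 : ‖ζ - (q + ν q * t)‖ ≤ 9 / 8 * t := by
    have : ζ - (q + ν q * t) = (ζ - q) - ν q * t := by ring
    rw [this]
    refine (norm_sub_le _ _).trans ?_
    rw [hqd, norm_mul, h.norm_normal q hq, Complex.norm_real, Real.norm_of_nonneg ht.le]
    linarith
  set σ := ν q / ν p
  have hσ : ‖σ - 1‖ ≤ 28 / 100 := by
    have h3 := h.norm_normal_sub_le hR.isOpen hp hq (by linarith)
    have h4 : σ - 1 = (ν q - ν p) / ν p := by simp only [σ]; field_simp
    rw [h4, h.norm_div_normal hp]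
    have h5 : K * ‖q - p‖ ^ α ≤ K * ρ ^ α := by
      have := h.one_le
      have := h.alpha_pos
      gcongr
      linarith
    linarith [h.small]
  set w := (q - p) / ν p + σ * t
  have hw : ‖w - t‖ ≤ 53 / 100 * t := by
    have : w - t = (q - p) / ν p + (σ - 1) * t := by simp only [w]; ring
    rw [this]
    refine (norm_add_le _ _).trans ?_
    rw [h.norm_div_normal hp, norm_mul, Complex.norm_real, Real.norm_of_nonneg ht.le]
    nlinarith
  have hwe : q + ν q * t = p + ν p * w := by simp only [w, σ]; field_simp; ring
  have h3 : ‖F (q + ν q * t) - F (p + ν p * t)‖ ≤ C * ‖q + ν q * t - (p + ν p * t)‖ := by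
    refine norm_sub_le_of_segment hR.isOpen hR.diffF hC ?_
    rintro _ ⟨a, b, ha, hb, hab, rfl⟩
    have he : a • (q + ν q * t) + b • (p + ν p * t) = p + ν p * (t + a * (w - t)) := by
      rw [hwe, Complex.real_smul, Complex.real_smul]
      have : (a : ℂ) + b = 1 := by exact_mod_cast hab
      linear_combination (p + ν p * t) * this
    rw [he]
    have hn : ‖(a * (w - t) : ℂ)‖ ≤ 53 / 100 * t := by
      rw [norm_mul, Complex.norm_real, Real.norm_of_nonneg ha]
      nlinarith [norm_nonneg (w - t)]
    have hn2 : ‖(t + a * (w - t) : ℂ)‖ ≤ 2 * t := by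
      refine (norm_add_le _ _).trans ?_
      rw [Complex.norm_real, Real.norm_of_nonneg ht.le]
      linarith
    have hre : 47 / 100 * t ≤ (t + a * (w - t) : ℂ).re := by
      rw [Complex.add_re, Complex.ofReal_re]
      linarith [(abs_le.1 (Complex.abs_re_le_norm (a * (w - t) : ℂ))).1]
    refine h.mem_of_cone hp (fun h0 => ?_) (by linarith) (by linarith)
    rw [h0, Complex.zero_re] at hre
    linarith
  have h4 : ‖q + ν q * t - (p + ν p * t)‖ ≤ 53 / 100 * t := by
    have : q + ν q * t - (p + ν p * t) = ν p * (w - t) := by rw [hwe]; ring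
    rw [this, norm_mul, h.norm_normal p hp, one_mul]
    exact hw
  calc ‖F ζ - F (p + ν p * t)‖
      ≤ ‖F ζ - F (q + ν q * t)‖ + ‖F (q + ν q * t) - F (p + ν p * t)‖ := norm_sub_le_norm_sub_add_norm_sub _ _ _
    _ ≤ C * (9 / 8 * t) + C * (53 / 100 * t) := add_le_add
        (h1.trans (mul_le_mul_of_nonneg_left h2 hC0)) (h3.trans (mul_le_mul_of_nonneg_left h4 hC0))
    _ ≤ _ := by nlinarith [mul_nonneg hC0 ht.le]

/-- The extension of the conformal map to the closed disk is injective. -/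
lemma IsFlat.injOn_closedBall (h : IsFlat α ρ K ν Ω) (hR : IsRiemannMap Ω F f)
    (hf : Continuous f) : InjOn f (closedBall 0 1) := by
  obtain ⟨C, hC0, hC⟩ := h.exists_norm_deriv_le hR
  intro z hz w hw hzw
  have hz1 : ‖z‖ ≤ 1 := by simpa using hz
  have hw1 : ‖w‖ ≤ 1 := by simpa using hw
  by_cases hzΩ : f z ∈ Ω
  · have hz' : ‖z‖ < 1 := lt_of_le_of_ne hz1 fun he =>
      hR.notMem_of_frontier (hR.mem_frontier hf he) hzΩ
    have hw' : ‖w‖ < 1 := lt_of_le_of_ne hw1 fun he =>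
      hR.notMem_of_frontier (hR.mem_frontier hf he) (hzw ▸ hzΩ)
    rw [← hR.right_inv z (by simpa using hz'), hzw, hR.right_inv w (by simpa using hw')]
  · have hp : f z ∈ frontier Ω :=
      ⟨hR.mem_closure hf hz1, by rwa [hR.isOpen.interior_eq]⟩
    -- All preimages of the boundary point `f z` are within `2 C t` of one value of `F` on the
    -- normal; letting `t → 0` identifies them.
    have key : ∀ t : ℝ, 0 < t → 8 * t < ρ → ∀ x : ℂ, ‖x‖ ≤ 1 → f x = f z →
        ‖x - F (f z + ν (f z) * t)‖ ≤ 2 * C * t := by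
      intro t ht htρ x hx hxz
      have h1 : Tendsto (fun s : ℝ => f (s * x)) (𝓝[<] 1) (𝓝 (f z)) := by
        rw [← hxz]; exact (hf.tendsto x).comp (tendsto_ofReal_mul_left x)
      refine le_of_tendsto ((tendsto_ofReal_mul_left x).sub_const _).norm ?_
      filter_upwards [Ioo_mem_nhdsLT one_pos,
        Metric.tendsto_nhds.1 h1 (t / 8) (by positivity)] with s hs hs2
      have hsx := ofReal_mul_mem_ball hx hs
      rw [dist_eq_norm] at hs2
      have := h.norm_sub_normal_le hR hC0.le hC hp ht htρ (hR.mapsTo hsx) hs2.le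
      rwa [hR.right_inv _ hsx] at this
    refine sub_eq_zero.1 (norm_le_zero_iff.1 (le_of_forall_pos_le_add fun ε hε => ?_))
    set t := min (ρ / 16) (ε / (4 * C))
    have hρ := h.radius_pos
    have ht : 0 < t := by positivity
    have ht1 : t ≤ ρ / 16 := min_le_left _ _
    have ht2 : t * (4 * C) ≤ ε := by
      rw [← le_div_iff₀ (by positivity)]; exact min_le_right _ _
    have h1 := key t ht (by linarith) z hz1 rfl
    have h2 := key t ht (by linarith) w hw1 hzw.symm
    rw [norm_sub_rev] at h2
    have h3 := norm_sub_le_norm_sub_add_norm_sub z (F (f z + ν (f z) * t)) w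
    linarith

end

end GreenInverse

/-! ### Schwarz's formula and the second derivative -/

namespace GreenInverse

open Set Metric Filter Topology Bornology

lemma circleIntegrable_of_continuousOn_sphere {E : Type*} [NormedAddCommGroup E] {f : ℂ → E}
    (hf : ContinuousOn f (sphere 0 1)) : CircleIntegrable f 0 1 :=
  ContinuousOn.circleIntegrable zero_le_one hf

lemma continuousOn_herglotzRieszKernel {w : ℂ} (hw : w ∈ ball (0 : ℂ) 1) :
    ContinuousOn (herglotzRieszKernel 0 w) (sphere 0 1) := by
  simpa using continuousOn_herglotzRieszKernel_sphere hw

/-- Schwarz's formula. -/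
lemma exists_eq_circleAverage_herglotz {l : ℂ → ℂ} (hl : DiffContOnCl ℂ l (ball 0 1)) :
    ∃ c : ℝ, ∀ w ∈ ball (0 : ℂ) 1, l w =
      Real.circleAverage (fun ζ => herglotzRieszKernel 0 w ζ • ((l ζ).re : ℂ)) 0 1
        + c * Complex.I := by
  have hc : ContinuousOn l (sphere 0 1) :=
    hl.continuousOn_ball.mono sphere_subset_closedBall
  have hre : ContinuousOn (fun ζ => (l ζ).re) (sphere 0 1) :=
    Complex.continuous_re.comp_continuousOn hc
  have hre' : ContinuousOn (fun ζ => ((l ζ).re : ℂ)) (sphere 0 1) :=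
    Complex.continuous_ofReal.comp_continuousOn hre
  set S : ℂ → ℂ := fun w =>
    Real.circleAverage (fun ζ => herglotzRieszKernel 0 w ζ • ((l ζ).re : ℂ)) 0 1
  have hS : DifferentiableOn ℂ S (ball 0 1) :=
    differentiableOn_circleAverage_herglotzRieszKernel_smul
      (circleIntegrable_of_continuousOn_sphere hre')
  have hSre : ∀ w ∈ ball (0 : ℂ) 1, (S w).re = (l w).re := by
    intro w hw
    have h1 := re_circleAverage_herglotzRieszKernel_smul
      (circleIntegrable_of_continuousOn_sphere hre) hw
    have h2 := hl.circleAverage_re_herglotzRieszKernel_smul hw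
    have hk : ContinuousOn (Complex.re ∘ herglotzRieszKernel 0 w) (sphere 0 1) :=
      Complex.continuous_re.comp_continuousOn (continuousOn_herglotzRieszKernel hw)
    have h3 := Complex.reCLM.circleAverage_comp_comm (c := 0) (R := 1)
      (f := (Complex.re ∘ herglotzRieszKernel 0 w) • l)
      (circleIntegrable_of_continuousOn_sphere (hk.smul hc))
    rw [h2] at h3
    rw [h1, show (l w).re = Complex.reCLM (l w) from rfl, ← h3]
    congr 1
    ext ζ
    simp
  obtain ⟨c, hcc⟩ := ((hl.differentiableOn.sub hS).analyticOnNhd isOpen_ball).eq_const_of_re_eq_const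
    (c₀ := 0) (fun w hw => by simp [hSre w hw]) isOpen_ball
    ((convex_ball (0 : ℂ) 1).isConnected ⟨0, mem_ball_self one_pos⟩)
  have hcre : c.re = 0 := by
    rw [← hcc 0 (mem_ball_self one_pos)]
    simp [hSre 0 (mem_ball_self one_pos)]
  refine ⟨c.im, fun w hw => ?_⟩
  have h1 := hcc w hw
  rw [Pi.sub_apply, sub_eq_iff_eq_add'] at h1
  rw [h1]
  congr 1
  apply Complex.ext <;> simp [hcre]

/-- With `v = 1 - ζ / z₀` this bounds `|ζ - z₀|^α` by a multiple of a harmonic function whose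
Poisson integral is known exactly. -/
lemma cos_mul_rpow_le_re_cpow {α : ℝ} (hα : 0 < α) (hα1 : α < 1) {v : ℂ} (hv : 0 ≤ v.re) :
    Real.cos (α * (Real.pi / 2)) * ‖v‖ ^ α ≤ (v ^ (α : ℂ)).re := by
  have h1 := Complex.abs_arg_le_pi_div_two_iff.2 hv
  rw [Complex.cpow_ofReal_re, mul_comm]
  refine mul_le_mul_of_nonneg_left ?_ (by positivity)
  rw [← Real.cos_abs (v.arg * α), abs_mul, abs_of_pos hα, mul_comm]
  have hπ := Real.pi_pos
  refine Real.cos_le_cos_of_nonneg_of_le_pi (by positivity) (by nlinarith) (by gcongr)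

/-- If `Re l` vanishes to order `1 + α` at the boundary point `z₀`, then `l''` is controlled on the
radius that ends at `z₀`. -/
lemma norm_deriv_deriv_le {α : ℝ} (hα : 0 < α) (hα1 : α < 1) {l : ℂ → ℂ}
    (hl : DiffContOnCl ℂ l (ball 0 1)) {M : ℝ} {z₀ : ℂ} (hz₀ : ‖z₀‖ = 1)
    (h : ∀ ζ ∈ sphere (0 : ℂ) 1, |(l ζ).re| ≤ M * ‖ζ - z₀‖ ^ (1 + α)) {r : ℝ} (hr : 0 ≤ r)
    (hr1 : r < 1) :
    ‖deriv (deriv l) (r * z₀)‖ ≤ 16 * M / Real.cos (α * (Real.pi / 2)) * (1 - r) ^ (α - 1) := by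
  have hz0 : z₀ ≠ 0 := norm_ne_zero_iff.1 (by rw [hz₀]; exact one_ne_zero)
  have hπ := Real.pi_pos
  have hcos : 0 < Real.cos (α * (Real.pi / 2)) :=
    Real.cos_pos_of_mem_Ioo ⟨by nlinarith, by nlinarith⟩
  set κ := Real.cos (α * (Real.pi / 2))
  have hδ : 0 < 1 - r := by linarith
  set w₀ : ℂ := r * z₀
  have hw₀n : ‖w₀‖ = r := by simp [w₀, hz₀, abs_of_nonneg hr]
  have hw₀ : w₀ ∈ ball (0 : ℂ) 1 := by rw [mem_ball_zero_iff, hw₀n]; exact hr1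
  have hw₀z : ‖w₀ - z₀‖ = 1 - r := by
    rw [show w₀ - z₀ = ((r - 1 : ℝ) : ℂ) * z₀ by simp [w₀]; ring, norm_mul, hz₀, mul_one,
      Complex.norm_real, Real.norm_eq_abs, abs_sub_comm, abs_of_pos hδ]
  have hM : 0 ≤ M := by
    have h1 := h (-z₀) (by simp [hz₀])
    have h2 : 0 < ‖-z₀ - z₀‖ ^ (1 + α) := by
      refine Real.rpow_pos_of_pos (norm_pos_iff.2 ?_) _
      rw [show -z₀ - z₀ = -2 * z₀ by ring]; simp [hz0]
    exact nonneg_of_mul_nonneg_left ((abs_nonneg _).trans h1) h2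
  -- Harmonic majorant: `κ |ζ - z₀|^α ≤ Re k`, and the Poisson integral of `Re k` at `w₀ = r z₀` is
  -- `k w₀ = (1 - r)^α`. This replaces a direct estimate of the singular integral.
  set k : ℂ → ℂ := fun ζ => (1 - ζ / z₀) ^ (α : ℂ)
  have hkre : ∀ ζ ∈ closedBall (0 : ℂ) 1, 0 ≤ (1 - ζ / z₀).re := by
    intro ζ hζ
    have h1 := Complex.re_le_norm (ζ / z₀)
    rw [norm_div, hz₀, div_one] at h1
    simp only [mem_closedBall_zero_iff] at hζ
    simp only [Complex.sub_re, Complex.one_re]; linarith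
  have hknorm : ∀ ζ, ‖1 - ζ / z₀‖ = ‖ζ - z₀‖ := by
    intro ζ
    rw [show 1 - ζ / z₀ = -(ζ - z₀) / z₀ by field_simp; ring, norm_div, norm_neg, hz₀, div_one]
  have hkc : ContinuousOn k (closedBall 0 1) := by
    intro ζ hζ
    have h1 : ContinuousAt (fun ζ : ℂ => 1 - ζ / z₀) ζ := by fun_prop
    exact (ContinuousAt.comp (f := fun ζ : ℂ => 1 - ζ / z₀) (g := fun v : ℂ => v ^ (α : ℂ))
      (Complex.continuousAt_cpow_const_of_re_pos (Or.inl (hkre ζ hζ)) (by simpa))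
      h1).continuousWithinAt
  have hkd : DiffContOnCl ℂ k (ball 0 1) := by
    refine ⟨fun ζ hζ => DifferentiableAt.differentiableWithinAt ?_, by
      rwa [closure_ball _ one_ne_zero]⟩
    refine DifferentiableAt.cpow_const (by fun_prop) (Or.inl ?_)
    have h1 := Complex.re_le_norm (ζ / z₀)
    rw [norm_div, hz₀, div_one] at h1
    rw [mem_ball_zero_iff] at hζ
    simp only [Complex.sub_re, Complex.one_re]; linarith
  have hkw : k w₀ = (((1 - r) ^ α : ℝ) : ℂ) := by
    simp only [k, w₀, mul_div_assoc, div_self hz0, mul_one]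
    rw [Complex.ofReal_cpow hδ.le]; push_cast; rfl
  have hHre : ContinuousOn (Complex.re ∘ herglotzRieszKernel 0 w₀) (sphere 0 1) :=
    Complex.continuous_re.comp_continuousOn (continuousOn_herglotzRieszKernel hw₀)
  have hksph : ContinuousOn k (sphere 0 1) := hkc.mono sphere_subset_closedBall
  -- Poisson's formula for the real part of `k`
  have hP : Real.circleAverage (fun ζ => (herglotzRieszKernel 0 w₀ ζ).re * (k ζ).re) 0 1
      = (1 - r) ^ α := by
    have h2 := hkd.circleAverage_re_herglotzRieszKernel_smul hw₀
    have h3 := Complex.reCLM.circleAverage_comp_comm (c := 0) (R := 1)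
      (f := (Complex.re ∘ herglotzRieszKernel 0 w₀) • k)
      (circleIntegrable_of_continuousOn_sphere (hHre.smul hksph))
    rw [h2, hkw, Complex.reCLM_apply, Complex.ofReal_re] at h3
    rw [← h3]
    congr 1
    ext ζ
    simp
  have hHval : ∀ ζ ∈ sphere (0 : ℂ) 1,
      (herglotzRieszKernel 0 w₀ ζ).re = (1 - r ^ 2) / ‖ζ - w₀‖ ^ 2 := by
    intro ζ hζ
    have h1 := congr_fun (poissonKernel_eq_re_herglotzRieszKernel (c := 0) (w := w₀)) ζ
    rw [Function.comp_apply] at h1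
    rw [← h1, poissonKernel_def]
    simp only [sub_zero]
    rw [mem_sphere_zero_iff_norm.1 hζ, hw₀n, one_pow]
  have hlc : ContinuousOn l (closedBall 0 1) := hl.continuousOn_ball
  have hlre : ContinuousOn (fun ζ => ((l ζ).re : ℂ)) (sphere 0 1) :=
    Complex.continuous_ofReal.comp_continuousOn (Complex.continuous_re.comp_continuousOn
      (hlc.mono sphere_subset_closedBall))
  obtain ⟨c, hS⟩ := exists_eq_circleAverage_herglotz hl
  have hne : ∀ w ∈ ball (0 : ℂ) 1, ∀ ζ ∈ sphere (0 : ℂ) 1, ζ - w ≠ 0 := by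
    intro w hw ζ hζ h0
    rw [sub_eq_zero] at h0
    rw [mem_ball_zero_iff, ← h0, mem_sphere_zero_iff_norm.1 hζ] at hw
    exact lt_irrefl _ hw
  -- `b` is the `w`-derivative at `w₀` of Schwarz's formula. Subtracting the first-order term leaves
  -- a kernel with the factor `(w - w₀)²`.
  set b : ℂ := Real.circleAverage (fun ζ => 2 * ζ / (ζ - w₀) ^ 2 * ((l ζ).re : ℂ)) 0 1
  have hbc : ContinuousOn (fun ζ => 2 * ζ / (ζ - w₀) ^ 2 * ((l ζ).re : ℂ)) (sphere 0 1) := by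
    refine ContinuousOn.mul (ContinuousOn.div (by fun_prop) (by fun_prop) ?_) hlre
    exact fun ζ hζ => pow_ne_zero _ (hne w₀ hw₀ ζ hζ)
  have hin : closedBall w₀ ((1 - r) / 2) ⊆ ball (0 : ℂ) 1 := by
    intro w hw
    rw [mem_closedBall, dist_eq_norm] at hw
    have h1 := norm_add_le w₀ (w - w₀)
    rw [add_sub_cancel, hw₀n] at h1
    rw [mem_ball_zero_iff]; linarith
  have key : ∀ w ∈ closedBall w₀ ((1 - r) / 2),
      ‖l w - l w₀ - (w - w₀) * b‖ ≤ 2 * M / κ * (1 - r) * (1 - r) ^ α := by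
    intro w hw
    have hwb := hin hw
    rw [mem_closedBall, dist_eq_norm] at hw
    have hHc : ∀ w ∈ ball (0 : ℂ) 1, CircleIntegrable
        (fun ζ => herglotzRieszKernel 0 w ζ • ((l ζ).re : ℂ)) 0 1 :=
      fun w hw => circleIntegrable_of_continuousOn_sphere
        ((continuousOn_herglotzRieszKernel hw).smul hlre)
    have e1 : l w - l w₀ - (w - w₀) * b = Real.circleAverage (fun ζ =>
        2 * ζ * (w - w₀) ^ 2 / ((ζ - w) * (ζ - w₀) ^ 2) * ((l ζ).re : ℂ)) 0 1 := by
      have e2 : (w - w₀) * b = Real.circleAverage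
          (fun ζ => (w - w₀) • (2 * ζ / (ζ - w₀) ^ 2 * ((l ζ).re : ℂ))) 0 1 := by
        rw [Real.circleAverage_fun_smul, smul_eq_mul]
      have hA : CircleIntegrable (fun ζ => herglotzRieszKernel 0 w ζ • ((l ζ).re : ℂ) -
          herglotzRieszKernel 0 w₀ ζ • ((l ζ).re : ℂ)) 0 1 := (hHc w hwb).sub (hHc w₀ hw₀)
      have hB : CircleIntegrable
          (fun ζ => (w - w₀) • (2 * ζ / (ζ - w₀) ^ 2 * ((l ζ).re : ℂ))) 0 1 :=
        circleIntegrable_of_continuousOn_sphere (continuousOn_const.mul hbc)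
      rw [hS w hwb, hS w₀ hw₀, e2, add_sub_add_right_eq_sub, ← Real.circleAverage_fun_sub (hHc w hwb) (hHc w₀ hw₀),
        ← Real.circleAverage_fun_sub hA hB]
      refine Real.circleAverage_congr_sphere fun ζ hζ => ?_
      rw [abs_one] at hζ
      have n1 := hne w hwb ζ hζ
      have n2 := hne w₀ hw₀ ζ hζ
      simp only [herglotzRieszKernel_def, sub_zero, smul_eq_mul]
      field_simp
      ring
    rw [e1]
    -- One factor of `|ζ - z₀|^{1+α}` cancels `|ζ - w|`, since `|ζ - z₀| ≤ 4|ζ - w|`; the other, `|ζ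
    -- - z₀|^α`, is bounded by `Re k / κ`. What remains, `(1 - r)² / |ζ - w₀|²`, is at most `1 - r`
    -- times the Poisson kernel.
    have hb1 : ∀ ζ ∈ sphere (0 : ℂ) 1,
        ‖2 * ζ * (w - w₀) ^ 2 / ((ζ - w) * (ζ - w₀) ^ 2) * ((l ζ).re : ℂ)‖ ≤
          2 * M / κ * (1 - r) * ((herglotzRieszKernel 0 w₀ ζ).re * (k ζ).re) := by
      intro ζ hζ
      have hζn := mem_sphere_zero_iff_norm.1 hζ
      have n1 := norm_pos_iff.2 (hne w hwb ζ hζ)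
      have n2 := norm_pos_iff.2 (hne w₀ hw₀ ζ hζ)
      have d1 : 1 - r ≤ ‖ζ - w₀‖ := by
        have := norm_sub_norm_le ζ w₀
        rwa [hζn, hw₀n] at this
      have d2 : ‖ζ - w₀‖ / 2 ≤ ‖ζ - w‖ := by
        have := norm_sub_le_norm_sub_add_norm_sub ζ w w₀
        linarith
      have d3 : ‖ζ - z₀‖ ≤ 4 * ‖ζ - w‖ := by
        have := norm_sub_le_norm_sub_add_norm_sub ζ w₀ z₀
        linarith
      have d4 := cos_mul_rpow_le_re_cpow hα hα1 (hkre ζ (sphere_subset_closedBall hζ))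
      rw [hknorm] at d4
      have d5 : ‖ζ - z₀‖ ^ α ≤ (k ζ).re / κ := by rw [le_div_iff₀ hcos, mul_comm]; exact d4
      have hp : ‖ζ - z₀‖ ^ (1 + α) ≤ 4 * ‖ζ - w‖ * ((k ζ).re / κ) := by
        rcases (norm_nonneg (ζ - z₀)).eq_or_lt with h0 | h0
        · rw [← h0, Real.zero_rpow (by linarith)]
          have : 0 ≤ (k ζ).re / κ := (by positivity : (0:ℝ) ≤ ‖ζ - z₀‖ ^ α).trans d5
          positivity
        · rw [Real.rpow_add h0, Real.rpow_one]; gcongr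
      rw [norm_mul, norm_div, norm_mul, norm_mul, norm_mul, norm_pow, norm_pow, hζn,
        Complex.norm_real, Complex.norm_two, mul_one, Real.norm_eq_abs, hHval ζ hζ]
      have hK : 0 ≤ (k ζ).re / κ := (by positivity : (0:ℝ) ≤ ‖ζ - z₀‖ ^ α).trans d5
      calc 2 * ‖w - w₀‖ ^ 2 / (‖ζ - w‖ * ‖ζ - w₀‖ ^ 2) * |(l ζ).re|
          ≤ 2 * ((1 - r) / 2) ^ 2 / (‖ζ - w‖ * ‖ζ - w₀‖ ^ 2) *
            (M * (4 * ‖ζ - w‖ * ((k ζ).re / κ))) := by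
            have := h ζ hζ
            have h5 : |(l ζ).re| ≤ M * (4 * ‖ζ - w‖ * ((k ζ).re / κ)) :=
              this.trans (mul_le_mul_of_nonneg_left hp hM)
            gcongr
        _ = 2 * M * ((1 - r) * (1 - r)) / ‖ζ - w₀‖ ^ 2 * ((k ζ).re / κ) := by
            field_simp; ring
        _ ≤ 2 * M * ((1 - r) * (1 - r ^ 2)) / ‖ζ - w₀‖ ^ 2 * ((k ζ).re / κ) := by
            have : (1 - r) * (1 - r) ≤ (1 - r) * (1 - r ^ 2) :=
              mul_le_mul_of_nonneg_left (by nlinarith) hδ.le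
            gcongr
        _ = _ := by ring
    have hcc : ContinuousOn (fun ζ => 2 * ζ * (w - w₀) ^ 2 / ((ζ - w) * (ζ - w₀) ^ 2) *
        ((l ζ).re : ℂ)) (sphere 0 1) := by
      refine ContinuousOn.mul (ContinuousOn.div (by fun_prop) (by fun_prop) ?_) hlre
      exact fun ζ hζ => mul_ne_zero (hne w hwb ζ hζ) (pow_ne_zero _ (hne w₀ hw₀ ζ hζ))
    have hrc : ContinuousOn (fun ζ => 2 * M / κ * (1 - r) *
        ((herglotzRieszKernel 0 w₀ ζ).re * (k ζ).re)) (sphere 0 1) :=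
      continuousOn_const.mul (hHre.mul (Complex.continuous_re.comp_continuousOn hksph))
    calc _ ≤ Real.circleAverage (fun ζ => ‖2 * ζ * (w - w₀) ^ 2 / ((ζ - w) * (ζ - w₀) ^ 2) *
          ((l ζ).re : ℂ)‖) 0 1 := by
          rw [Real.circleAverage_def, Real.circleAverage_def, norm_smul, smul_eq_mul,
            Real.norm_of_nonneg (by positivity)]
          gcongr
          exact intervalIntegral.norm_integral_le_integral_norm (by positivity)
      _ ≤ Real.circleAverage (fun ζ => 2 * M / κ * (1 - r) *
        ((herglotzRieszKernel 0 w₀ ζ).re * (k ζ).re)) 0 1 := by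
          refine Real.circleAverage_mono (circleIntegrable_of_continuousOn_sphere hcc.norm)
            (circleIntegrable_of_continuousOn_sphere hrc) fun ζ hζ => ?_
          rw [abs_one] at hζ
          exact hb1 ζ hζ
      _ = _ := by
          have := Real.circleAverage_fun_smul (c := 0) (R := 1) (a := 2 * M / κ * (1 - r))
            (f := fun ζ => (herglotzRieszKernel 0 w₀ ζ).re * (k ζ).re)
          simp only [smul_eq_mul] at this
          rw [this, hP]
  have hd2 : DiffContOnCl ℂ (fun w => l w - l w₀ - (w - w₀) * b) (ball w₀ ((1 - r) / 2)) := by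
    have hs : closure (ball w₀ ((1 - r) / 2)) ⊆ ball 0 1 := closure_ball_subset_closedBall.trans hin
    refine ((hl.differentiableOn.mono hs).sub_const _ |>.sub ?_).diffContOnCl
    fun_prop
  -- Cauchy's estimate on the circle of radius `(1 - r)/2`; the affine correction does not affect
  -- the second derivative. The factor `2! · 2 · 4` is the constant `16`.
  have h2 := Complex.norm_iteratedDeriv_le_of_forall_mem_sphere_norm_le 2 (by positivity) hd2
    fun z hz => key z (sphere_subset_closedBall hz)
  have e : iteratedDeriv 2 (fun w => l w - l w₀ - (w - w₀) * b) w₀ = deriv (deriv l) w₀ := by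
    rw [iteratedDeriv_succ, iteratedDeriv_one]
    have : deriv (fun w => l w - l w₀ - (w - w₀) * b) =ᶠ[𝓝 w₀] fun w => deriv l w - b := by
      filter_upwards [isOpen_ball.mem_nhds hw₀] with w hw
      have h3 := (hl.differentiableOn.differentiableAt (isOpen_ball.mem_nhds hw)).hasDerivAt
      have h4 := (h3.sub_const (l w₀)).fun_sub (((hasDerivAt_id w).sub_const w₀).mul_const b)
      simpa using h4.deriv
    rw [this.deriv_eq, deriv_sub_const]
  rw [e] at h2
  refine h2.trans (le_of_eq ?_)
  rw [Real.rpow_sub_one hδ.ne']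
  simp only [Nat.factorial]
  push_cast
  field_simp
  ring

end GreenInverse

/-! ### Hölder extension of the derivative -/

namespace GreenInverse

open Set Metric Filter Topology Bornology

/-- Hardy and Littlewood: a function whose derivative is `O((1 - |z|)^{α-1})` is Hölder continuous
on the disk. -/
lemma exists_holder_of_norm_deriv_le {α : ℝ} (hα : 0 < α) (hα1 : α < 1) {Ψ : ℂ → ℂ}
    (hΨ : DifferentiableOn ℂ Ψ (ball 0 1)) {C : ℝ} (hC : 0 ≤ C)
    (h : ∀ z ∈ ball (0 : ℂ) 1, ‖deriv Ψ z‖ ≤ C * (1 - ‖z‖) ^ (α - 1)) :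
    ∃ C' : ℝ, 0 ≤ C' ∧ ∀ z ∈ ball (0 : ℂ) 1, ∀ w ∈ ball (0 : ℂ) 1,
      ‖Ψ z - Ψ w‖ ≤ C' * ‖z - w‖ ^ α := by
  have hda : ∀ z ∈ ball (0 : ℂ) 1, HasDerivAt Ψ (deriv Ψ z) z := fun z hz =>
    (hΨ.differentiableAt (isOpen_ball.mem_nhds hz)).hasDerivAt
  -- Radial integration of the derivative bound, by comparison with the primitive `(C/α)(s^α - (1 -
  -- t)^α)`, which is continuous at `t = 1` although its derivative blows up there.
  have hrad : ∀ s : ℝ, 0 < s → s ≤ 1 → ∀ z ∈ ball (0 : ℂ) 1,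
      ‖Ψ z - Ψ (((1 - s : ℝ) : ℂ) * z)‖ ≤ C / α * s ^ α := by
    intro s hs hs1 z hz
    rw [mem_ball_zero_iff] at hz
    have hin : ∀ t ∈ Icc (1 - s) 1, (t : ℂ) * z ∈ ball (0 : ℂ) 1 := by
      intro t ht
      rw [mem_ball_zero_iff, norm_mul, Complex.norm_real, Real.norm_of_nonneg (by linarith [ht.1])]
      exact lt_of_le_of_lt (mul_le_of_le_one_left (norm_nonneg _) ht.2) hz
    have hd1 : ∀ t ∈ Icc (1 - s) 1, HasDerivAt (fun t : ℝ => Ψ (t * z) - Ψ (((1 - s : ℝ) : ℂ) * z))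
        (deriv Ψ (t * z) * z) t := by
      intro t ht
      have h1 : HasDerivAt (fun t : ℝ => (t : ℂ) * z) z t := by
        simpa using (Complex.ofRealCLM.hasDerivAt (x := t)).mul_const z
      exact ((hda _ (hin t ht)).comp t h1).sub_const _
    have hB : ∀ t ∈ Ico (1 - s) 1, HasDerivAt (fun t : ℝ => C / α * (s ^ α - (1 - t) ^ α))
        (C * (1 - t) ^ (α - 1)) t := by
      intro t ht
      have h1 := (((hasDerivAt_id t).const_sub 1).rpow_const (p := α)
        (Or.inl (by simp only [id]; linarith [ht.2]))).const_sub (s ^ α) |>.const_mul (C / α)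
      have h2 : C / α * -(-1 * α * (1 - t) ^ (α - 1)) = C * (1 - t) ^ (α - 1) := by field_simp
      rw [← h2]
      exact h1
    have := image_norm_le_of_norm_deriv_right_le_deriv_boundary'
      (f := fun t : ℝ => Ψ (t * z) - Ψ (((1 - s : ℝ) : ℂ) * z))
      (f' := fun t => deriv Ψ (t * z) * z) (a := 1 - s) (b := 1)
      (B := fun t : ℝ => C / α * (s ^ α - (1 - t) ^ α)) (B' := fun t => C * (1 - t) ^ (α - 1))
      (fun t ht => (hd1 t ht).continuousAt.continuousWithinAt)
      (fun t ht => (hd1 t ⟨ht.1, ht.2.le⟩).hasDerivWithinAt)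
      (by simp)
      (by
        refine continuousOn_const.mul (continuousOn_const.sub ?_)
        exact ContinuousOn.rpow_const (by fun_prop) fun _ _ => Or.inr hα.le)
      (fun t ht => (hB t ht).hasDerivWithinAt)
      (fun t ht => by
        have h1 := h _ (hin t ⟨ht.1, ht.2.le⟩)
        have ht0 : 0 ≤ t := by linarith [ht.1]
        rw [norm_mul, Complex.norm_real, Real.norm_of_nonneg ht0] at h1
        rw [norm_mul]
        have h2 : (1 - t * ‖z‖) ^ (α - 1) ≤ (1 - t) ^ (α - 1) :=
          Real.rpow_le_rpow_of_nonpos (by linarith [ht.2])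
            (by nlinarith [mul_le_of_le_one_right ht0 hz.le]) (by linarith)
        calc ‖deriv Ψ (t * z)‖ * ‖z‖ ≤ C * (1 - t * ‖z‖) ^ (α - 1) * 1 :=
              mul_le_mul h1 hz.le (norm_nonneg _) ((norm_nonneg _).trans h1)
          _ ≤ _ := by rw [mul_one]; exact mul_le_mul_of_nonneg_left h2 hC)
      (right_mem_Icc.2 (by linarith))
    simpa [Real.zero_rpow hα.ne'] using this
  refine ⟨2 * (C / α) + 2 * C, by positivity, fun z hz w hw => ?_⟩
  rcases eq_or_ne z w with rfl | hne
  · simp only [sub_self, norm_zero]; positivity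
  -- Both points are contracted by `1 - s`; between the contracted points the derivative is at most
  -- `C s^{α-1}`. Halving the distance ensures `s < 1`.
  set s := ‖z - w‖ / 2
  have hs : 0 < s := by have := norm_pos_iff.2 (sub_ne_zero.2 hne); positivity
  have hzn := mem_ball_zero_iff.1 hz
  have hwn := mem_ball_zero_iff.1 hw
  have hs1 : s < 1 := by
    have := norm_sub_le z w
    simp only [s]; linarith
  have hcb : ∀ x ∈ ball (0 : ℂ) 1, ((1 - s : ℝ) : ℂ) * x ∈ closedBall (0 : ℂ) (1 - s) := by
    intro x hx
    rw [mem_ball_zero_iff] at hx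
    rw [mem_closedBall_zero_iff, norm_mul, Complex.norm_real, Real.norm_of_nonneg (by linarith)]
    exact mul_le_of_le_one_right (by linarith) hx.le
  have hsub : closedBall (0 : ℂ) (1 - s) ⊆ ball 0 1 := closedBall_subset_ball (by linarith)
  have h3 := (convex_closedBall (0 : ℂ) (1 - s)).norm_image_sub_le_of_norm_hasDerivWithin_le
    (C := C * s ^ (α - 1)) (fun x hx => (hda x (hsub hx)).hasDerivWithinAt) (fun x hx => by
      refine (h x (hsub hx)).trans (mul_le_mul_of_nonneg_left ?_ hC)
      rw [mem_closedBall_zero_iff] at hx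
      exact Real.rpow_le_rpow_of_nonpos hs (by linarith) (by linarith)) (hcb w hw) (hcb z hz)
  have h4 : ‖((1 - s : ℝ) : ℂ) * z - ((1 - s : ℝ) : ℂ) * w‖ ≤ 2 * s := by
    rw [← mul_sub, norm_mul, Complex.norm_real, Real.norm_of_nonneg (by linarith)]
    have : ‖z - w‖ = 2 * s := by simp only [s]; ring
    rw [this]; nlinarith
  have h5 : C * s ^ (α - 1) * ‖((1 - s : ℝ) : ℂ) * z - ((1 - s : ℝ) : ℂ) * w‖ ≤ 2 * C * s ^ α := by
    calc _ ≤ C * s ^ (α - 1) * (2 * s) := mul_le_mul_of_nonneg_left h4 (by positivity)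
      _ = _ := by rw [Real.rpow_sub_one hs.ne']; field_simp
  have h1 := hrad s hs hs1.le z hz
  have h2 := hrad s hs hs1.le w hw
  rw [norm_sub_rev] at h2
  have h6 : ‖Ψ z - Ψ w‖ ≤ (2 * (C / α) + 2 * C) * s ^ α := by
    calc ‖Ψ z - Ψ w‖ = ‖(Ψ z - Ψ (((1 - s : ℝ) : ℂ) * z)) + (Ψ (((1 - s : ℝ) : ℂ) * z) -
          Ψ (((1 - s : ℝ) : ℂ) * w)) + (Ψ (((1 - s : ℝ) : ℂ) * w) - Ψ w)‖ := by congr 1; ring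
      _ ≤ C / α * s ^ α + 2 * C * s ^ α + C / α * s ^ α := by
        refine (norm_add₃_le).trans ?_
        gcongr
        exact h3.trans h5
      _ = _ := by ring
  refine h6.trans ?_
  have : s ≤ ‖z - w‖ := by simp only [s]; linarith [norm_nonneg (z - w)]
  gcongr

lemma continuousOn_of_holder {α : ℝ} (hα : 0 < α) {g : ℂ → ℂ} {s : Set ℂ} {C : ℝ}
    (h : ∀ z ∈ s, ∀ w ∈ s, ‖g z - g w‖ ≤ C * ‖z - w‖ ^ α) : ContinuousOn g s := by
  intro z hz
  rw [ContinuousWithinAt, tendsto_iff_norm_sub_tendsto_zero]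
  refine squeeze_zero' (Eventually.of_forall fun _ => norm_nonneg _)
    (g := fun w => C * ‖w - z‖ ^ α) ?_ ?_
  · filter_upwards [self_mem_nhdsWithin] with w hw using h w hw z hz
  · have : ContinuousAt (fun w => C * ‖w - z‖ ^ α) z :=
      (((continuous_id.sub continuous_const).norm).continuousAt.rpow_const
        (Or.inr hα.le)).const_mul C
    have h2 := this.tendsto
    simp only [sub_self, norm_zero, Real.zero_rpow hα.ne', mul_zero] at h2
    exact h2.mono_left nhdsWithin_le_nhds

/-- A Hölder function on the disk extends to the closed disk. -/
lemma exists_holder_extension {α : ℝ} (hα : 0 < α) {Ψ : ℂ → ℂ} {C : ℝ}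
    (h : ∀ z ∈ ball (0 : ℂ) 1, ∀ w ∈ ball (0 : ℂ) 1, ‖Ψ z - Ψ w‖ ≤ C * ‖z - w‖ ^ α) :
    ∃ g : ℂ → ℂ, EqOn g Ψ (ball 0 1) ∧ (∀ z ∈ closedBall (0 : ℂ) 1,
      Tendsto (fun t : ℝ => Ψ (t * z)) (𝓝[<] 1) (𝓝 (g z))) ∧
      ∀ z ∈ closedBall (0 : ℂ) 1, ∀ w ∈ closedBall (0 : ℂ) 1, ‖g z - g w‖ ≤ C * ‖z - w‖ ^ α := by
  have hcont := continuousOn_of_holder hα h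
  have hIoo : Ioo (0 : ℝ) 1 ∈ 𝓝[<] (1 : ℝ) := Ioo_mem_nhdsLT one_pos
  have hlim : ∀ z ∈ closedBall (0 : ℂ) 1,
      ∃ y, Tendsto (fun t : ℝ => Ψ (t * z)) (𝓝[<] 1) (𝓝 y) := by
    intro z hz
    rw [mem_closedBall_zero_iff] at hz
    refine cauchy_map_iff_exists_tendsto.1 ?_
    rw [cauchy_map_iff]
    refine ⟨inferInstance, ?_⟩
    rw [tendsto_uniformity_iff_dist_tendsto_zero]
    refine squeeze_zero' (Eventually.of_forall fun _ => dist_nonneg)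
      (g := fun p : ℝ × ℝ => C * ‖(p.1 : ℂ) * z - p.2 * z‖ ^ α) ?_ ?_
    · filter_upwards [prod_mem_prod hIoo hIoo] with p hp
      rw [dist_eq_norm]
      exact h _ (ofReal_mul_mem_ball hz hp.1) _ (ofReal_mul_mem_ball hz hp.2)
    · have : ContinuousAt (fun p : ℝ × ℝ => C * ‖(p.1 : ℂ) * z - p.2 * z‖ ^ α) (1, 1) := by
        refine ContinuousAt.const_mul (ContinuousAt.rpow_const ?_ (Or.inr hα.le)) C
        fun_prop
      have h2 := this.tendsto
      simp only [sub_self, norm_zero, Real.zero_rpow hα.ne', mul_zero] at h2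
      rw [nhds_prod_eq] at h2
      exact h2.mono_left (prod_mono nhdsWithin_le_nhds nhdsWithin_le_nhds)
  choose! g hg using hlim
  refine ⟨g, fun z hz => ?_, hg, fun z hz w hw => ?_⟩
  · refine tendsto_nhds_unique (hg z (ball_subset_closedBall hz)) ((hcont z hz).tendsto.comp ?_)
    refine tendsto_nhdsWithin_iff.2 ⟨tendsto_ofReal_mul_left z, ?_⟩
    filter_upwards [hIoo] with t ht using ofReal_mul_mem_ball (mem_ball_zero_iff.1 hz).le ht
  · have h1 := ((hg z hz).sub (hg w hw)).norm
    have h2 : Tendsto (fun t : ℝ => C * ‖(t : ℂ) * z - t * w‖ ^ α) (𝓝[<] 1)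
        (𝓝 (C * ‖z - w‖ ^ α)) :=
      ((((tendsto_ofReal_mul_left z).sub (tendsto_ofReal_mul_left w)).norm).rpow_const
        (Or.inr hα.le)).const_mul C
    refine le_of_tendsto_of_tendsto h1 h2 ?_
    filter_upwards [hIoo] with t ht
    exact h _ (ofReal_mul_mem_ball (mem_closedBall_zero_iff.1 hz) ht) _
      (ofReal_mul_mem_ball (mem_closedBall_zero_iff.1 hw) ht)

lemma uniqueDiffWithinAt_closedBall {z : ℂ} (hz : z ∈ closedBall (0 : ℂ) 1) :
    UniqueDiffWithinAt ℂ (closedBall (0 : ℂ) 1) z := by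
  refine uniqueDiffWithinAt_convex_of_isRCLikeNormedField (convex_closedBall _ _) ?_
    (subset_closure hz)
  rw [interior_closedBall _ one_ne_zero]
  exact ⟨0, mem_ball_self one_pos⟩

/-- If `f'` extends to a Hölder function on the closed disk then the extension is the derivative of
`f` on the closed disk. -/
lemma hasDerivWithinAt_closedBall {α : ℝ} (hα : 0 < α) {f g : ℂ → ℂ}
    (hf : ContinuousOn f (closedBall 0 1)) (hd : DifferentiableOn ℂ f (ball 0 1))
    (hg : EqOn g (deriv f) (ball 0 1)) {C : ℝ} (hC : 0 ≤ C)
    (h : ∀ z ∈ closedBall (0 : ℂ) 1, ∀ w ∈ closedBall (0 : ℂ) 1, ‖g z - g w‖ ≤ C * ‖z - w‖ ^ α)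
    {z : ℂ} (hz : z ∈ closedBall (0 : ℂ) 1) : HasDerivWithinAt f (g z) (closedBall 0 1) z := by
  have h1 : ∀ z ∈ ball (0 : ℂ) 1, ∀ w ∈ ball (0 : ℂ) 1,
      ‖f w - f z - g z * (w - z)‖ ≤ C * ‖w - z‖ ^ α * ‖w - z‖ := by
    intro z hz w hw
    have hs : segment ℝ z w ⊆ ball (0 : ℂ) 1 := (convex_ball _ _).segment_subset hz hw
    have h2 := (convex_segment z w).norm_image_sub_le_of_norm_hasDerivWithin_le
      (f := fun x => f x - g z * x) (f' := fun x => deriv f x - g z) (C := C * ‖w - z‖ ^ α)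
      (fun x hx => by
        have h3 := (hd.differentiableAt (isOpen_ball.mem_nhds (hs hx))).hasDerivAt.fun_sub
          ((hasDerivAt_id x).const_mul (g z))
        rw [mul_one] at h3
        exact h3.hasDerivWithinAt)
      (fun x hx => by
        rw [← hg (hs hx)]
        refine (h x (ball_subset_closedBall (hs hx)) z (ball_subset_closedBall hz)).trans ?_
        have : ‖x - z‖ ≤ ‖w - z‖ := by
          have := (convex_closedBall z ‖w - z‖).segment_subset
            (mem_closedBall_self (norm_nonneg _)) (mem_closedBall_iff_norm.2 le_rfl) hx
          exact mem_closedBall_iff_norm.1 this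
        gcongr)
      (left_mem_segment ℝ z w) (right_mem_segment ℝ z w)
    rwa [show f w - g z * w - (f z - g z * z) = f w - f z - g z * (w - z) by ring] at h2
  have hgc := continuousOn_of_holder hα h
  -- The first-order remainder bound passes to the closed disk by applying it at `t z`, `t w` and
  -- letting `t → 1`.
  have h2 : ∀ z ∈ closedBall (0 : ℂ) 1, ∀ w ∈ closedBall (0 : ℂ) 1,
      ‖f w - f z - g z * (w - z)‖ ≤ C * ‖w - z‖ ^ α * ‖w - z‖ := by
    intro z hz w hw
    have hIoo : Ioo (0 : ℝ) 1 ∈ 𝓝[<] (1 : ℝ) := Ioo_mem_nhdsLT one_pos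
    have ht : ∀ x ∈ closedBall (0 : ℂ) 1, Tendsto (fun t : ℝ => (t : ℂ) * x) (𝓝[<] 1)
        (𝓝[closedBall 0 1] x) := fun x hx => tendsto_nhdsWithin_iff.2
      ⟨tendsto_ofReal_mul_left x, by
        filter_upwards [hIoo] with t ht using
          ball_subset_closedBall (ofReal_mul_mem_ball (mem_closedBall_zero_iff.1 hx) ht)⟩
    have l1 := (tendsto_ofReal_mul_left w).sub (tendsto_ofReal_mul_left z)
    have l2 := ((((hf w hw).tendsto.comp (ht w hw)).sub ((hf z hz).tendsto.comp (ht z hz))).sub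
      (((hgc z hz).tendsto.comp (ht z hz)).mul l1)).norm
    have l3 := ((l1.norm.rpow_const (p := α) (Or.inr hα.le)).const_mul C).mul l1.norm
    refine le_of_tendsto_of_tendsto l2 l3 ?_
    filter_upwards [hIoo] with t ht
    exact h1 _ (ofReal_mul_mem_ball (mem_closedBall_zero_iff.1 hz) ht) _
      (ofReal_mul_mem_ball (mem_closedBall_zero_iff.1 hw) ht)
  rw [hasDerivWithinAt_iff_isLittleO, Asymptotics.isLittleO_iff]
  intro c hc
  have h3 : ContinuousAt (fun w => C * ‖w - z‖ ^ α) z :=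
    (((continuous_id.sub continuous_const).norm).continuousAt.rpow_const
      (Or.inr hα.le)).const_mul C
  have h4 := h3.eventually_lt_const (u := c)
    (by beta_reduce; rw [sub_self, norm_zero, Real.zero_rpow hα.ne', mul_zero]; exact hc)
  filter_upwards [self_mem_nhdsWithin, h4.filter_mono nhdsWithin_le_nhds] with w hw hw2
  rw [smul_eq_mul, mul_comm (w - z)]
  exact (h2 z hz w hw).trans (mul_le_mul_of_nonneg_right hw2.le (norm_nonneg _))

end GreenInverse

/-! ### Kellogg's theorem and the normalized conformal map -/

namespace GreenInverse

open Set Metric Filter Topology Bornology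

variable {α ρ K : ℝ} {ν : ℂ → ℂ} {Ω : Set ℂ} {F f : ℂ → ℂ}

/-- The growth of the second derivative of the conformal map. -/
lemma IsFlat.exists_norm_deriv_deriv_le (h : IsFlat α ρ K ν Ω) (hR : IsRiemannMap Ω F f)
    {L : NNReal} (hL : LipschitzWith L f) :
    ∃ C : ℝ, 0 ≤ C ∧ ∀ z ∈ ball (0 : ℂ) 1, ‖deriv (deriv f) z‖ ≤ C * (1 - ‖z‖) ^ (α - 1) := by
  have hα := h.alpha_pos
  have hα1 := h.alpha_lt
  have hρ := h.radius_pos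
  have hK : 0 ≤ K := zero_le_one.trans h.one_le
  have hπ := Real.pi_pos
  have hcos : 0 < Real.cos (α * (Real.pi / 2)) :=
    Real.cos_pos_of_mem_Ioo ⟨by nlinarith, by nlinarith⟩
  -- `K` handles chords shorter than `ρ`; for longer ones `‖q - p‖ ≤ ρ^{-α} ‖q - p‖^{1+α}`
  -- trivially. The Lipschitz constant transfers the bound to the unit circle.
  set M : ℝ := (K + (ρ ^ α)⁻¹) * (L : ℝ) ^ (1 + α)
  have key : ∀ z₀ : ℂ, ‖z₀‖ = 1 → ∀ r : ℝ, 0 ≤ r → r < 1 → ‖deriv (deriv f) (r * z₀)‖ ≤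
      16 * M / Real.cos (α * (Real.pi / 2)) * (1 - r) ^ (α - 1) := by
    intro z₀ hz₀ r hr hr1
    have hp := hR.mem_frontier hL.continuous hz₀
    have hν := h.norm_normal _ hp
    set p := f z₀
    have hld : DiffContOnCl ℂ (fun z => (f z - p) / ν p) (ball 0 1) :=
      ⟨(hR.diff.sub_const p).div_const _,
        ((hL.continuous.sub continuous_const).div_const _).continuousOn⟩
    have hb : ∀ ζ ∈ sphere (0 : ℂ) 1, |((f ζ - p) / ν p).re| ≤ M * ‖ζ - z₀‖ ^ (1 + α) := by
      intro ζ hζ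
      have hq := hR.mem_frontier hL.continuous (mem_sphere_zero_iff_norm.1 hζ)
      have hlip : ‖f ζ - p‖ ≤ L * ‖ζ - z₀‖ := by
        simpa [dist_eq_norm] using hL.dist_le_mul ζ z₀
      have hpow : ‖f ζ - p‖ ^ (1 + α) ≤ (L : ℝ) ^ (1 + α) * ‖ζ - z₀‖ ^ (1 + α) := by
        rw [← Real.mul_rpow (NNReal.coe_nonneg L) (norm_nonneg _)]
        exact Real.rpow_le_rpow (norm_nonneg _) hlip (by linarith)
      have hmain : |((f ζ - p) / ν p).re| ≤ (K + (ρ ^ α)⁻¹) * ‖f ζ - p‖ ^ (1 + α) := by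
        rcases lt_or_ge ‖f ζ - p‖ ρ with hlt | hge
        · refine (h.abs_re_chord_le hR.isOpen hp hq hlt).trans ?_
          gcongr
          linarith [(by positivity : 0 ≤ (ρ ^ α)⁻¹)]
        · have h0 : 0 < ‖f ζ - p‖ := hρ.trans_le hge
          have h1 := Complex.abs_re_le_norm ((f ζ - p) / ν p)
          rw [norm_div, hν, div_one] at h1
          have h2 : ρ ^ α ≤ ‖f ζ - p‖ ^ α := by gcongr
          have h3 : 1 ≤ (ρ ^ α)⁻¹ * ‖f ζ - p‖ ^ α := by
            rw [inv_mul_eq_div, one_le_div (by positivity)]; exact h2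
          rw [Real.rpow_add h0, Real.rpow_one]
          calc _ ≤ ‖f ζ - p‖ * 1 := by rw [mul_one]; exact h1
            _ ≤ ‖f ζ - p‖ * ((ρ ^ α)⁻¹ * ‖f ζ - p‖ ^ α) := by gcongr
            _ ≤ ‖f ζ - p‖ * ((K + (ρ ^ α)⁻¹) * ‖f ζ - p‖ ^ α) := by
              gcongr
              linarith
            _ = _ := by ring
      refine hmain.trans ?_
      simp only [M]
      rw [mul_assoc]
      gcongr
    have h1 := norm_deriv_deriv_le hα hα1 hld hz₀ hb hr hr1
    have h2 : deriv (fun z => (f z - p) / ν p) = fun z => deriv f z / ν p := by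
      ext z; rw [deriv_div_const, deriv_sub_const]
    rwa [h2, deriv_div_const, norm_div, hν, div_one] at h1
  refine ⟨16 * M / Real.cos (α * (Real.pi / 2)), by positivity, fun z hz => ?_⟩
  rw [mem_ball_zero_iff] at hz
  rcases eq_or_ne z 0 with rfl | hz0
  · simpa using key 1 (by simp) 0 le_rfl one_pos
  · have hzn := norm_pos_iff.2 hz0
    have h1 := key (z / ‖z‖) (by rw [norm_div, Complex.norm_real, norm_norm, div_self hzn.ne'])
      ‖z‖ hzn.le hz
    rwa [mul_div_cancel₀ _ (by exact_mod_cast hzn.ne')] at h1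

/-- Kellogg's theorem. -/
lemma IsFlat.exists_deriv_extension (h : IsFlat α ρ K ν Ω) (hR : IsRiemannMap Ω F f)
    {L : NNReal} (hL : LipschitzWith L f) :
    ∃ (g : ℂ → ℂ) (C : ℝ), (∀ z ∈ closedBall (0 : ℂ) 1, g z ≠ 0) ∧
      (∀ z ∈ closedBall (0 : ℂ) 1, HasDerivWithinAt f (g z) (closedBall 0 1) z) ∧
      ∀ z ∈ closedBall (0 : ℂ) 1, ∀ w ∈ closedBall (0 : ℂ) 1, ‖g z - g w‖ ≤ C * ‖z - w‖ ^ α := by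
  obtain ⟨C, hC, hC2⟩ := h.exists_norm_deriv_deriv_le hR hL
  obtain ⟨C', hC', hH⟩ := exists_holder_of_norm_deriv_le h.alpha_pos h.alpha_lt
    (hR.diff.deriv isOpen_ball) hC hC2
  obtain ⟨g, hg, hlim, hgH⟩ := exists_holder_extension h.alpha_pos hH
  obtain ⟨B, hB, hBd⟩ := h.exists_norm_deriv_le hR
  refine ⟨g, C', fun z hz h0 => ?_, fun z hz =>
    hasDerivWithinAt_closedBall h.alpha_pos hL.continuous.continuousOn hR.diff hg hC' hgH hz, hgH⟩
  -- From `F' · f' = 1` and `‖F'‖ ≤ B`; the lower bound survives the radial limit, so the extension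
  -- has no zeros.
  have h1 : ∀ w ∈ ball (0 : ℂ) 1, B⁻¹ ≤ ‖deriv f w‖ := by
    intro w hw
    have hfw := hR.mapsTo hw
    have h2 := (hR.diff.differentiableAt (isOpen_ball.mem_nhds hw)).hasDerivAt
    have h3 := (hR.diffF.differentiableAt (hR.isOpen.mem_nhds hfw)).hasDerivAt
    have h4 := h3.comp w h2
    have h5 : HasDerivAt (F ∘ f) 1 w := by
      refine (hasDerivAt_id w).congr_of_eventuallyEq ?_
      filter_upwards [isOpen_ball.mem_nhds hw] with x hx using hR.right_inv x hx
    have h6 := congrArg norm (h4.unique h5)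
    rw [norm_mul, norm_one] at h6
    have h7 : 1 ≤ B * ‖deriv f w‖ := by
      rw [← h6]; exact mul_le_mul_of_nonneg_right (hBd _ hfw) (norm_nonneg _)
    rwa [inv_le_iff_one_le_mul₀' hB]
  have h2 := (hlim z hz).norm
  rw [h0, norm_zero] at h2
  have h3 := ge_of_tendsto h2 (b := B⁻¹) (by
    filter_upwards [Ioo_mem_nhdsLT one_pos] with t ht
    exact h1 _ (ofReal_mul_mem_ball (mem_closedBall_zero_iff.1 hz) ht))
  exact absurd h3 (not_le.2 (by positivity))

/-- The normalized conformal map of the disk onto a domain of the class `𝒪`. -/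
lemma MemO.exists_conformal {ζc ζb : ℂ} (hα : 0 < α) (hα1 : α < 1) (hΩ : MemO α ζc ζb Ω) :
    ∃ F f : ℂ → ℂ, IsRiemannMap Ω F f ∧ Continuous f ∧ MemF α ζc ζb f ∧
      (∀ z ∈ closedBall (0 : ℂ) 1, diskDeriv f z ≠ 0) := by
  obtain ⟨ρ, K, ν, h⟩ := exists_isFlat hα hα1 hΩ.isOpen hΩ.isBounded hΩ.c1Holder
  obtain ⟨F, hF, hbij, hF0⟩ := exists_riemann_map hΩ.isOpen hΩ.simplyConnected (by
    rintro rfl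
    simpa using hΩ.base_mem) hΩ.center_mem
  have hleft : LeftInvOn (Function.invFunOn F Ω) F Ω := hbij.injOn.leftInvOn_invFunOn
  have hright : ∀ z ∈ ball (0 : ℂ) 1, Function.invFunOn F Ω z ∈ Ω ∧
      F (Function.invFunOn F Ω z) = z := fun z hz =>
    ⟨Function.invFunOn_mem (hbij.surjOn hz), Function.invFunOn_eq (hbij.surjOn hz)⟩
  have hR₀ : IsRiemannMap Ω F (Function.invFunOn F Ω) := by
    refine ⟨hΩ.isOpen, hΩ.isBounded, hF, fun z hz => ?_, hbij.mapsTo, fun z hz => (hright z hz).1,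
      fun ζ hζ => hleft hζ, fun z hz => (hright z hz).2⟩
    have := (hasDerivAt_of_leftInvOn hΩ.isOpen hF hleft (hright z hz).1).2
    rw [(hright z hz).2] at this
    exact this.differentiableAt.differentiableWithinAt
  obtain ⟨f₁, hR₁, L, hL₁⟩ := h.exists_lipschitz hR₀
  -- Rotating the disk by the boundary preimage `z₁` of `ζb` moves it to `1` and keeps the centre
  -- fixed.
  obtain ⟨z₁, hz₁, hf₁⟩ := hR₁.frontier_subset hL₁.continuous hΩ.base_mem
  rw [mem_sphere_zero_iff_norm] at hz₁
  have hz₁0 : z₁ ≠ 0 := norm_ne_zero_iff.1 (by rw [hz₁]; exact one_ne_zero)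
  have hrot : MapsTo (fun z => z₁ * z) (ball (0 : ℂ) 1) (ball 0 1) := fun z hz => by
    rw [mem_ball_zero_iff, norm_mul, hz₁, one_mul]; exact mem_ball_zero_iff.1 hz
  have hR : IsRiemannMap Ω (fun ζ => F ζ / z₁) (fun z => f₁ (z₁ * z)) := by
    refine ⟨hΩ.isOpen, hΩ.isBounded, hF.div_const _, hR₁.diff.comp (by fun_prop) hrot,
      fun ζ hζ => ?_, fun z hz => hR₁.mapsTo (hrot hz), fun ζ hζ => ?_, fun z hz => ?_⟩
    · rw [mem_ball_zero_iff, norm_div, hz₁, div_one]; exact mem_ball_zero_iff.1 (hR₁.mapsToF hζ)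
    · rw [mul_div_cancel₀ _ hz₁0]; exact hR₁.left_inv ζ hζ
    · rw [hR₁.right_inv _ (hrot hz), mul_div_cancel_left₀ _ hz₁0]
  have hL : LipschitzWith L (fun z => f₁ (z₁ * z)) := by
    refine LipschitzWith.of_dist_le_mul fun z w => (hL₁.dist_le_mul _ _).trans (le_of_eq ?_)
    rw [dist_eq_norm, dist_eq_norm, ← mul_sub, norm_mul, hz₁, one_mul]
  obtain ⟨g, C, hg0, hgd, hgH⟩ := h.exists_deriv_extension hR hL
  have hdd : ∀ z ∈ closedBall (0 : ℂ) 1, diskDeriv (fun z => f₁ (z₁ * z)) z = g z := fun z hz =>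
    (hgd z hz).derivWithin (uniqueDiffWithinAt_closedBall hz)
  refine ⟨_, _, hR, hL.continuous, ⟨fun z hz => (hgd z hz).differentiableWithinAt,
    ⟨C, fun z hz w hw => ?_⟩, h.injOn_closedBall hR hL.continuous, ?_, ?_⟩, fun z hz => ?_⟩
  · rw [hdd z hz, hdd w hw]; exact hgH z hz w hw
  · have := hR.left_inv ζc hΩ.center_mem
    simpa [hF0] using this
  · simpa using hf₁
  · rw [hdd z hz]; exact hg0 z hz

end GreenInverse

/-! ### The Green's function in the disk -/

namespace GreenInverse

open Set Metric Filter Topology Bornology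

variable {Ω : Set ℂ} {F f : ℂ → ℂ}

/-- Locally `h` is the real part of an analytic function, and composition with `f` keeps it
analytic. -/
lemma harmonicAt_comp {h : ℂ → ℝ} {z : ℂ} (hΩ : IsOpen Ω)
    (hh : InnerProductSpace.HarmonicOnNhd h Ω) (hf : AnalyticAt ℂ f z) (hz : f z ∈ Ω) :
    InnerProductSpace.HarmonicAt (fun z => h (f z)) z := by
  obtain ⟨R, hR, hball⟩ := Metric.isOpen_iff.1 hΩ _ hz
  obtain ⟨k, hk, hkh⟩ := (hh.mono hball).exists_analyticOnNhd_ball_re_eq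
  have h1 : AnalyticAt ℂ (fun z => k (f z)) z := (hk _ (mem_ball_self hR)).comp hf
  refine (InnerProductSpace.harmonicAt_congr_nhds ?_).1 h1.harmonicAt_re
  filter_upwards [hf.continuousAt (ball_mem_nhds _ hR)] with w hw
  exact hkh hw

lemma dslope_ne_zero_of_injOn {U : Set ℂ} (hU : IsOpen U) (hf : DifferentiableOn ℂ f U)
    (hi : InjOn f U) {a z : ℂ} (ha : a ∈ U) (hz : z ∈ U) : dslope f a z ≠ 0 := by
  rcases eq_or_ne z a with rfl | hza
  · rw [dslope_same]
    exact deriv_ne_zero_of_injOn hU hf hi hz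
  · rw [dslope_of_ne _ hza, slope_def_field]
    exact div_ne_zero (sub_ne_zero.2 fun h => hza (hi hz ha h)) (sub_ne_zero.2 hza)

/-- The Green's function in terms of the conformal map. -/
lemma IsRiemannMap.green_eq (hR : IsRiemannMap Ω F f) (hf : Continuous f) {ζc : ℂ}
    (h0 : f 0 = ζc) {U : ℂ → ℝ} (hU : IsGreenFunction Ω ζc U) {z : ℂ}
    (hz : z ∈ closedBall (0 : ℂ) 1) (hz0 : z ≠ 0) :
    U (f z) = -(1 / (2 * Real.pi)) * Real.log ‖z‖ := by
  obtain ⟨h, hh, hUh⟩ := hU.harmonic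
  have hinj : InjOn f (ball 0 1) := fun x hx y hy hxy => by
    rw [← hR.right_inv x hx, ← hR.right_inv y hy, hxy]
  have h00 : (0 : ℂ) ∈ ball (0 : ℂ) 1 := mem_ball_self one_pos
  have hfan : AnalyticOnNhd ℂ f (ball 0 1) := hR.diff.analyticOnNhd isOpen_ball
  have hdan : AnalyticOnNhd ℂ (dslope f 0) (ball 0 1) :=
    ((Complex.differentiableOn_dslope (isOpen_ball.mem_nhds h00)).2 hR.diff).analyticOnNhd
      isOpen_ball
  -- Away from `0`, `u = U ∘ f + (1/2π) log|z|`: the logarithmic poles cancel into `log |dslope f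
  -- 0|`. This is harmonic also at `0`, since injectivity keeps the divided difference nonzero.
  -- Extended by `0` to the circle as `v`, it vanishes by Poisson's formula.
  set u : ℂ → ℝ := fun z => h (f z) - 1 / (2 * Real.pi) * Real.log ‖dslope f 0 z‖
  set v : ℂ → ℝ := fun z => if ‖z‖ < 1 then u z else 0
  have hvu : EqOn v u (ball 0 1) := fun x hx => if_pos (mem_ball_zero_iff.1 hx)
  have hv : ∀ x ∈ closedBall (0 : ℂ) 1, x ≠ 0 →
      v x = U (f x) + 1 / (2 * Real.pi) * Real.log ‖x‖ := by
    intro x hx hx0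
    rw [mem_closedBall_zero_iff] at hx
    rcases hx.lt_or_eq with hlt | heq
    · have hxb : x ∈ ball (0 : ℂ) 1 := mem_ball_zero_iff.2 hlt
      have hne : f x ≠ ζc := fun hh => hx0 (hinj hxb h00 (hh.trans h0.symm))
      rw [hvu hxb, hUh _ (hR.mapsTo hxb) hne]
      simp only [u]
      rw [dslope_of_ne _ hx0, slope_def_field, h0, sub_zero, norm_div,
        Real.log_div (norm_ne_zero_iff.2 (sub_ne_zero.2 hne)) (norm_ne_zero_iff.2 hx0)]
      ring
    · have : v x = 0 := if_neg (by rw [heq]; exact lt_irrefl _)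
      rw [this, hU.boundary _ (hR.mem_frontier hf heq), heq, Real.log_one]
      simp
  have hvh : InnerProductSpace.HarmonicOnNhd v (ball 0 1) := by
    intro x hx
    refine (InnerProductSpace.harmonicAt_congr_nhds (f₂ := u) ?_).2 ?_
    · filter_upwards [isOpen_ball.mem_nhds hx] with y hy using hvu hy
    · exact (harmonicAt_comp hR.isOpen hh (hfan x hx) (hR.mapsTo hx)).sub
        (((hdan x hx).harmonicAt_log_norm
          (dslope_ne_zero_of_injOn isOpen_ball hR.diff hinj h00 hx)).const_smul)
  have hne : ∀ x ∈ closedBall (0 : ℂ) 1, x ≠ 0 → f x ≠ ζc := by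
    intro x hx hx0 hh
    rw [mem_closedBall_zero_iff] at hx
    rcases hx.lt_or_eq with hlt | heq
    · exact hx0 (hinj (mem_ball_zero_iff.2 hlt) h00 (hh.trans h0.symm))
    · exact hR.notMem_of_frontier (hR.mem_frontier hf heq) (by
        rw [hh, ← h0]; exact hR.mapsTo h00)
  have hvc : InnerProductSpace.HarmonicContOnCl v (ball 0 1) := by
    refine ⟨hvh, fun x hx => ?_⟩
    rw [closure_ball _ one_ne_zero] at hx ⊢
    rcases eq_or_ne x 0 with rfl | hx0
    · exact (hvh.continuousOn.continuousAt (isOpen_ball.mem_nhds h00)).continuousWithinAt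
    · have h1 : ContinuousWithinAt (fun x => U (f x)) (closedBall 0 1 \ {0}) x :=
        (hU.continuousOn (f x) ⟨hR.mem_closure hf (mem_closedBall_zero_iff.1 hx),
          hne x hx hx0⟩).comp hf.continuousWithinAt fun y hy =>
          ⟨hR.mem_closure hf (mem_closedBall_zero_iff.1 hy.1), hne y hy.1 hy.2⟩
      have h2 : ContinuousWithinAt (fun x : ℂ => 1 / (2 * Real.pi) * Real.log ‖x‖)
          (closedBall 0 1 \ {0}) x :=
        ((continuousAt_id.norm.log (norm_ne_zero_iff.2 hx0)).const_mul _).continuousWithinAt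
      have h3 : ContinuousWithinAt v (closedBall 0 1 \ {0}) x :=
        (h1.add h2).congr (fun y hy => hv y hy.1 hy.2) (hv x hx hx0)
      exact h3.mono_of_mem_nhdsWithin 
        (inter_mem self_mem_nhdsWithin (mem_nhdsWithin_of_mem_nhds (isOpen_ne.mem_nhds hx0)))
  have hv0 : ∀ x ∈ ball (0 : ℂ) 1, v x = 0 := by
    intro x hx
    rw [← hvc.circleAverage_poissonKernel_smul hx]
    rw [Real.circleAverage_congr_sphere (f₂ := fun _ => 0), Real.circleAverage_const]
    intro y hy
    rw [abs_one, mem_sphere_zero_iff_norm] at hy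
    have : v y = 0 := if_neg (by rw [hy]; exact lt_irrefl _)
    simp [this]
  have hvz : v z = 0 := by
    rcases (mem_closedBall_zero_iff.1 hz).lt_or_eq with hlt | heq
    · exact hv0 z (mem_ball_zero_iff.2 hlt)
    · exact if_neg (by rw [heq]; exact lt_irrefl _)
  rw [hv z hz hz0] at hvz
  linarith

end GreenInverse

/-! ### Normal derivative and boundary angle -/

namespace GreenInverse

open Set Metric Filter Topology Bornology

variable {α : ℝ} {ζc ζb : ℂ} {Ω : Set ℂ} {F f : ℂ → ℂ}

lemma MemF.hasDerivWithinAt (hf : MemF α ζc ζb f) {z : ℂ} (hz : z ∈ closedBall (0 : ℂ) 1) :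
    HasDerivWithinAt f (diskDeriv f z) (closedBall 0 1) z :=
  (hf.differentiableOn z hz).hasDerivWithinAt

lemma MemF.continuousOn_diskDeriv (hα : 0 < α) (hf : MemF α ζc ζb f) :
    ContinuousOn (diskDeriv f) (closedBall 0 1) :=
  continuousOn_of_holder hα hf.holder.choose_spec

lemma diskDeriv_eq_deriv {z : ℂ} (hz : z ∈ ball (0 : ℂ) 1) : diskDeriv f z = deriv f z :=
  derivWithin_of_mem_nhds (mem_of_superset (isOpen_ball.mem_nhds hz) ball_subset_closedBall)

/-- Lifting a differentiable curve through `f`. -/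
lemma MemF.hasDerivWithinAt_lift (hf : MemF α ζc ζb f) (hfc : Continuous f) {γ e : ℝ → ℂ}
    {T : Set ℝ} {s : ℝ} (hs : s ∈ T) (he : ∀ t ∈ T, e t ∈ closedBall (0 : ℂ) 1 ∧ f (e t) = γ t)
    {γ' : ℂ} (hγ : HasDerivWithinAt γ γ' T s) (hγ' : γ' ≠ 0) (hne : diskDeriv f (e s) ≠ 0) :
    HasDerivWithinAt e (γ' / diskDeriv f (e s)) T s := by
  -- No inverse function theorem at the boundary: by compactness `e t` has cluster points, each is
  -- mapped by `f` to `γ s`, and injectivity leaves only `e s`.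
  have hcont : ContinuousWithinAt e T s := by
    refine (isCompact_closedBall (0 : ℂ) 1).tendsto_nhds_of_unique_mapClusterPt
      (eventually_mem_nhdsWithin.mono fun t ht => (he t ht).1) fun y hy hcl => ?_
    have h1 : MapClusterPt (f y) (𝓝[T] s) (fun t => f (e t)) :=
      hcl.continuousAt_comp hfc.continuousAt
    have h2 : Tendsto (fun t => f (e t)) (𝓝[T] s) (𝓝 (γ s)) :=
      hγ.continuousWithinAt.tendsto.congr' (eventually_mem_nhdsWithin.mono fun t ht =>
        (he t ht).2.symm)
    refine hf.injOn hy (he s hs).1 ?_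
    rw [(he s hs).2]
    exact eq_of_nhds_neBot (ClusterPt.mono h1 h2)
  have hγs := hasDerivWithinAt_iff_tendsto_slope.1 hγ
  have hne1 : ∀ᶠ t in 𝓝[T \ {s}] s, slope γ s t ≠ 0 := hγs.eventually_ne hγ'
  have hmem : ∀ᶠ t in 𝓝[T \ {s}] s, t ∈ T \ {s} := self_mem_nhdsWithin
  have hnee : ∀ᶠ t in 𝓝[T \ {s}] s, e t ≠ e s := by
    filter_upwards [hne1, hmem] with t h1 h2 h3
    apply h1
    rw [slope_def_module, ← (he t h2.1).2, ← (he s hs).2, h3, sub_self, smul_zero]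
  have hfs := hasDerivWithinAt_iff_tendsto_slope.1 (hf.hasDerivWithinAt (he s hs).1)
  have hcomp : Tendsto (fun t => slope f (e s) (e t)) (𝓝[T \ {s}] s)
      (𝓝 (diskDeriv f (e s))) := by
    refine hfs.comp (tendsto_nhdsWithin_iff.2 ⟨hcont.tendsto.mono_left
      (nhdsWithin_mono _ sdiff_subset), ?_⟩)
    filter_upwards [hmem, hnee] with t h1 h2 using ⟨(he t h1.1).1, h2⟩
  rw [hasDerivWithinAt_iff_tendsto_slope]
  refine (hγs.div hcomp hne).congr' ?_
  filter_upwards [hmem, hnee] with t h1 h2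
  have h3 : e t - e s ≠ 0 := sub_ne_zero.2 h2
  have h4 : f (e t) - f (e s) ≠ 0 :=
    sub_ne_zero.2 fun h => h2 (hf.injOn (he t h1.1).1 (he s hs).1 h)
  rw [Pi.div_apply, slope_def_module, slope_def_field, slope_def_module, ← (he t h1.1).2,
    ← (he s hs).2, Complex.real_smul, Complex.real_smul]
  field_simp

/-- The preimage of the boundary curve on the unit circle. -/
lemma IsRiemannMap.exists_lift_boundary (hR : IsRiemannMap Ω F f) (hfc : Continuous f)
    (hf : MemF α ζc ζb f) (hne : ∀ z ∈ closedBall (0 : ℂ) 1, diskDeriv f z ≠ 0) {L : ℝ}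
    {c : ℝ → ℂ} (hc : IsArclengthParam Ω ζb L c) :
    ∃ E : ℝ → ℂ, ∀ s, ‖E s‖ = 1 ∧ f (E s) = c s ∧
      HasDerivAt E (deriv c s / diskDeriv f (E s)) s := by
  have h1 : ∀ s, ∃ z ∈ sphere (0 : ℂ) 1, f z = c s := fun s =>
    hR.frontier_subset hfc (hc.range_eq ▸ mem_range_self s)
  choose E hE hfE using h1
  have hE1 : ∀ s, E s ∈ closedBall (0 : ℂ) 1 := fun s => sphere_subset_closedBall (hE s)
  refine ⟨E, fun s => ⟨mem_sphere_zero_iff_norm.1 (hE s), hfE s, ?_⟩⟩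
  have hd : HasDerivAt c (deriv c s) s := (hc.contDiff.differentiable one_ne_zero s).hasDerivAt
  rw [← hasDerivWithinAt_univ] at hd ⊢
  exact hf.hasDerivWithinAt_lift hfc (mem_univ s) (fun t _ => ⟨hE1 t, hfE t⟩) hd
    (norm_ne_zero_iff.1 (by rw [hc.unit_speed]; exact one_ne_zero)) (hne _ (hE1 s))

/-- The preimage in the disk of the interior normal. -/
lemma IsRiemannMap.exists_lift_normal (hR : IsRiemannMap Ω F f) (hfc : Continuous f)
    (hf : MemF α ζc ζb f) (hne : ∀ z ∈ closedBall (0 : ℂ) 1, diskDeriv f z ≠ 0) {L : ℝ}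
    {c : ℝ → ℂ} (hc : IsArclengthParam Ω ζb L c) {s : ℝ} {z : ℂ} (hz : ‖z‖ = 1)
    (hzs : f z = c s) :
    ∃ ε > 0, ∃ e : ℝ → ℂ, e 0 = z ∧ (∀ t ∈ Ioo 0 ε, e t ∈ ball (0 : ℂ) 1) ∧
      (∀ t ∈ Ico 0 ε, f (e t) = c s + t * (Complex.I * deriv c s)) ∧
      HasDerivWithinAt e (Complex.I * deriv c s / diskDeriv f z) (Ico 0 ε) 0 := by
  obtain ⟨ε, hε, hin⟩ := mem_nhdsGT_iff_exists_Ioo_subset.1 (hc.counterclockwise s)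
  rw [mem_Ioi] at hε
  set γ : ℝ → ℂ := fun t => c s + t * (Complex.I * deriv c s)
  -- The value at `t = 0` is prescribed, because `γ 0 = c s` is a boundary point, where `F` carries
  -- no information.
  set e : ℝ → ℂ := fun t => if t = 0 then z else F (γ t)
  have he0 : e 0 = z := if_pos rfl
  have he1 : ∀ t ∈ Ioo 0 ε, e t = F (γ t) := fun t ht => if_neg ht.1.ne'
  have hball : ∀ t ∈ Ioo 0 ε, e t ∈ ball (0 : ℂ) 1 := fun t ht => by
    rw [he1 t ht]; exact hR.mapsToF (hin ht)
  have hzc : z ∈ closedBall (0 : ℂ) 1 := by rw [mem_closedBall_zero_iff, hz]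
  have hfe : ∀ t ∈ Ico 0 ε, e t ∈ closedBall (0 : ℂ) 1 ∧ f (e t) = γ t := by
    intro t ht
    rcases ht.1.eq_or_lt with rfl | h0
    · rw [he0]; exact ⟨hzc, by simp [γ, hzs]⟩
    · refine ⟨ball_subset_closedBall (hball t ⟨h0, ht.2⟩), ?_⟩
      rw [he1 t ⟨h0, ht.2⟩]; exact hR.left_inv _ (hin ⟨h0, ht.2⟩)
  refine ⟨ε, hε, e, he0, hball, fun t ht => (hfe t ht).2, ?_⟩
  have hγ : HasDerivAt γ (Complex.I * deriv c s) 0 := by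
    have := ((Complex.ofRealCLM.hasDerivAt (x := (0 : ℝ))).mul_const
      (Complex.I * deriv c s)).const_add (c s)
    rw [Complex.ofRealCLM_apply, Complex.ofReal_one, one_mul] at this
    exact this
  have hcs : ‖deriv c s‖ = 1 := hc.unit_speed s
  have := hf.hasDerivWithinAt_lift hfc (left_mem_Ico.2 hε) hfe hγ.hasDerivWithinAt
    (norm_ne_zero_iff.1 (by rw [norm_mul, hcs]; simp)) (by rw [he0]; exact hne _ hzc)
  rwa [he0] at this

lemma nonpos_of_hasDerivWithinAt_Ico {u : ℝ → ℝ} {u' ε : ℝ} (hε : 0 < ε)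
    (hu : HasDerivWithinAt u u' (Ico 0 ε) 0) (h : ∀ t ∈ Ioo 0 ε, u t ≤ u 0) : u' ≤ 0 := by
  have h1 := hasDerivWithinAt_iff_tendsto_slope.1 hu
  rw [Ico_sdiff_left] at h1
  have : (𝓝[Ioo 0 ε] (0 : ℝ)).NeBot := left_nhdsWithin_Ioo_neBot hε
  refine le_of_tendsto h1 ?_
  filter_upwards [self_mem_nhdsWithin] with t ht
  rw [slope_def_field]
  exact div_nonpos_of_nonpos_of_nonneg (by linarith [h t ht]) (by linarith [ht.1])

/-- The lift `e` of the inner normal enters the disk, so `Re (e / z)` does not exceed its initial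
value `1` and `Re (e' / z) ≤ 0`, where `e' / z = -(c' / (i z f'))`. This is where the orientation of
the boundary enters. -/
lemma IsRiemannMap.re_nonneg_of_counterclockwise (hR : IsRiemannMap Ω F f) (hfc : Continuous f)
    (hf : MemF α ζc ζb f) (hne : ∀ z ∈ closedBall (0 : ℂ) 1, diskDeriv f z ≠ 0) {L : ℝ}
    {c : ℝ → ℂ} (hc : IsArclengthParam Ω ζb L c) {s : ℝ} {z : ℂ} (hz : ‖z‖ = 1)
    (hzs : f z = c s) : 0 ≤ (deriv c s / (Complex.I * z * diskDeriv f z)).re := by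
  obtain ⟨ε, hε, e, he0, hball, -, hd⟩ := hR.exists_lift_normal hfc hf hne hc hz hzs
  have hz0 : z ≠ 0 := norm_ne_zero_iff.1 (by rw [hz]; exact one_ne_zero)
  have hd2 := (Complex.reCLM.hasFDerivAt.comp_hasDerivWithinAt 0 (hd.div_const z))
  have h1 := nonpos_of_hasDerivWithinAt_Ico hε hd2 fun t ht => by
    simp only [Function.comp_apply, Complex.reCLM_apply]
    rw [he0, div_self hz0, Complex.one_re]
    refine (Complex.re_le_norm _).trans ?_
    rw [norm_div, hz, div_one]
    exact (mem_ball_zero_iff.1 (hball t ht)).le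
  have h2 : Complex.I * deriv c s / diskDeriv f z / z =
      -(deriv c s / (Complex.I * z * diskDeriv f z)) := by
    have hz' := hne z (by rw [mem_closedBall_zero_iff, hz])
    field_simp
    simp
  rw [h2, Complex.reCLM_apply, Complex.neg_re] at h1
  linarith

/-- The derivative of the Green's function along the interior normal. -/
lemma IsRiemannMap.green_normal_deriv (hR : IsRiemannMap Ω F f) (hfc : Continuous f)
    (hf : MemF α ζc ζb f) (hne : ∀ z ∈ closedBall (0 : ℂ) 1, diskDeriv f z ≠ 0) {L : ℝ}
    {c : ℝ → ℂ} (hc : IsArclengthParam Ω ζb L c) {s : ℝ} {z : ℂ} (hz : ‖z‖ = 1)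
    (hzs : f z = c s) {U : ℂ → ℝ} (hU : IsGreenFunction Ω ζc U) {v : ℝ}
    (hv : HasDerivWithinAt (fun t : ℝ => U (c s + t * (Complex.I * deriv c s))) v (Ici 0) 0) :
    v = 1 / (2 * Real.pi) * (deriv c s / (Complex.I * z * diskDeriv f z)).re := by
  obtain ⟨ε, hε, e, he0, hball, hfe, hd⟩ := hR.exists_lift_normal hfc hf hne hc hz hzs
  have hz0 : z ≠ 0 := norm_ne_zero_iff.1 (by rw [hz]; exact one_ne_zero)
  have hz' := hne z (by rw [mem_closedBall_zero_iff, hz])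
  -- Along the normal `U = -(1/2π) Re log (e t / z)`. Dividing by `z` starts the curve at `1`, on
  -- the principal branch, without changing the modulus.
  have hlog : HasDerivWithinAt (fun t => Complex.log (e t / z))
      (-(deriv c s / (Complex.I * z * diskDeriv f z))) (Ico 0 ε) 0 := by
    have h1 := (hd.div_const z).clog_real (by
      rw [he0, div_self hz0]; exact Complex.one_mem_slitPlane)
    rw [he0, div_self hz0, div_one] at h1
    convert h1 using 1
    field_simp
    simp
  have h2 := ((Complex.reCLM.hasFDerivAt.comp_hasDerivWithinAt 0 hlog).const_mul
    (-(1 / (2 * Real.pi))))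
  have hev : ∀ᶠ t in 𝓝[Ico 0 ε] (0 : ℝ), e t ≠ 0 :=
    hd.continuousWithinAt.tendsto.eventually_ne (by rwa [he0])
  have h3 : HasDerivWithinAt (fun t : ℝ => U (c s + t * (Complex.I * deriv c s)))
      (-(1 / (2 * Real.pi)) * Complex.reCLM (-(deriv c s / (Complex.I * z * diskDeriv f z))))
      (Ico 0 ε) 0 := by
    have key : ∀ t ∈ Ico 0 ε, e t ≠ 0 → U (c s + t * (Complex.I * deriv c s)) =
        -(1 / (2 * Real.pi)) * (Complex.reCLM ∘ fun t => Complex.log (e t / z)) t := by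
      intro t ht h0
      have hmem : e t ∈ closedBall (0 : ℂ) 1 := by
        rcases ht.1.eq_or_lt with rfl | h
        · rw [he0, mem_closedBall_zero_iff, hz]
        · exact ball_subset_closedBall (hball t ⟨h, ht.2⟩)
      rw [← hfe t ht, hR.green_eq hfc hf.map_zero hU hmem h0]
      simp only [Function.comp_apply, Complex.reCLM_apply, Complex.log_re]
      rw [norm_div, hz, div_one]
    refine h2.congr_of_eventuallyEq ?_ (key 0 (left_mem_Ico.2 hε) (by rwa [he0]))
    filter_upwards [self_mem_nhdsWithin, hev] with t ht h0 using key t ht h0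
  have huniq : UniqueDiffWithinAt ℝ (Ico 0 ε) 0 :=
    uniqueDiffOn_Ico 0 ε 0 (left_mem_Ico.2 hε)
  have h4 := huniq.eq_deriv _ (hv.mono Ico_subset_Ici_self) h3
  rw [h4, Complex.reCLM_apply, Complex.neg_re]
  ring

/-- The angle on the unit circle as a function of the arclength on the boundary. -/
lemma IsRiemannMap.exists_angle (hα : 0 < α) (hR : IsRiemannMap Ω F f) (hfc : Continuous f)
    (hf : MemF α ζc ζb f) (hne : ∀ z ∈ closedBall (0 : ℂ) 1, diskDeriv f z ≠ 0) {L : ℝ}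
    {c : ℝ → ℂ} (hc : IsArclengthParam Ω ζb L c) :
    ∃ θ : ℝ → ℝ, θ 0 = 0 ∧ θ L = 2 * Real.pi ∧
      (∀ s, f (Complex.exp (θ s * Complex.I)) = c s) ∧
      (∀ s, HasDerivAt θ (1 / ‖diskDeriv f (Complex.exp (θ s * Complex.I))‖) s) ∧
      ∀ s, (deriv c s / (Complex.I * Complex.exp (θ s * Complex.I) *
        diskDeriv f (Complex.exp (θ s * Complex.I)))).re =
          1 / ‖diskDeriv f (Complex.exp (θ s * Complex.I))‖ := by
  obtain ⟨E, hE⟩ := hR.exists_lift_boundary hfc hf hne hc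
  have hE1 : ∀ s, E s ∈ closedBall (0 : ℂ) 1 := fun s => by
    rw [mem_closedBall_zero_iff, (hE s).1]
  have hE0 : ∀ s, E s ≠ 0 := fun s => norm_ne_zero_iff.1 (by rw [(hE s).1]; exact one_ne_zero)
  have hEc : Continuous E := continuous_iff_continuousAt.2 fun s => (hE s).2.2.continuousAt
  have hgE : Continuous fun s => diskDeriv f (E s) :=
    (hf.continuousOn_diskDeriv hα).comp_continuous hEc hE1
  have hE00 : E 0 = 1 := by
    refine hf.injOn (hE1 0) (by simp) ?_
    rw [(hE 0).2.1, hc.base, hf.map_one]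
  -- The lift satisfies `E' = i A E`, so `E = exp (i ∫ A)`. Since `|E| = 1`, the integral and hence
  -- `A` are real; orientation makes `A ≥ 0`, and unit speed gives `A = 1 / |f'|`.
  set A : ℝ → ℂ := fun s => deriv c s / (Complex.I * E s * diskDeriv f (E s))
  have hAc : Continuous A := (hc.contDiff.continuous_deriv le_rfl).div
    ((continuous_const.mul hEc).mul hgE) fun s =>
      mul_ne_zero (mul_ne_zero Complex.I_ne_zero (hE0 s)) (hne _ (hE1 s))
  have hEA : ∀ s, deriv c s / diskDeriv f (E s) = Complex.I * A s * E s := by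
    intro s
    have h1 := hE0 s
    have h2 := hne _ (hE1 s)
    simp only [A]
    field_simp
  set Θ : ℝ → ℂ := fun s => ∫ x in (0 : ℝ)..s, A x
  have hΘ : ∀ s, HasDerivAt Θ (A s) s := fun s =>
    intervalIntegral.integral_hasDerivAt_right (hAc.intervalIntegrable _ _)
      (hAc.stronglyMeasurableAtFilter _ _) hAc.continuousAt
  have hΘ0 : Θ 0 = 0 := intervalIntegral.integral_same
  have hexp : ∀ s, E s = Complex.exp (Complex.I * Θ s) := by
    intro s
    have hd : ∀ s, HasDerivAt (fun s => E s * Complex.exp (-(Complex.I * Θ s))) 0 s := by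
      intro s
      have h1 := (hE s).2.2.fun_mul (((hΘ s).const_mul Complex.I).fun_neg.cexp)
      rwa [hEA, show Complex.I * A s * E s * Complex.exp (-(Complex.I * Θ s)) +
        E s * (Complex.exp (-(Complex.I * Θ s)) * -(Complex.I * A s)) = 0 by ring] at h1
    have h1 := is_const_of_deriv_eq_zero (fun s => (hd s).differentiableAt)
      (fun s => (hd s).deriv) s 0
    simp only [hΘ0, mul_zero, neg_zero, Complex.exp_zero, mul_one, hE00] at h1
    rw [Complex.exp_neg] at h1
    rwa [mul_inv_eq_one₀ (Complex.exp_ne_zero _)] at h1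
  have him : ∀ s, (Θ s).im = 0 := by
    intro s
    have h1 := (hE s).1
    rw [hexp s, Complex.norm_exp, Real.exp_eq_one_iff] at h1
    simpa using h1
  have hAim : ∀ s, (A s).im = 0 := by
    intro s
    have h1 := Complex.imCLM.hasFDerivAt.comp_hasDerivAt s (hΘ s)
    have h2 : Complex.imCLM ∘ Θ = fun _ => 0 := by ext s; exact him s
    rw [h2] at h1
    exact h1.unique (hasDerivAt_const s 0)
  have hEθ : ∀ s, Complex.exp ((Θ s).re * Complex.I) = E s := by
    intro s
    rw [hexp s, mul_comm]
    congr 2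
    apply Complex.ext <;> simp [him s]
  have hAre : ∀ s, (A s).re = 1 / ‖diskDeriv f (E s)‖ := by
    intro s
    have h1 := hR.re_nonneg_of_counterclockwise hfc hf hne hc (hE s).1 (hE s).2.1
    have h2 : A s = (((A s).re : ℝ) : ℂ) := by apply Complex.ext <;> simp [hAim s]
    have h3 : ‖A s‖ = 1 / ‖diskDeriv f (E s)‖ := by
      simp only [A]
      rw [norm_div, norm_mul, norm_mul, hc.unit_speed, (hE s).1, Complex.norm_I, one_mul, one_mul]
    rwa [h2, Complex.norm_real, Real.norm_of_nonneg h1] at h3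
  have hθd : ∀ s, HasDerivAt (fun s => (Θ s).re) (A s).re s := fun s =>
    Complex.reCLM.hasFDerivAt.comp_hasDerivAt s (hΘ s)
  have hmono : StrictMono fun s => (Θ s).re := strictMono_of_deriv_pos fun s => by
    rw [(hθd s).deriv, hAre s]
    exact one_div_pos.2 (norm_pos_iff.2 (hne _ (hE1 s)))
  have hcont : Continuous fun s => (Θ s).re :=
    continuous_iff_continuousAt.2 fun s => (hθd s).continuousAt
  have hfθ : ∀ s, f (Complex.exp ((Θ s).re * Complex.I)) = c s := fun s => by
    rw [hEθ]; exact (hE s).2.1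
  refine ⟨fun s => (Θ s).re, by simp [hΘ0], ?_, hfθ,
    fun s => by rw [hEθ, ← hAre s]; exact hθd s, fun s => by rw [hEθ, ← hAre s]⟩
  have hEL : Complex.exp ((Θ L).re * Complex.I) = 1 := by
    rw [hEθ, ← hE00]
    refine hf.injOn (hE1 L) (hE1 0) ?_
    rw [(hE L).2.1, (hE 0).2.1]
    simpa using hc.periodic 0
  -- The angle at `L` is a positive multiple of `2π`. If it exceeded `2π`, the angle would take the
  -- value `2π` before `L`, and `c` would return to `ζb` too early, contradicting injectivity on
  -- `[0, L)`.
  obtain ⟨n, hn⟩ := Complex.exp_eq_one_iff.1 hEL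
  have hn' : (Θ L).re = n * (2 * Real.pi) := by
    have := congrArg Complex.im hn
    simpa using this
  have hL := hc.length_pos
  have hπ := Real.pi_pos
  have hpos : 0 < (Θ L).re := by
    have := hmono hL
    simpa [hΘ0] using this
  have hn1 : 1 ≤ n := by
    by_contra hlt
    have : (n : ℝ) ≤ 0 := by exact_mod_cast (by omega : n ≤ 0)
    rw [hn'] at hpos
    nlinarith
  rcases hn1.eq_or_lt with rfl | hn2
  · simpa using hn'
  · exfalso
    have h2 : 2 * Real.pi < (Θ L).re := by
      have : (2 : ℝ) ≤ n := by exact_mod_cast hn2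
      rw [hn']; nlinarith
    obtain ⟨s, hs, hs2⟩ := intermediate_value_Ioo hL.le hcont.continuousOn
      (show 2 * Real.pi ∈ Ioo (Θ 0).re (Θ L).re from ⟨by simp [hΘ0, hπ], h2⟩)
    have h3 : c s = c 0 := by
      rw [← hfθ s, ← hfθ 0]
      simp only at hs2
      rw [hs2]
      simp [hΘ0, Complex.exp_two_pi_mul_I]
    exact hs.1.ne' (hc.injOn ⟨hs.1.le, hs.2⟩ (left_mem_Ico.2 hL) h3)

end GreenInverse

/-! ### The forward operator and the formula for `f'` -/

namespace GreenInverse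

open Set Metric Filter Topology Bornology

variable {α L : ℝ} {ζc ζb : ℂ} {Ω : Set ℂ} {F f : ℂ → ℂ} {φ : ℝ → ℝ}

lemma exp_mem_closedBall (x : ℝ) : Complex.exp (x * Complex.I) ∈ closedBall (0 : ℂ) 1 := by
  rw [mem_closedBall_zero_iff, Complex.norm_exp_ofReal_mul_I]

lemma MemF.continuous_norm_diskDeriv (hα : 0 < α) (hf : MemF α ζc ζb f) :
    Continuous fun x : ℝ => ‖diskDeriv f (Complex.exp (x * Complex.I))‖ :=
  ((hf.continuousOn_diskDeriv hα).comp_continuous (by fun_prop) exp_mem_closedBall).norm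

lemma MemF.hasDerivAt_arclength (hα : 0 < α) (hf : MemF α ζc ζb f) (x : ℝ) :
    HasDerivAt (arclength f) ‖diskDeriv f (Complex.exp (x * Complex.I))‖ x :=
  intervalIntegral.integral_hasDerivAt_right
    ((hf.continuous_norm_diskDeriv hα).intervalIntegrable _ _)
    ((hf.continuous_norm_diskDeriv hα).stronglyMeasurableAtFilter _ _)
    (hf.continuous_norm_diskDeriv hα).continuousAt

lemma arclength_zero (f : ℂ → ℂ) : arclength f 0 = 0 := intervalIntegral.integral_same

namespace IsForwardImage

lemma strictMonoOn (hα : 0 < α) (hf : MemF α ζc ζb f) (h : IsForwardImage f L φ) :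
    StrictMonoOn (arclength f) (Icc 0 (2 * Real.pi)) := by
  refine strictMonoOn_of_deriv_pos (convex_Icc _ _)
    (fun x _ => (hf.hasDerivAt_arclength hα x).continuousAt.continuousWithinAt) fun x hx => ?_
  rw [(hf.hasDerivAt_arclength hα x).deriv]
  exact norm_pos_iff.2 (h.2 x (interior_subset hx)).1

lemma image_Icc (hα : 0 < α) (hf : MemF α ζc ζb f) (h : IsForwardImage f L φ) {x : ℝ}
    (hx : x ∈ Icc 0 (2 * Real.pi)) : arclength f '' Icc 0 x = Icc 0 (arclength f x) := by
  have hmono := h.strictMonoOn hα hf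
  have hsub : Icc 0 x ⊆ Icc 0 (2 * Real.pi) := Icc_subset_Icc_right hx.2
  refine Subset.antisymm ?_ ?_
  · rintro _ ⟨y, hy, rfl⟩
    refine ⟨?_, hmono.monotoneOn (hsub hy) hx hy.2⟩
    rw [← arclength_zero f]
    exact hmono.monotoneOn ⟨le_rfl, hx.1.trans hx.2⟩ (hsub hy) hy.1
  · have := intermediate_value_Icc hx.1
      (f := arclength f) fun x _ => (hf.hasDerivAt_arclength hα x).continuousAt.continuousWithinAt
    rwa [arclength_zero] at this

lemma bijOn (hα : 0 < α) (hf : MemF α ζc ζb f) (h : IsForwardImage f L φ) :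
    BijOn (arclength f) (Icc 0 (2 * Real.pi)) (Icc 0 L) := by
  have h1 := h.image_Icc hα hf ⟨Real.two_pi_pos.le, le_rfl⟩
  rw [h.1] at h1
  rw [← h1]
  exact (h.strictMonoOn hα hf).injOn.bijOn_image

/-- After the substitution `s = s_f(t)` the integrand is `|f'| φ(s_f(t)) = 1/(2π)`, so `Φ` inverts
`s_f`. Change of variables along an injective map requires no regularity of `φ`. -/
lemma phi_arclength (hα : 0 < α) (hf : MemF α ζc ζb f) (h : IsForwardImage f L φ) {x : ℝ}
    (hx : x ∈ Icc 0 (2 * Real.pi)) : Phi φ (arclength f x) = x := by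
  have hsub : Icc 0 x ⊆ Icc 0 (2 * Real.pi) := Icc_subset_Icc_right hx.2
  have h0 : 0 ≤ arclength f x := by
    rw [← arclength_zero f]
    exact (h.strictMonoOn hα hf).monotoneOn ⟨le_rfl, hx.1.trans hx.2⟩ hx hx.1
  have h1 := MeasureTheory.integral_image_eq_integral_abs_deriv_smul (s := Icc 0 x)
    measurableSet_Icc (fun y _ => (hf.hasDerivAt_arclength hα y).hasDerivWithinAt)
    ((h.strictMonoOn hα hf).injOn.mono hsub) φ
  have h2 : ∫ y in Icc 0 x, |‖diskDeriv f (Complex.exp (y * Complex.I))‖| • φ (arclength f y) =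
      ∫ _ in Icc 0 x, 1 / (2 * Real.pi) := by
    refine MeasureTheory.setIntegral_congr_fun measurableSet_Icc fun y hy => ?_
    obtain ⟨h2, h3⟩ := h.2 y (hsub hy)
    have h4 := norm_pos_iff.2 h2
    rw [h3, smul_eq_mul, abs_of_pos h4]
    have := Real.pi_pos
    field_simp
  rw [h.image_Icc hα hf hx, h2] at h1
  rw [Phi, intervalIntegral.integral_of_le h0, ← MeasureTheory.integral_Icc_eq_integral_Ioc, h1,
    MeasureTheory.setIntegral_const]
  have := Real.pi_pos
  simp only [MeasureTheory.measureReal_def, Real.volume_Icc, sub_zero, smul_eq_mul,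
    ENNReal.toReal_ofReal hx.1]
  field_simp

lemma phi_bijOn (hα : 0 < α) (hf : MemF α ζc ζb f) (h : IsForwardImage f L φ) :
    BijOn (Phi φ) (Icc 0 L) (Icc 0 (2 * Real.pi)) := by
  have hb := h.bijOn hα hf
  refine ⟨fun s hs => ?_, fun s hs t ht hst => ?_, fun x hx => ?_⟩
  · obtain ⟨x, hx, rfl⟩ := hb.surjOn hs
    rwa [h.phi_arclength hα hf hx]
  · obtain ⟨x, hx, rfl⟩ := hb.surjOn hs
    obtain ⟨y, hy, rfl⟩ := hb.surjOn ht
    rw [h.phi_arclength hα hf hx, h.phi_arclength hα hf hy] at hst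
    rw [hst]
  · exact ⟨_, hb.mapsTo hx, h.phi_arclength hα hf hx⟩

lemma phiInv_eq (hα : 0 < α) (hf : MemF α ζc ζb f) (h : IsForwardImage f L φ) {x : ℝ}
    (hx : x ∈ Icc 0 (2 * Real.pi)) : PhiInv φ L x = arclength f x := by
  have hs := (h.phi_bijOn hα hf).surjOn hx
  refine (h.phi_bijOn hα hf).injOn (Function.invFunOn_mem hs) ((h.bijOn hα hf).mapsTo hx) ?_
  rw [h.phi_arclength hα hf hx]
  exact Function.invFunOn_eq hs

lemma pos (hα : 0 < α) (hf : MemF α ζc ζb f) (h : IsForwardImage f L φ) {s : ℝ}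
    (hs : s ∈ Icc 0 L) : 0 < φ s := by
  obtain ⟨x, hx, rfl⟩ := (h.bijOn hα hf).surjOn hs
  rw [(h.2 x hx).2]
  have := norm_pos_iff.2 (h.2 x hx).1
  have := Real.pi_pos
  positivity

lemma diskDeriv_ne_zero (hf : MemF α ζc ζb f) (h : IsForwardImage f L φ) {z : ℂ}
    (hz : z ∈ closedBall (0 : ℂ) 1) : diskDeriv f z ≠ 0 := by
  rcases (mem_closedBall_zero_iff.1 hz).lt_or_eq with hlt | heq
  · have hzb : z ∈ ball (0 : ℂ) 1 := mem_ball_zero_iff.2 hlt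
    rw [diskDeriv_eq_deriv hzb]
    exact deriv_ne_zero_of_injOn isOpen_ball (hf.differentiableOn.mono ball_subset_closedBall)
      (hf.injOn.mono ball_subset_closedBall) hzb
  · have h1 : Complex.exp (z.arg * Complex.I) = z := by
      have := Complex.norm_mul_exp_arg_mul_I z
      rwa [heq, Complex.ofReal_one, one_mul] at this
    have hπ := Complex.neg_pi_lt_arg z
    have hπ' := Complex.arg_le_pi z
    rcases le_or_gt 0 z.arg with h0 | h0
    · rw [← h1]
      exact (h.2 _ ⟨h0, by linarith⟩).1
    · have h2 := (h.2 (z.arg + 2 * Real.pi) ⟨by linarith, by linarith⟩).1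
      push_cast at h2
      rwa [add_mul, Complex.exp_add, Complex.exp_two_pi_mul_I, mul_one, h1] at h2

/-- Since `Φ⁻¹ = s_f`, the density `1 / (2π φ(s(t)))` is `|f'(e^{it})|`, and the exponent becomes
the Schwarz integral of `log |f'|`. -/
lemma outerExp_eq (hα : 0 < α) (hf : MemF α ζc ζb f) (h : IsForwardImage f L φ) (z : ℂ) :
    outerExp φ L z = Complex.exp (Real.circleAverage (fun ζ =>
      herglotzRieszKernel 0 z ζ • ((Real.log ‖diskDeriv f ζ‖ : ℝ) : ℂ)) 0 1) := by
  rw [outerExp, Real.circleAverage_def, Complex.real_smul, one_div]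
  congr 2
  refine intervalIntegral.integral_congr fun t ht => ?_
  rw [uIcc_of_le Real.two_pi_pos.le] at ht
  have hπ := Real.pi_pos
  have hn := norm_pos_iff.2 (h.2 t ht).1
  simp only [herglotzRieszKernel_def, circleMap_zero, sub_zero, smul_eq_mul, Complex.ofReal_one,
    one_mul]
  rw [h.phiInv_eq hα hf ht, (h.2 t ht).2]
  congr 4
  field_simp

end IsForwardImage

lemma re_circleAverage_herglotz_eq {u : ℂ → ℝ}
    (hu : InnerProductSpace.HarmonicContOnCl u (ball 0 1)) {w : ℂ} (hw : w ∈ ball (0 : ℂ) 1) :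
    (Real.circleAverage (fun ζ => herglotzRieszKernel 0 w ζ • (u ζ : ℂ)) 0 1).re = u w := by
  rw [re_circleAverage_herglotzRieszKernel_smul
    (circleIntegrable_of_continuousOn_sphere (hu.continuousOn_ball.mono sphere_subset_closedBall)) hw]
  exact hu.circleAverage_re_herglotzRieszKernel_smul hw

/-- The quotient is holomorphic with constant modulus `1`, so the maximum principle makes it a
unimodular constant. -/
lemma exists_eq_const_mul {p q : ℂ → ℂ} (hp : DifferentiableOn ℂ p (ball 0 1))
    (hq : DifferentiableOn ℂ q (ball 0 1)) (hq0 : ∀ z ∈ ball (0 : ℂ) 1, q z ≠ 0)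
    (h : ∀ z ∈ ball (0 : ℂ) 1, ‖p z‖ = ‖q z‖) :
    ∃ γ : ℝ, ∀ z ∈ ball (0 : ℂ) 1, p z = Complex.exp (γ * Complex.I) * q z := by
  have hn : ∀ z ∈ ball (0 : ℂ) 1, ‖p z / q z‖ = 1 := fun z hz => by
    rw [norm_div, h z hz, div_self (norm_ne_zero_iff.2 (hq0 z hz))]
  have h0 : (0 : ℂ) ∈ ball (0 : ℂ) 1 := mem_ball_self one_pos
  have h1 := Complex.eqOn_of_isPreconnected_of_isMaxOn_norm (f := fun z => p z / q z)
    (convex_ball (0 : ℂ) 1).isPreconnected isOpen_ball (hp.div hq hq0) h0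
    (fun z hz => by simp only [Function.comp_apply, mem_ofPred_eq]; rw [hn z hz, hn 0 h0])
  refine ⟨(p 0 / q 0).arg, fun z hz => ?_⟩
  have h2 := Complex.norm_mul_exp_arg_mul_I (p 0 / q 0)
  rw [hn 0 h0, Complex.ofReal_one, one_mul] at h2
  have h3 := h1 hz
  simp only [Function.const_apply] at h3
  rw [h2, ← h3, div_mul_cancel₀ _ (hq0 z hz)]

/-- `f'` is determined by `|f'|` on the unit circle. -/
lemma IsForwardImage.exists_deriv_eq (hα : 0 < α) (hf : MemF α ζc ζb f)
    (h : IsForwardImage f L φ) : ∃ γ : ℝ, ∀ z ∈ ball (0 : ℂ) 1,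
      deriv f z = Complex.exp (γ * Complex.I) * outerExp φ L z := by
  have hd : DifferentiableOn ℂ (deriv f) (ball 0 1) :=
    (hf.differentiableOn.mono ball_subset_closedBall).deriv isOpen_ball
  have hne : ∀ z ∈ closedBall (0 : ℂ) 1, diskDeriv f z ≠ 0 := fun z hz => h.diskDeriv_ne_zero hf hz
  have hlog : ContinuousOn (fun ζ => Real.log ‖diskDeriv f ζ‖) (closedBall 0 1) :=
    (hf.continuousOn_diskDeriv hα).norm.log fun z hz => norm_ne_zero_iff.2 (hne z hz)
  have hu : InnerProductSpace.HarmonicContOnCl (fun ζ => Real.log ‖diskDeriv f ζ‖) (ball 0 1) := by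
    refine ⟨fun z hz => ?_, by rwa [closure_ball _ one_ne_zero]⟩
    have hz0 := hne z (ball_subset_closedBall hz)
    rw [diskDeriv_eq_deriv hz] at hz0
    refine (InnerProductSpace.harmonicAt_congr_nhds (f₂ := fun ζ => Real.log ‖deriv f ζ‖) ?_).2
      ((hd.analyticOnNhd isOpen_ball z hz).harmonicAt_log_norm hz0)
    filter_upwards [isOpen_ball.mem_nhds hz] with w hw
    rw [diskDeriv_eq_deriv hw]
  have hS : DifferentiableOn ℂ (fun w => Real.circleAverage (fun ζ =>
      herglotzRieszKernel 0 w ζ • ((Real.log ‖diskDeriv f ζ‖ : ℝ) : ℂ)) 0 1) (ball 0 1) :=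
    differentiableOn_circleAverage_herglotzRieszKernel_smul
      (circleIntegrable_of_continuousOn_sphere
        (Complex.continuous_ofReal.comp_continuousOn (hlog.mono sphere_subset_closedBall)))
  have hfun : outerExp φ L = fun w => Complex.exp (Real.circleAverage (fun ζ =>
      herglotzRieszKernel 0 w ζ • ((Real.log ‖diskDeriv f ζ‖ : ℝ) : ℂ)) 0 1) :=
    funext fun w => h.outerExp_eq hα hf w
  rw [hfun]
  -- The modulus of the exponential is `exp` of the Poisson integral of `log |f'|`, which reproduces
  -- `|f'|` because `log |f'|` is harmonic inside and continuous up to the circle.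
  refine exists_eq_const_mul hd hS.cexp (fun z _ => Complex.exp_ne_zero _) fun z hz => ?_
  rw [Complex.norm_exp, re_circleAverage_herglotz_eq hu hz, Real.exp_log
    (norm_pos_iff.2 (hne z (ball_subset_closedBall hz))), diskDeriv_eq_deriv hz]

lemma MemF.integral_deriv (hα : 0 < α) (hf : MemF α ζc ζb f) :
    ∫ t in (0 : ℝ)..1, diskDeriv f (t : ℂ) = ζb - ζc := by
  have hin : ∀ t ∈ Icc (0 : ℝ) 1, (t : ℂ) ∈ closedBall (0 : ℂ) 1 := fun t ht => by
    rw [mem_closedBall_zero_iff, Complex.norm_real, Real.norm_of_nonneg ht.1]; exact ht.2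
  have h1 := intervalIntegral.integral_eq_sub_of_hasDerivAt_of_le (f := fun t : ℝ => f t)
    (f' := fun t : ℝ => diskDeriv f (t : ℂ)) zero_le_one
    (hf.differentiableOn.continuousOn.comp Complex.continuous_ofReal.continuousOn hin)
    (fun t ht => by
      have hb : (t : ℂ) ∈ ball (0 : ℂ) 1 := by
        rw [mem_ball_zero_iff, Complex.norm_real, Real.norm_of_nonneg ht.1.le]; exact ht.2
      exact ((hf.hasDerivWithinAt (ball_subset_closedBall hb)).hasDerivAt
        (mem_of_superset (isOpen_ball.mem_nhds hb) ball_subset_closedBall)).comp_ofReal)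
    (ContinuousOn.intervalIntegrable (by
      rw [uIcc_of_le zero_le_one]
      exact (hf.continuousOn_diskDeriv hα).comp Complex.continuous_ofReal.continuousOn hin))
  rw [h1]
  simp [hf.map_zero, hf.map_one]

lemma MemF.ne (hf : MemF α ζc ζb f) : ζb ≠ ζc := by
  rw [← hf.map_zero, ← hf.map_one]
  exact fun h => one_ne_zero (hf.injOn (by simp) (by simp) h)

/-- Integrating `f'` over `[0, 1]` shows that `γ₀` satisfies the condition. The integral of the
exponential is nonzero because `ζb ≠ ζc`, so the condition amounts to the value of `e^{iγ}`. -/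
lemma MemF.gammaCondition_iff (hα : 0 < α) (hf : MemF α ζc ζb f) {γ₀ : ℝ} (hγ₀ : ∀ z ∈ ball (0 : ℂ) 1,
      deriv f z = Complex.exp (γ₀ * Complex.I) * outerExp φ L z) (γ : ℝ) :
    GammaCondition ζc ζb φ L γ ↔ Complex.exp (γ * Complex.I) = Complex.exp (γ₀ * Complex.I) := by
  have h1 : Complex.exp (γ₀ * Complex.I) * ∫ t in (0 : ℝ)..1, outerExp φ L (t : ℂ) = ζb - ζc := by
    rw [← hf.integral_deriv hα, ← intervalIntegral.integral_const_mul,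
      intervalIntegral.integral_of_le zero_le_one, intervalIntegral.integral_of_le zero_le_one,
      -- The endpoint `t = 1` is dropped: the formula for `f'` is known only in the open disk.
      MeasureTheory.integral_Ioc_eq_integral_Ioo, MeasureTheory.integral_Ioc_eq_integral_Ioo]
    refine MeasureTheory.setIntegral_congr_fun measurableSet_Ioo fun t ht => ?_
    have hb : (t : ℂ) ∈ ball (0 : ℂ) 1 := by
      rw [mem_ball_zero_iff, Complex.norm_real, Real.norm_of_nonneg ht.1.le]; exact ht.2
    rw [diskDeriv_eq_deriv hb, hγ₀ _ hb]
  have h2 : ∫ t in (0 : ℝ)..1, outerExp φ L (t : ℂ) ≠ 0 := by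
    intro h0
    rw [h0, mul_zero] at h1
    exact sub_ne_zero.2 hf.ne h1.symm
  rw [GammaCondition, ← h1]
  exact mul_left_inj' h2

lemma IsForwardImage.existsUnique_gamma (hα : 0 < α) (hf : MemF α ζc ζb f)
    (h : IsForwardImage f L φ) :
    ∃! γ : ℝ, γ ∈ Ico 0 (2 * Real.pi) ∧ GammaCondition ζc ζb φ L γ := by
  obtain ⟨γ₀, hγ₀⟩ := h.exists_deriv_eq hα hf
  have hπ := Real.two_pi_pos
  refine ⟨toIcoMod hπ 0 γ₀, ⟨?_, (hf.gammaCondition_iff hα hγ₀ _).2 ?_⟩, fun γ ⟨hγ, hγ'⟩ => ?_⟩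
  · simpa using toIcoMod_mem_Ico hπ 0 γ₀
  · refine Complex.exp_eq_exp_iff_exists_int.2 ⟨-toIcoDiv hπ 0 γ₀, ?_⟩
    rw [← self_sub_toIcoDiv_zsmul]
    push_cast [zsmul_eq_mul]
    ring
  · obtain ⟨n, hn⟩ := Complex.exp_eq_exp_iff_exists_int.1
      ((hf.gammaCondition_iff hα hγ₀ γ).1 hγ')
    have hn' : γ₀ = γ - n * (2 * Real.pi) := by
      have := congrArg Complex.im hn
      simp at this
      linarith
    rw [hn', ← zsmul_eq_mul, toIcoMod_sub_zsmul, (toIcoMod_eq_self hπ).2 (by simpa using hγ)]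

/-- The map `𝒯` is injective. -/
lemma IsForwardImage.eqOn {g : ℂ → ℂ} (hα : 0 < α) (hf : MemF α ζc ζb f) (hg : MemF α ζc ζb g)
    (h : IsForwardImage f L φ) (h' : IsForwardImage g L φ) : EqOn f g (closedBall 0 1) := by
  obtain ⟨γ₁, h₁⟩ := h.exists_deriv_eq hα hf
  obtain ⟨γ₂, h₂⟩ := h'.exists_deriv_eq hα hg
  -- The condition on `γ` involves only `φ`, `ζc` and `ζb`, so `γ₁`, obtained from `f`, also
  -- satisfies it for `g`.
  have hγ : Complex.exp (γ₁ * Complex.I) = Complex.exp (γ₂ * Complex.I) :=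
    (hg.gammaCondition_iff hα h₂ γ₁).1 ((hf.gammaCondition_iff hα h₁ γ₁).2 rfl)
  have hfd := hf.differentiableOn.mono (ball_subset_closedBall (x := (0 : ℂ)) (ε := 1))
  have hgd := hg.differentiableOn.mono (ball_subset_closedBall (x := (0 : ℂ)) (ε := 1))
  have hb : EqOn f g (ball 0 1) := isOpen_ball.eqOn_of_deriv_eq
    (convex_ball (0 : ℂ) 1).isPreconnected hfd hgd
    (fun z hz => by rw [h₁ z hz, h₂ z hz, hγ]) (mem_ball_self one_pos)
    (by rw [hf.map_zero, hg.map_zero])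
  refine hb.of_subset_closure hf.differentiableOn.continuousOn hg.differentiableOn.continuousOn
    ball_subset_closedBall ?_
  rw [closure_ball _ one_ne_zero]

end GreenInverse

/-! ### Assembly of the theorem -/

namespace GreenInverse

open Set Metric Filter Topology Bornology

lemma IsRiemannMap.image_ball {Ω : Set ℂ} {F f : ℂ → ℂ} (hR : IsRiemannMap Ω F f) :
    f '' ball 0 1 = Ω :=
  Subset.antisymm (image_subset_iff.2 hR.mapsTo)
    fun ζ hζ => ⟨F ζ, hR.mapsToF hζ, hR.left_inv ζ hζ⟩

/-- The conformal map of a domain of the class `𝒪` solves `𝒯(f) = φ`. -/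
lemma MemO.exists_isForwardImage {α L : ℝ} {ζc ζb : ℂ} {Ω : Set ℂ} {φ : ℝ → ℝ} (hα : 0 < α)
    (hα1 : α < 1) (hΩ : MemO α ζc ζb Ω) (hφ : IsGreenNormalDeriv ζc ζb Ω L φ) :
    ContinuousOn φ (Icc 0 L) ∧
      ∃ f : ℂ → ℂ, MemF α ζc ζb f ∧ f '' ball 0 1 = Ω ∧ IsForwardImage f L φ := by
  obtain ⟨F, f, hR, hfc, hf, hne⟩ := hΩ.exists_conformal hα hα1
  obtain ⟨U, c, hU, hc, hv⟩ := hφ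
  obtain ⟨θ, hθ0, hθL, hfθ, hθd, hA⟩ := hR.exists_angle hα hfc hf hne hc
  have hφθ : ∀ s ∈ Icc 0 L,
      φ s = 1 / (2 * Real.pi) * (1 / ‖diskDeriv f (Complex.exp (θ s * Complex.I))‖) := by
    intro s hs
    rw [← hA s]
    exact hR.green_normal_deriv hfc hf hne hc (Complex.norm_exp_ofReal_mul_I _) (hfθ s) hU (hv s hs)
  have hθc : Continuous θ := continuous_iff_continuousAt.2 fun s => (hθd s).continuousAt
  have hpos : ∀ x : ℝ, 0 < ‖diskDeriv f (Complex.exp (x * Complex.I))‖ := fun x =>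
    norm_pos_iff.2 (hne _ (exp_mem_closedBall x))
  -- The derivative of the left side is `|f'| · (1 / |f'|) = 1`: the boundary angle inverts `s_f`.
  have harc : ∀ s, arclength f (θ s) = s := by
    intro s
    have hd : ∀ s, HasDerivAt (fun s => arclength f (θ s) - s) 0 s := by
      intro s
      have h1 := ((hf.hasDerivAt_arclength hα (θ s)).comp s (hθd s)).fun_sub (hasDerivAt_id s)
      rw [mul_one_div_cancel (hpos _).ne', sub_self] at h1
      exact h1
    have h1 := is_const_of_deriv_eq_zero (fun s => (hd s).differentiableAt)
      (fun s => (hd s).deriv) s 0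
    simp only [hθ0, arclength_zero, sub_self] at h1
    exact sub_eq_zero.1 h1
  refine ⟨?_, f, hf, hR.image_ball, by rw [← hθL, harc], fun x hx =>
    ⟨hne _ (exp_mem_closedBall x), ?_⟩⟩
  · refine ContinuousOn.congr (Continuous.continuousOn ?_) hφθ
    exact continuous_const.mul (continuous_const.div
      ((hf.continuous_norm_diskDeriv hα).comp hθc) fun s => (hpos _).ne')
  · have h1 := intermediate_value_Icc hc.length_pos.le hθc.continuousOn
    rw [hθ0, hθL] at h1
    obtain ⟨s, hs, rfl⟩ := h1 hx
    rw [harc, hφθ s hs, one_div_mul_one_div]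

end GreenInverse

open GreenInverse
theorem theorem2p2 (α : ℝ) (hα₀ : 0 < α) (hα₁ : α < 1) (ζc ζb : ℂ) :
    (∀ (Ω : Set ℂ), MemO α ζc ζb Ω → ∀ (L : ℝ) (φ : ℝ → ℝ), IsGreenNormalDeriv ζc ζb Ω L φ →
      ContinuousOn φ (Set.Icc 0 L) ∧ (∀ s ∈ Set.Icc 0 L, 0 < φ s) ∧
      Set.BijOn (Phi φ) (Set.Icc 0 L) (Set.Icc 0 (2 * Real.pi)) ∧
      (∃! γ : ℝ, γ ∈ Set.Ico 0 (2 * Real.pi) ∧ GammaCondition ζc ζb φ L γ) ∧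
      ∃ f : ℂ → ℂ, MemF α ζc ζb f ∧ f '' Metric.ball 0 1 = Ω ∧ IsForwardImage f L φ ∧
        (∀ g : ℂ → ℂ, MemF α ζc ζb g → IsForwardImage g L φ →
          Set.EqOn g f (Metric.closedBall 0 1)) ∧
        ∀ γ : ℝ, GammaCondition ζc ζb φ L γ →
          ∀ z ∈ Metric.ball (0 : ℂ) 1, deriv f z = Complex.exp (γ * Complex.I) * outerExp φ L z) ∧
    (∀ Ω₁ Ω₂ : Set ℂ, MemO α ζc ζb Ω₁ → MemO α ζc ζb Ω₂ → ∀ (L : ℝ) (φ : ℝ → ℝ),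
      IsGreenNormalDeriv ζc ζb Ω₁ L φ → IsGreenNormalDeriv ζc ζb Ω₂ L φ → Ω₁ = Ω₂) ∧
    (∀ f g : ℂ → ℂ, MemF α ζc ζb f → MemF α ζc ζb g → ∀ (L : ℝ) (φ : ℝ → ℝ),
      IsForwardImage f L φ → IsForwardImage g L φ → Set.EqOn f g (Metric.closedBall 0 1)) := by
  refine ⟨fun Ω hΩ L φ hφ => ?_, fun Ω₁ Ω₂ h₁ h₂ L φ hφ₁ hφ₂ => ?_,
    fun f g hf hg L φ h h' => h.eqOn hα₀ hf hg h'⟩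
  · obtain ⟨hcont, f, hf, himg, hfor⟩ := hΩ.exists_isForwardImage hα₀ hα₁ hφ
    refine ⟨hcont, fun s hs => hfor.pos hα₀ hf hs, hfor.phi_bijOn hα₀ hf,
      hfor.existsUnique_gamma hα₀ hf, f, hf, himg, hfor,
      fun g hg hgfor => hgfor.eqOn hα₀ hg hf hfor, fun γ hγ z hz => ?_⟩
    obtain ⟨γ₀, hγ₀⟩ := hfor.exists_deriv_eq hα₀ hf
    rw [(hf.gammaCondition_iff hα₀ hγ₀ γ).1 hγ]
    exact hγ₀ z hz
  · obtain ⟨-, f₁, hf₁, himg₁, hfor₁⟩ := h₁.exists_isForwardImage hα₀ hα₁ hφ₁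
    obtain ⟨-, f₂, hf₂, himg₂, hfor₂⟩ := h₂.exists_isForwardImage hα₀ hα₁ hφ₂
    -- Each domain is the image of the disk under a solution of `𝒯(f) = φ`, and that solution is
    -- unique on the closed disk.
    rw [← himg₁, ← himg₂]
    exact ((hfor₁.eqOn hα₀ hf₁ hf₂ hfor₂).mono Metric.ball_subset_closedBall).image_eq
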